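/- **Conventions.** Rings are associative, not necessarily unital. An *odd form ring* $(R,\Delta)$ consists of a ring $R$ with an involution $x\mapsto\bar x$ (additive, $\overline{xy}=\bar y\,\bar x$, $\bar{\bar x}=x$), a group $\Delta$ (written additively with $\dotplus$, not necessarily commutative) with a right action $u\cdot x$ of the multiplicative semigroup of $R$ by group endomorphisms, and maps $\phi\colon R\to\Delta$, $\pi,\rho\colon\Delta\to R$ such that - $\pi$ and $\phi$ are group homomorphisms, $\pi(u\cdot x)=\pi(u)x$, $\phi(\bar x y x)=\phi(y)\cdot x$, and $\phi(x)=\dot 0$ if $\bar x=x$; - $u\dotplus\phi(x)=\phi(x)\dotplus u$ and $u\dotplus v=v\dotplus u\dotplus\phi(-\overline{\pi(u)}\pi(v))$; - $\rho(u\dotplus v)=\rho(u)-\overline{\pi(u)}\pi(v)+\rho(v)$, $\overline{\rho(u)}=\rho(\dotminus u)$, $\rho(u\cdot x)=\bar x\rho(u)x$; - $\pi(\phi(x))=0$, $\rho(\phi(x))=x-\bar x$, and $u\cdot(x+y)=u\cdot x\dotplus\phi(\bar y\rho(u)x)\dotplus u\cdot y$. (Here $\dotminus u$ denotes the inverse of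 $u$.) The unitary group $\mathrm U(R,\Delta)$ is the set of pairs $g=(\beta(g),\gamma(g))\in R\times\Delta$ with $\beta\bar\beta+\beta+\bar\beta=\bar\beta\beta+\beta+\bar\beta=0$, $\pi(\gamma)=\beta$, $\rho(\gamma)=\bar\beta$, with product $\beta(gh)=\beta(g)\beta(h)+\beta(g)+\beta(h)$, $\gamma(gh)=\gamma(g)\cdot\beta(h)\dotplus\gamma(h)\dotplus\gamma(g)$. A *hyperbolic pair* is $\eta=(e_-,e_+,q_-,q_+)$ with orthogonal idempotents $e_\pm\in R$, $\bar e_+=e_-$, and $q_\pm\in\Delta$, $\pi(q_\pm)=e_\pm$, $\rho(q_\pm)=0$, $q_\pm\cdot e_\pm=q_\pm$. A *free orthogonal hyperbolic family* of rank $n$ consists of hyperbolic pairs $\eta_i=(e_{-i},e_i,q_{-i},q_i)$, $1\le i\le n$, such that the idempotents $e_{-i}+e_i$ are pairwise orthogonal and there are $e_{ij}\in R$ $(1\le i,j\le n)$ with $e_{ii}=e_i$ and $e_{ij}e_{jk}=e_{ik}$. Put $R_{ij}=e_iRe_j$, $R_1=e_1Re_1$ (a ring with identity $e_1$), $\Delta^0=\{u\in\Delta\mid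 e_i\pi(u)=0\text{ for all }0<|i|\le n\}$ and $\Delta^0_k=\Delta^0\cdot e_k$. The *elementary transvections* are the elements of $\mathrm U(R,\Delta)$ - $T_{ij}(x)$ for $0<|i|,|j|\le n$, $i\ne\pm j$, $x\in R_{ij}$, with $\beta=x-\bar x$, $\gamma=q_i\cdot x\dotplus q_{-j}\cdot(-\bar x)\dotminus\phi(x)$; - $T_k(u)$ for $0<|k|\le n$, $u\in\Delta^0_k$, with $\beta=\rho(u)+\pi(u)-\overline{\pi(u)}$, $\gamma=q_{-k}\cdot(\rho(u)-\overline{\pi(u)})\dotplus u\dotminus\phi(\rho(u)+\pi(u))$. For $m\le n$ let $\mathrm U(m;R,\Delta)$ be the subgroup of those $g\in\mathrm U(R,\Delta)$ with $e_i\beta(g)=\beta(g)e_i=0$ and $\gamma(g)\cdot e_i=\dot0$ whenever $m<|i|\le n$, let $\mathrm E(m;R,\Delta)$ be the subgroup generated by all $T_{ij}(x)$, $T_k(u)$ with $|i|,|j|,|k|\le m$, and let $\mathrm{KU}_1(m;R,\Delta)=\mathrm U(m;R,\Delta)/\mathrm E(m;R,\Delta)$ (a pointed set of left cosets). An *odd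 form ideal* $(I,\Gamma)\trianglelefteq(R,\Delta)$ is a two-sided ideal $I=\bar I$ of $R$ and a normal subgroup $\Gamma$ of $\Delta$ with $\Gamma\cdot R\subseteq\Gamma$, $\Delta\cdot I\subseteq\Gamma$, $\phi(I)\subseteq\Gamma$, $\pi(\Gamma)\subseteq I$, $\rho(\Gamma)\subseteq I$. Let $\mathrm U(m;I,\Gamma)=\{g\in\mathrm U(m;R,\Delta)\mid\beta(g)\in I,\gamma(g)\in\Gamma\}$, let $\mathrm E(m;R,\Delta;I,\Gamma)$ be the smallest subgroup of $\mathrm U(R,\Delta)$ normalized by $\mathrm E(m;R,\Delta)$ and containing all $T_{ij}(x)$, $T_k(u)$ with $|i|,|j|,|k|\le m$, $x\in I\cap R_{ij}$, $u\in\Gamma\cap\Delta^0_k$, and let $\mathrm{KU}_1(m;R,\Delta;I,\Gamma)=\mathrm U(m;I,\Gamma)/\mathrm E(m;R,\Delta;I,\Gamma)$. Let $I\rtimes R$ be the group $I\oplus R$ with multiplication $(x,y)(x',y')=(xx'+xy'+yx',yy')$, and $(I\rtimes R)_1=(0,e_1)(I\rtimes R)(0,e_1)$, a ring with identity $(0,e_1)$.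 For a unital ring $A$ and an integer $m\ge0$, $\mathrm{sr}(A)\le m$ means: whenever $x_1,\dots,x_{m+1}\in A$ satisfy $\sum_i y_ix_i=1$ for some $y_i\in A$, there are $a_1,\dots,a_m\in A$ and $z_1,\dots,z_m\in A$ with $\sum_{i\le m}z_i(x_i+a_ix_{m+1})=1$. **Theorem.** Let $(R,\Delta)$ be an odd form ring with a free orthogonal hyperbolic family of rank $n\ge2$. 1. If $\mathrm{sr}(R_1)\le n-2$, then the natural map $\mathrm{KU}_1(n-1;R,\Delta)\to\mathrm{KU}_1(n;R,\Delta)$ is injective. 2. If $(I,\Gamma)\trianglelefteq(R,\Delta)$ is an odd form ideal and $\mathrm{sr}((I\rtimes R)_1)\le n-2$ (with no assumption on $\mathrm{sr}(R_1)$), then the natural map $\mathrm{KU}_1(n-1;R,\Delta;I,\Gamma)\to\mathrm{KU}_1(n;R,\Delta;I,\Gamma)$ is injective. -/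

import Mathlib

/-- An odd form ring `(R, Δ)`. The ring `R` has an involution and need not be unital; the group `Δ`
is written additively but need not be commutative; `act u x` is the right action `u · x` of the
multiplicative semigroup of `R` on the group `Δ`. -/
class OddFormRing (R : Type*) (Δ : Type*) [NonUnitalRing R] [StarRing R] [AddGroup Δ] where
  act : Δ → R → Δ
  φ : R → Δ
  π : Δ → R
  ρ : Δ → R
  act_mul : ∀ u x y, act u (x * y) = act (act u x) y
  add_act : ∀ u v x, act (u + v) x = act u x + act v x
  π_add : ∀ u v, π (u + v) = π u + π v
  π_act : ∀ u x, π (act u x) = π u * x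
  φ_add : ∀ x y, φ (x + y) = φ x + φ y
  φ_conj : ∀ x y, φ (star x * y * x) = act (φ y) x
  φ_hermitian : ∀ x, star x = x → φ x = 0
  add_φ : ∀ u x, u + φ x = φ x + u
  add_swap : ∀ u v, u + v = v + u + φ (-(star (π u) * π v))
  ρ_add : ∀ u v, ρ (u + v) = ρ u - star (π u) * π v + ρ v
  star_ρ : ∀ u, star (ρ u) = ρ (-u)
  ρ_act : ∀ u x, ρ (act u x) = star x * ρ u * x
  π_φ : ∀ x, π (φ x) = 0
  ρ_φ : ∀ x, ρ (φ x) = x - star x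
  act_add : ∀ u x y, act u (x + y) = act u x + φ (star y * ρ u * x) + act u y

namespace OddFormRing

section Basic

variable {R Δ : Type*} [NonUnitalRing R] [StarRing R] [AddGroup Δ] [OddFormRing R Δ]

lemma zero_act (x : R) : act (0 : Δ) x = 0 := by
  have h := add_act (R := R) (0 : Δ) 0 x
  simpa using h

lemma neg_act (u : Δ) (x : R) : act (-u) x = -act u x := by
  have h := add_act (R := R) (-u) u x
  rw [neg_add_cancel, zero_act] at h
  exact eq_neg_of_add_eq_zero_left h.symm

lemma φ_zero : φ (0 : R) = (0 : Δ) := φ_hermitian _ (star_zero _)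

lemma φ_neg (x : R) : φ (-x) = -(φ x : Δ) := by
  have h := φ_add (Δ := Δ) (-x) x
  rw [neg_add_cancel, φ_zero] at h
  exact eq_neg_of_add_eq_zero_left h.symm

lemma act_zero (u : Δ) : act u (0 : R) = 0 := by
  have h := act_add u (0 : R) 0
  simpa [φ_zero] using h

lemma π_zero : π (0 : Δ) = (0 : R) := by
  have h := π_add (R := R) (0 : Δ) 0
  simpa using h

lemma π_neg (u : Δ) : π (-u) = -(π u : R) := by
  have h := π_add (R := R) (-u) u
  rw [neg_add_cancel, π_zero] at h
  exact eq_neg_of_add_eq_zero_left h.symm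

lemma ρ_zero : ρ (0 : Δ) = (0 : R) := by
  have h := ρ_add (R := R) (0 : Δ) 0
  simpa [π_zero] using h

end Basic

end OddFormRing

open OddFormRing

/-- The unitary group `U(R, Δ)`: pairs `(β, γ)` such that `α = β + 1` satisfies `α⁻¹ = star α`,
and `π γ = β`, `ρ γ = star β`. -/
@[ext]
structure OddUnitary (R Δ : Type*) [NonUnitalRing R] [StarRing R] [AddGroup Δ]
    [OddFormRing R Δ] where
  β : R
  γ : Δ
  mul_star : β * star β + β + star β = 0
  star_mul : star β * β + β + star β = 0
  π_γ : π γ = β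
  ρ_γ : ρ γ = star β

namespace OddUnitary

section GroupStructure

variable {R Δ : Type*} [NonUnitalRing R] [StarRing R] [AddGroup Δ] [OddFormRing R Δ]

instance : One (OddUnitary R Δ) where
  one := ⟨0, 0, by simp, by simp, π_zero, by simp [ρ_zero]⟩

/-- The product is given by `α (gh) = α g * α h` and `γ (gh) = γ g · α h + γ h`. Since
`α h = β h + 1`, these formulas read `β (gh) = β g * β h + β g + β h` and
`γ (gh) = γ g · β h + γ h + γ g`. -/
instance : Mul (OddUnitary R Δ) where
  mul g h :=
    { β := g.β * h.β + g.β + h.β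
      γ := act g.γ h.β + h.γ + g.γ
      mul_star := by
        have h1 := g.mul_star
        have h2 := h.mul_star
        have e1 : g.β * star g.β = -g.β - star g.β := by
          rw [← sub_eq_zero, ← h1]; abel
        have e2 : h.β * star h.β = -h.β - star h.β := by
          rw [← sub_eq_zero, ← h2]; abel
        have e4 : g.β * h.β * star h.β = - (g.β * h.β) - g.β * star h.β := by
          rw [mul_assoc, e2]; noncomm_ring
        simp only [star_add, StarMul.star_mul, mul_add, add_mul, sub_mul, neg_mul, e1, e2, e4,
          ← mul_assoc]
        abel
      star_mul := by
        have h1 := g.star_mul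
        have h2 := h.star_mul
        have e1 : star g.β * g.β = -g.β - star g.β := by
          rw [← sub_eq_zero, ← h1]; abel
        have e2 : star h.β * h.β = -h.β - star h.β := by
          rw [← sub_eq_zero, ← h2]; abel
        have e4 : star h.β * star g.β * g.β = - (star h.β * g.β) - star h.β * star g.β := by
          rw [mul_assoc, e1]; noncomm_ring
        simp only [star_add, StarMul.star_mul, mul_add, add_mul, sub_mul, neg_mul, e1, e2, e4,
          ← mul_assoc]
        abel
      π_γ := by
        rw [π_add, π_add, π_act, g.π_γ, h.π_γ]; abel
      ρ_γ := by
        have h1 := g.star_mul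
        have e1 : star g.β * g.β = -g.β - star g.β := by
          rw [← sub_eq_zero, ← h1]; abel
        have e4 : star h.β * star g.β * g.β = - (star h.β * g.β) - star h.β * star g.β := by
          rw [mul_assoc, e1]; noncomm_ring
        simp only [ρ_add, π_add, π_act, ρ_act, g.π_γ, h.π_γ, g.ρ_γ, h.ρ_γ, star_add,
          StarMul.star_mul, add_mul, e4]
        abel }

/-- The inverse, given by `α (g⁻¹) = star (α g)`. -/
instance : Inv (OddUnitary R Δ) where
  inv g :=
    { β := star g.β
      γ := -(g.γ + act g.γ (star g.β))
      mul_star := by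
        rw [star_star, add_assoc, add_comm (star g.β) g.β, ← add_assoc]; exact g.star_mul
      star_mul := by
        rw [star_star, add_assoc, add_comm (star g.β) g.β, ← add_assoc]; exact g.mul_star
      π_γ := by
        rw [π_neg, π_add, π_act, g.π_γ, eq_comm, ← sub_eq_zero, ← g.mul_star]; abel
      ρ_γ := by
        have e1 : g.β * star g.β = star g.β * g.β := by
          have h1 := g.star_mul
          rw [← g.mul_star] at h1
          simpa using h1.symm
        have e2 : star g.β * (g.β * star g.β) = g.β * star g.β * star g.β := by
          rw [← mul_assoc, ← e1]
        rw [← star_ρ, ρ_add, ρ_act, π_act, g.π_γ, g.ρ_γ, e2]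
        simp }

lemma β_one : (1 : OddUnitary R Δ).β = 0 := rfl
lemma γ_one : (1 : OddUnitary R Δ).γ = 0 := rfl
lemma β_mul (g h : OddUnitary R Δ) : (g * h).β = g.β * h.β + g.β + h.β := rfl
lemma γ_mul (g h : OddUnitary R Δ) : (g * h).γ = act g.γ h.β + h.γ + g.γ := rfl
lemma β_inv (g : OddUnitary R Δ) : (g⁻¹).β = star g.β := rfl
lemma γ_inv (g : OddUnitary R Δ) : (g⁻¹).γ = -(g.γ + act g.γ (star g.β)) := rfl

lemma γ_mul_assoc (g h k : OddUnitary R Δ) : (g * h * k).γ = (g * (h * k)).γ := by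
  have sw : ∀ (u v w : Δ), w + u + v = w + v + u + φ (-(star (π u) * π v) : R) := by
    intro u v w
    rw [add_assoc, add_swap (R := R) u v, ← add_assoc, ← add_assoc]
  have pull : ∀ (u v : Δ) (x : R), u + φ x + v = u + v + φ x := by
    intro u v x
    rw [add_assoc, ← add_φ, ← add_assoc]
  have fold : ∀ (u : Δ) (x y : R), u + φ x + φ y = u + φ (x + y) := by
    intro u x y
    rw [add_assoc, ← φ_add]
  have herm : ∀ x y : R, star (x - y) = x - y → (φ x : Δ) = φ y := by
    intro x y hxy
    have := φ_add (Δ := Δ) (x - y) y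
    rwa [sub_add_cancel, φ_hermitian _ hxy, zero_add] at this
  have h1 := g.star_mul
  have e1 : star g.β * g.β = -g.β - star g.β := by
    rw [← sub_eq_zero, ← h1]; abel
  simp only [γ_mul, β_mul, act_add, add_act, ← act_mul]
  set A := act g.γ (h.β * k.β)
  set B := act h.γ k.β
  set C := act g.γ k.β
  set D := act g.γ h.β
  have hB : (π B : R) = h.β * k.β := by rw [π_act, h.π_γ]
  have hC : (π C : R) = g.β * k.β := by rw [π_act, g.π_γ]
  have hD : (π D : R) = g.β * h.β := by rw [π_act, g.π_γ]
  have L : A + B + C + k.γ + (D + h.γ + g.γ) = A + D + C + B + k.γ + h.γ + g.γ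
      + φ (-(star (π B) * π C) + (-(star (π B) * π D) + (-(star (π C) * π D)
        + -(star (π k.γ) * π D))) : R) := by
    rw [← add_assoc, ← add_assoc, sw k.γ D, pull _ h.γ, pull _ g.γ, sw C D, pull _ k.γ, pull _ h.γ,
      pull _ g.γ, sw B D, pull _ C, pull _ k.γ, pull _ h.γ, pull _ g.γ, sw B C, pull _ k.γ,
      pull _ h.γ, pull _ g.γ]
    rw [fold, fold, fold]
  rw [L]
  rw [← add_assoc, ← add_assoc, pull _ D, fold, pull _ C, pull _ (B + k.γ + h.γ), pull _ g.γ,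
    ← add_assoc (A + D + C) (B + k.γ) h.γ, ← add_assoc (A + D + C) B k.γ]
  congr 1
  apply herm
  rw [hB, hC, hD, k.π_γ, g.ρ_γ]
  have e2 : ∀ z : R, star k.β * star g.β * g.β * z
      = -(star k.β * g.β * z) - star k.β * star g.β * z := by
    intro z
    rw [mul_assoc (star k.β), e1]; noncomm_ring
  simp only [StarMul.star_mul, star_add, star_sub, star_neg, star_star, mul_add,
    ← mul_assoc, e2]
  abel

instance : Group (OddUnitary R Δ) :=
  Group.ofRightAxioms
    (by
      intro g h k
      refine OddUnitary.ext ?_ (γ_mul_assoc g h k)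
      simp only [β_mul, mul_add, add_mul, mul_assoc]
      abel)
    (by
      intro g
      refine OddUnitary.ext ?_ ?_
      · simp [β_mul, β_one]
      · simp [γ_mul, β_one, γ_one, act_zero])
    (by
      intro g
      refine OddUnitary.ext ?_ ?_
      · exact g.mul_star
      · rw [γ_mul, β_inv, γ_inv, neg_add_rev, γ_one]
        simp [← add_assoc])

end GroupStructure

end OddUnitary

/-- A hyperbolic pair `η = (e₋, e₊, q₋, q₊)` in an odd form ring. -/
structure HyperbolicPair (R Δ : Type*) [NonUnitalRing R] [StarRing R] [AddGroup Δ]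
    [OddFormRing R Δ] where
  eNeg : R
  ePos : R
  qNeg : Δ
  qPos : Δ
  eNeg_idem : eNeg * eNeg = eNeg
  ePos_idem : ePos * ePos = ePos
  eNeg_mul_ePos : eNeg * ePos = 0
  ePos_mul_eNeg : ePos * eNeg = 0
  star_ePos : star ePos = eNeg
  π_qNeg : π qNeg = eNeg
  ρ_qNeg : ρ qNeg = (0 : R)
  act_qNeg : act qNeg eNeg = qNeg
  π_qPos : π qPos = ePos
  ρ_qPos : ρ qPos = (0 : R)
  act_qPos : act qPos ePos = qPos

/-- A free orthogonal hyperbolic family `η₁, …, ηₙ` (indexed here by `Fin n`): pairwise orthogonal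
hyperbolic pairs that are coherently isomorphic, that is, there are `e_{ij}` with `e_{ii} = e_i` and
`e_{ij} e_{jk} = e_{ik}`. The pairs of such a family are automatically Morita equivalent,
see `FreeHyperbolicFamily.morita`. -/
structure FreeHyperbolicFamily (R Δ : Type*) [NonUnitalRing R] [StarRing R] [AddGroup Δ]
    [OddFormRing R Δ] (n : ℕ) where
  pair : Fin n → HyperbolicPair R Δ
  orthogonal : ∀ i j, i ≠ j →
    ((pair i).eNeg + (pair i).ePos) * ((pair j).eNeg + (pair j).ePos) = 0
  free : ∃ E : Fin n → Fin n → R,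
    (∀ i, E i i = (pair i).ePos) ∧ ∀ i j k, E i j * E j k = E i k

/-- The signed indices `±1, …, ±n`; the index `±(k + 1)` is `(k, true)`, resp. `(k, false)`. -/
abbrev SignedIndex (n : ℕ) : Type := Fin n × Bool

/-- The index `-i`. -/
def SignedIndex.opp {n : ℕ} (i : SignedIndex n) : SignedIndex n := (i.1, !i.2)

namespace FreeHyperbolicFamily

section Family

variable {R Δ : Type*} [NonUnitalRing R] [StarRing R] [AddGroup Δ] [OddFormRing R Δ] {n : ℕ}
  (η : FreeHyperbolicFamily R Δ n)

/-- The idempotents `e_i` for `i = ±1, …, ±n`. -/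
def e (i : SignedIndex n) : R := if i.2 then (η.pair i.1).ePos else (η.pair i.1).eNeg

/-- The elements `q_i` for `i = ±1, …, ±n`. -/
def q (i : SignedIndex n) : Δ := if i.2 then (η.pair i.1).qPos else (η.pair i.1).qNeg

/-- The idempotent `e_{|k|} = e_{-k} + e_k`. -/
def eAbs (k : Fin n) : R := η.e (k, false) + η.e (k, true)

lemma e_idem (i : SignedIndex n) : η.e i * η.e i = η.e i := by
  rcases i with ⟨k, _ | _⟩
  · simpa [e] using (η.pair k).eNeg_idem
  · simpa [e] using (η.pair k).ePos_idem

lemma star_e (i : SignedIndex n) : star (η.e i) = η.e i.opp := by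
  rcases i with ⟨k, _ | _⟩
  · simp [e, SignedIndex.opp, ← (η.pair k).star_ePos]
  · simpa [e, SignedIndex.opp] using (η.pair k).star_ePos

lemma π_q (i : SignedIndex n) : π (η.q i) = η.e i := by
  rcases i with ⟨k, _ | _⟩
  · simpa [e, q] using (η.pair k).π_qNeg
  · simpa [e, q] using (η.pair k).π_qPos

lemma ρ_q (i : SignedIndex n) : ρ (η.q i) = (0 : R) := by
  rcases i with ⟨k, _ | _⟩
  · simpa [q] using (η.pair k).ρ_qNeg
  · simpa [q] using (η.pair k).ρ_qPos

lemma e_mul_e_opp (i : SignedIndex n) : η.e i * η.e i.opp = 0 := by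
  rcases i with ⟨k, _ | _⟩
  · simpa [e, SignedIndex.opp] using (η.pair k).eNeg_mul_ePos
  · simpa [e, SignedIndex.opp] using (η.pair k).ePos_mul_eNeg

lemma e_mul_eAbs (i : SignedIndex n) : η.e i * η.eAbs i.1 = η.e i := by
  rcases i with ⟨k, _ | _⟩
  · simp [eAbs, mul_add, e_idem, show η.e (k, false) * η.e (k, true) = 0 from e_mul_e_opp η _]
  · simp [eAbs, mul_add, e_idem, show η.e (k, true) * η.e (k, false) = 0 from e_mul_e_opp η _]

lemma eAbs_mul_e (i : SignedIndex n) : η.eAbs i.1 * η.e i = η.e i := by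
  rcases i with ⟨k, _ | _⟩
  · simp [eAbs, add_mul, e_idem, show η.e (k, true) * η.e (k, false) = 0 from e_mul_e_opp η _]
  · simp [eAbs, add_mul, e_idem, show η.e (k, false) * η.e (k, true) = 0 from e_mul_e_opp η _]

lemma eAbs_mul_eAbs {i j : Fin n} (h : i ≠ j) : η.eAbs i * η.eAbs j = 0 := by
  simpa [eAbs, e] using η.orthogonal i j h

lemma e_mul_e {i j : SignedIndex n} (h : i ≠ j) : η.e i * η.e j = 0 := by
  by_cases h1 : i.1 = j.1
  · have : j = i.opp := by
      rcases i with ⟨i, a⟩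
      rcases j with ⟨j, b⟩
      obtain rfl : i = j := h1
      cases a <;> cases b <;> simp_all [SignedIndex.opp]
    rw [this, e_mul_e_opp]
  · rw [← e_mul_eAbs η i, ← eAbs_mul_e η j, mul_assoc, ← mul_assoc (η.eAbs i.1),
      eAbs_mul_eAbs η h1]
    simp

/-- The pairs of a free orthogonal hyperbolic family are Morita equivalent:
`e_{|i|} ∈ e_{|i|} R e_{|j|} R e_{|i|}`. -/
lemma morita (i j : Fin n) :
    ∃ x y : R, (η.eAbs i * x * η.eAbs j) * (η.eAbs j * y * η.eAbs i) = η.eAbs i := by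
  obtain ⟨E, h1, h2⟩ := η.free
  have hE : ∀ k, E k k = η.e (k, true) := fun k => by simp [h1, e]
  have hs : ∀ k, star (E k k) = η.e (k, false) := fun k => by
    rw [hE, star_e]; rfl
  have a1 : ∀ k l, η.eAbs k * E k l = E k l := fun k l => by
    rw [← h2 k k l, ← mul_assoc, hE, eAbs_mul_e η (k, true)]
  have a2 : ∀ k l, E k l * η.eAbs l = E k l := fun k l => by
    rw [← h2 k l l, mul_assoc, hE, e_mul_eAbs η (l, true)]
  have hst : ∀ k, star (η.eAbs k) = η.eAbs k := fun k => by
    rw [eAbs, star_add, star_e, star_e, add_comm]; rfl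
  have a3 : ∀ k l, η.eAbs l * star (E k l) = star (E k l) := fun k l => by
    have := congrArg star (a2 k l)
    rwa [star_mul, hst] at this
  have a4 : ∀ k l, star (E k l) * η.eAbs k = star (E k l) := fun k l => by
    have := congrArg star (a1 k l)
    rwa [star_mul, hst] at this
  have c1 : E i j * star (E i j) = 0 := by
    rw [← h2 i j j, star_mul, mul_assoc, ← mul_assoc (E j j), hs, hE,
      e_mul_e η (show ((j, true) : SignedIndex n) ≠ (j, false) by simp)]
    simp
  have c2 : star (E j i) * E j i = 0 := by
    rw [← h2 j j i, star_mul, mul_assoc, ← mul_assoc (star (E j j)), hs, hE,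
      e_mul_e η (show ((j, false) : SignedIndex n) ≠ (j, true) by simp)]
    simp
  refine ⟨E i j + star (E j i), E j i + star (E i j), ?_⟩
  simp only [mul_add, add_mul, a1, a2, a3, a4]
  rw [h2 i j i, ← star_mul, h2 i j i, hE, c1, c2, ← hE, hs]
  simp [eAbs, hE, add_comm]

/-- The Peirce component `R_{ij} = e_i R e_j`. -/
def peirce (i j : SignedIndex n) : Set R := {x | η.e i * x * η.e j = x}

/-- The subset `Δ⁰ = {u | π u ∈ e₀ R}` of `Δ`, where `e₀ = 1 - ∑ e_i` is the complementary
idempotent; `π u ∈ e₀ R` means that `e_i * π u = 0` for all `i = ±1, …, ±n`. -/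
def delta0 : Set Δ := {u | ∀ i, η.e i * π u = 0}

/-- The subset `Δ⁰_k = Δ⁰ · e_k` of `Δ⁰`. -/
def delta0At (k : SignedIndex n) : Set Δ := {u | u ∈ η.delta0 ∧ act u (η.e k) = u}

lemma mem_peirce_left {i j : SignedIndex n} {x : R} (hx : x ∈ η.peirce i j) : η.e i * x = x := by
  have hx' : η.e i * x * η.e j = x := hx
  rw [← hx', ← mul_assoc, ← mul_assoc, e_idem]

lemma mem_peirce_right {i j : SignedIndex n} {x : R} (hx : x ∈ η.peirce i j) :
    x * η.e j = x := by
  have hx' : η.e i * x * η.e j = x := hx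
  rw [← hx', mul_assoc, e_idem]

lemma peirce_mul_zero {i j k l : SignedIndex n} {x y : R} (hx : x ∈ η.peirce i j)
    (hy : y ∈ η.peirce k l) (h : j ≠ k) : x * y = 0 := by
  rw [← mem_peirce_right η hx, ← mem_peirce_left η hy, mul_assoc, ← mul_assoc (η.e j),
    e_mul_e η h]
  simp

lemma star_mem_peirce {i j : SignedIndex n} {x : R} (hx : x ∈ η.peirce i j) :
    star x ∈ η.peirce j.opp i.opp := by
  have hx' : η.e i * x * η.e j = x := hx
  change η.e j.opp * star x * η.e i.opp = star x
  conv_rhs => rw [← hx']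
  rw [star_mul, star_mul, star_e, star_e, mul_assoc]

/-- The transvection `T_{ij}(x)` of short root type, for `i ≠ ±j` and `x ∈ R_{ij}`. It is given by
`β = x - star x` and `γ⁰ = -φ x`; as `γ` is the sum of `γ⁰` and of the `γ^l = q_l · β` for
`l = ±1, …, ±n`, this means `γ = q_i · x + q_{-j} · (-star x) - φ x`. -/
def shortTransvection (i j : SignedIndex n) (hij : i.1 ≠ j.1) (x : R) (hx : x ∈ η.peirce i j) :
    OddUnitary R Δ :=
  have hji : j ≠ i := fun h => hij (by rw [h])
  have hjio : j ≠ i.opp := fun h => hij (by rw [h]; rfl)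
  have hji2 : j.opp ≠ i.opp := fun h => hij (congrArg Prod.fst h).symm
  have hx2 := η.star_mem_peirce hx
  have xx : x * x = 0 := η.peirce_mul_zero hx hx hji
  have ss : star x * star x = 0 := by rw [← star_mul, xx, star_zero]
  have xs : x * star x = 0 := η.peirce_mul_zero hx hx2 (by
    intro h
    rcases j with ⟨j, b⟩
    cases b <;> simp [SignedIndex.opp] at h)
  have sx : star x * x = 0 := η.peirce_mul_zero hx2 hx (by
    intro h
    rcases i with ⟨j, b⟩
    cases b <;> simp [SignedIndex.opp] at h)
  { β := x - star x
    γ := act (η.q i) x + act (η.q j.opp) (-star x) - φ x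
    mul_star := by
      simp [mul_sub, sub_mul, xx, ss, xs, sx]
    star_mul := by
      simp [mul_sub, sub_mul, xx, ss, xs, sx]
    π_γ := by
      rw [sub_eq_add_neg, π_add, π_add, π_neg, π_φ, π_act, π_act, π_q, π_q,
        η.mem_peirce_left hx, mul_neg, η.mem_peirce_left hx2]
      simp [sub_eq_add_neg]
    ρ_γ := by
      rw [sub_eq_add_neg, ← φ_neg, ρ_add, ρ_add, π_φ, ρ_φ, ρ_act, ρ_act, ρ_q, ρ_q, π_act, π_act,
        π_q, π_q, η.mem_peirce_left hx, mul_neg (η.e j.opp), η.mem_peirce_left hx2, mul_neg, ss]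
      simp [sub_eq_add_neg, add_comm] }

lemma mem_delta0At_π {k : SignedIndex n} {u : Δ} (hu : u ∈ η.delta0At k) :
    (π u : R) * η.e k = π u := by
  conv_rhs => rw [← hu.2]
  rw [π_act]

lemma mem_delta0At_ρ {k : SignedIndex n} {u : Δ} (hu : u ∈ η.delta0At k) :
    (ρ u : R) ∈ η.peirce k.opp k := by
  change η.e k.opp * ρ u * η.e k = ρ u
  conv_rhs => rw [← hu.2]
  rw [ρ_act, star_e]

/-- The transvection `T_k(u)` of ultrashort root type, for `u ∈ Δ⁰_k`. It is given by
`β = ρ u + π u - star (π u)` and `γ⁰ = u - φ (ρ u + π u)`; as `γ` is the sum of `γ⁰` and of the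
`γ^l = q_l · β` for `l = ±1, …, ±n`, this means
`γ = q_{-k} · (ρ u - star (π u)) + u - φ (ρ u + π u)`. -/
def ultrashortTransvection (k : SignedIndex n) (u : Δ) (hu : u ∈ η.delta0At k) :
    OddUnitary R Δ :=
  have hk : k ≠ k.opp := by
    rcases k with ⟨j, b⟩
    cases b <;> simp [SignedIndex.opp]
  have p1 : (π u : R) * η.e k = π u := η.mem_delta0At_π hu
  have p0 : ∀ i, η.e i * π u = 0 := hu.1
  have s0 : ∀ i, star (π u : R) * η.e i = 0 := fun i => by
    have h := congrArg star (p0 i.opp)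
    rw [star_mul, star_e, star_zero] at h
    have h2 : i.opp.opp = i := by
      rcases i with ⟨j, b⟩
      simp [SignedIndex.opp]
    rwa [h2] at h
  have s1 : η.e k.opp * star (π u : R) = star (π u) := by
    have h := congrArg star p1
    rwa [star_mul, star_e] at h
  have r1 := η.mem_delta0At_ρ hu
  have ra : η.e k.opp * (ρ u : R) = ρ u := η.mem_peirce_left r1
  have rb : (ρ u : R) * η.e k = ρ u := η.mem_peirce_right r1
  have ta : η.e k.opp * star (ρ u : R) = star (ρ u) := by
    have h := congrArg star rb
    rwa [star_mul, star_e] at h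
  have tb : star (ρ u : R) * η.e k = star (ρ u) := by
    have h := congrArg star ra
    rw [star_mul, star_e] at h
    have h2 : k.opp.opp = k := by
      rcases k with ⟨j, b⟩
      simp [SignedIndex.opp]
    rwa [h2] at h
  have z : ∀ x y : R, x * η.e k = x → η.e k.opp * y = y → x * y = 0 := fun x y hx hy => by
    rw [← hx, ← hy, mul_assoc, ← mul_assoc (η.e k), η.e_mul_e hk]
    simp
  have zp : ∀ x : R, x * η.e k = x → x * π u = 0 := fun x hx => by
    rw [← hx, mul_assoc, p0, mul_zero]
  have zs : ∀ x : R, η.e k.opp * x = x → star (π u : R) * x = 0 := fun x hx => by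
    rw [← hx, ← mul_assoc, s0, zero_mul]
  have key : (ρ u : R) + star (ρ u) + star (π u : R) * π u = 0 := by
    have h := ρ_add (R := R) (-u) u
    rw [neg_add_cancel, ρ_zero, ← star_ρ, π_neg] at h
    rw [h]
    simp
    abel
  { β := ρ u + π u - star (π u)
    γ := act (η.q k.opp) (ρ u - star (π u)) + u - φ (ρ u + π u : R)
    mul_star := by
      simp only [star_add, star_sub, star_star, mul_add, add_mul, mul_sub, sub_mul,
        z _ _ rb ta, z _ _ rb s1, zp _ rb, z _ _ p1 ta, z _ _ p1 s1, zp _ p1, zs _ ta, zs _ s1]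
      rw [← key]
      abel
    star_mul := by
      simp only [star_add, star_sub, star_star, mul_add, add_mul, mul_sub, sub_mul,
        z _ _ tb ra, z _ _ tb s1, zp _ tb, z _ _ p1 ra, z _ _ p1 s1, zp _ p1, zs _ ra, zs _ s1]
      rw [← key]
      abel
    π_γ := by
      rw [sub_eq_add_neg, ← φ_neg, π_add, π_add, π_φ, π_act, π_q, mul_sub, ra, s1]
      abel
    ρ_γ := by
      rw [sub_eq_add_neg, ← φ_neg, ρ_add, ρ_add, π_φ, ρ_φ, ρ_act, ρ_q, π_act, π_q, mul_sub (η.e k.opp), ra, s1,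
        star_sub, star_star, sub_mul (star (ρ u)) (π u) (π u : R), zp _ tb, zp _ p1]
      simp
      abel }

/-- The index `i = ±1, …, ±n` satisfies `|i| ≤ m`. -/
def IdxLE (m : ℕ) (i : SignedIndex n) : Prop := i.1.val < m

/-- The subgroup `U(m; R, Δ)` of `U(n; R, Δ) = U(R, Δ)` for `m ≤ n`: all `g` such that
`e_i β(g) = 0`, `β(g) e_i = 0` and `γ(g) · e_i = 0` for all `i` with `m < |i| ≤ n`. -/
def U (m : ℕ) : Subgroup (OddUnitary R Δ) where
  carrier := {g | ∀ i : SignedIndex n, ¬ IdxLE m i →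
    η.e i * g.β = 0 ∧ g.β * η.e i = 0 ∧ act g.γ (η.e i) = 0}
  one_mem' := fun i _ => by
    simp [OddUnitary.β_one, OddUnitary.γ_one, zero_act]
  mul_mem' := by
    intro g h hg hh i hi
    obtain ⟨a1, a2, a3⟩ := hg i hi
    obtain ⟨b1, b2, b3⟩ := hh i hi
    refine ⟨?_, ?_, ?_⟩
    · rw [OddUnitary.β_mul, mul_add, mul_add, ← mul_assoc, a1, b1]; simp
    · rw [OddUnitary.β_mul, add_mul, add_mul, mul_assoc, a2, b2]; simp
    · rw [OddUnitary.γ_mul, add_act, add_act, ← act_mul, b2, act_zero, a3, b3]; simp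
  inv_mem' := by
    intro g hg i hi
    obtain ⟨a1, a2, a3⟩ := hg i hi
    obtain ⟨b1, b2, b3⟩ := hg i.opp hi
    have hoo : i.opp.opp = i := by simp [SignedIndex.opp]
    have c1 : η.e i * star g.β = 0 := by
      rw [← hoo, ← star_e, ← star_mul, b2, star_zero]
    have c2 : star g.β * η.e i = 0 := by
      rw [← hoo, ← star_e, ← star_mul, b1, star_zero]
    refine ⟨c1, c2, ?_⟩
    rw [OddUnitary.γ_inv, neg_act, add_act, ← act_mul, c2, a3, act_zero]; simp

/-- The generators of `E(m; R, Δ)`: the transvections `T_{ij}(x)` and `T_k(u)` with indices of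
absolute value at most `m`. -/
def elementaryGenerators (m : ℕ) : Set (OddUnitary R Δ) :=
  {g | ∃ (i j : SignedIndex n) (hij : i.1 ≠ j.1) (x : R) (hx : x ∈ η.peirce i j),
      IdxLE m i ∧ IdxLE m j ∧ g = η.shortTransvection i j hij x hx} ∪
  {g | ∃ (k : SignedIndex n) (u : Δ) (hu : u ∈ η.delta0At k),
      IdxLE m k ∧ g = η.ultrashortTransvection k u hu}

/-- The elementary unitary group `E(m; R, Δ)`. -/
def E (m : ℕ) : Subgroup (OddUnitary R Δ) := Subgroup.closure (η.elementaryGenerators m)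

lemma U_mono {m m' : ℕ} (h : m ≤ m') : η.U m ≤ η.U m' :=
  fun _ hg i hi => hg i (fun hi' => hi (lt_of_lt_of_le hi' h))

lemma elementaryGenerators_mono {m m' : ℕ} (h : m ≤ m') :
    η.elementaryGenerators m ⊆ η.elementaryGenerators m' := by
  rintro g (⟨i, j, hij, x, hx, h1, h2, rfl⟩ | ⟨k, u, hu, h1, rfl⟩)
  · exact Or.inl ⟨i, j, hij, x, hx, lt_of_lt_of_le h1 h, lt_of_lt_of_le h2 h, rfl⟩
  · exact Or.inr ⟨k, u, hu, lt_of_lt_of_le h1 h, rfl⟩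

lemma E_mono {m m' : ℕ} (h : m ≤ m') : η.E m ≤ η.E m' :=
  Subgroup.closure_mono (η.elementaryGenerators_mono h)

/-- The pointed set `KU₁(m; R, Δ) = U(m; R, Δ) / E(m; R, Δ)` of left cosets. -/
abbrev KU (m : ℕ) : Type _ := η.U m ⧸ (η.E m).subgroupOf (η.U m)

/-- The stabilization map `KU₁(m; R, Δ) → KU₁(m'; R, Δ)`, sending the class of `g` to the class
of `g`. -/
def KU.map {m m' : ℕ} (h : m ≤ m') : η.KU m → η.KU m' :=
  Quotient.map' (Subgroup.inclusion (η.U_mono h)) (by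
    intro a b hab
    rw [QuotientGroup.leftRel_apply, Subgroup.mem_subgroupOf] at hab ⊢
    exact η.E_mono h hab)

end Family

end FreeHyperbolicFamily

/-- An odd form ideal `(I, Γ)` of an odd form ring `(R, Δ)`. -/
structure OddFormIdeal (R Δ : Type*) [NonUnitalRing R] [StarRing R] [AddGroup Δ]
    [OddFormRing R Δ] where
  I : TwoSidedIdeal R
  Γ : AddSubgroup Δ
  normal : Γ.Normal
  star_mem : ∀ x ∈ I, star x ∈ I
  act_mem : ∀ u ∈ Γ, ∀ x : R, act u x ∈ Γ
  act_mem_of_mem : ∀ u : Δ, ∀ x ∈ I, act u x ∈ Γ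
  φ_mem : ∀ x ∈ I, φ x ∈ Γ
  π_mem : ∀ u ∈ Γ, π u ∈ I
  ρ_mem : ∀ u ∈ Γ, ρ u ∈ I

/-- The unitary group `U(I, Γ)`, as a subgroup of `U(R, Δ)`. -/
def OddFormIdeal.unitary {R Δ : Type*} [NonUnitalRing R] [StarRing R] [AddGroup Δ]
    [OddFormRing R Δ] (J : OddFormIdeal R Δ) : Subgroup (OddUnitary R Δ) where
  carrier := {g | g.β ∈ J.I ∧ g.γ ∈ J.Γ}
  one_mem' := ⟨J.I.zero_mem, J.Γ.zero_mem⟩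
  mul_mem' := by
    rintro g h ⟨a1, a2⟩ ⟨b1, b2⟩
    exact ⟨J.I.add_mem (J.I.add_mem (J.I.mul_mem_left _ _ b1) a1) b1,
      J.Γ.add_mem (J.Γ.add_mem (J.act_mem _ a2 _) b2) a2⟩
  inv_mem' := by
    rintro g ⟨a1, a2⟩
    exact ⟨J.star_mem _ a1, J.Γ.neg_mem (J.Γ.add_mem a2 (J.act_mem _ a2 _))⟩

namespace FreeHyperbolicFamily

section Relative

variable {R Δ : Type*} [NonUnitalRing R] [StarRing R] [AddGroup Δ] [OddFormRing R Δ] {n : ℕ}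
  (η : FreeHyperbolicFamily R Δ n) (J : OddFormIdeal R Δ)

/-- The group `U(m; I, Γ) = U(m; R, Δ) ∩ U(I, Γ)`. -/
def relU (m : ℕ) : Subgroup (OddUnitary R Δ) := η.U m ⊓ J.unitary

/-- The elementary transvections from `U(I, Γ)` with indices of absolute value at most `m`. -/
def relGenerators (m : ℕ) : Set (OddUnitary R Δ) :=
  {g | ∃ (i j : SignedIndex n) (hij : i.1 ≠ j.1) (x : R) (hx : x ∈ η.peirce i j),
      IdxLE m i ∧ IdxLE m j ∧ x ∈ J.I ∧ g = η.shortTransvection i j hij x hx} ∪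
  {g | ∃ (k : SignedIndex n) (u : Δ) (hu : u ∈ η.delta0At k),
      IdxLE m k ∧ u ∈ J.Γ ∧ g = η.ultrashortTransvection k u hu}

/-- The relative elementary group `E(m; R, Δ; I, Γ)`: the smallest subgroup that contains the
elementary transvections from `U(I, Γ)` (of rank `m`) and is normalized by `E(m; R, Δ)`. -/
def relE (m : ℕ) : Subgroup (OddUnitary R Δ) :=
  Subgroup.closure {g | ∃ a ∈ η.E m, ∃ t ∈ η.relGenerators J m, g = a * t * a⁻¹}

lemma relU_mono {m m' : ℕ} (h : m ≤ m') : η.relU J m ≤ η.relU J m' :=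
  inf_le_inf_right _ (η.U_mono h)

lemma relE_mono {m m' : ℕ} (h : m ≤ m') : η.relE J m ≤ η.relE J m' := by
  refine Subgroup.closure_mono ?_
  rintro g ⟨a, ha, t, ht, rfl⟩
  refine ⟨a, η.E_mono h ha, t, ?_, rfl⟩
  rcases ht with ⟨i, j, hij, x, hx, h1, h2, h3, rfl⟩ | ⟨k, u, hu, h1, h2, rfl⟩
  · exact Or.inl ⟨i, j, hij, x, hx, lt_of_lt_of_le h1 h, lt_of_lt_of_le h2 h, h3, rfl⟩
  · exact Or.inr ⟨k, u, hu, lt_of_lt_of_le h1 h, h2, rfl⟩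

/-- The pointed set `KU₁(m; R, Δ; I, Γ) = U(m; I, Γ) / E(m; R, Δ; I, Γ)` of left cosets. -/
abbrev relKU (m : ℕ) : Type _ := η.relU J m ⧸ (η.relE J m).subgroupOf (η.relU J m)

/-- The stabilization map `KU₁(m; R, Δ; I, Γ) → KU₁(m'; R, Δ; I, Γ)`, sending the class of `g` to
the class of `g`. -/
def relKU.map {m m' : ℕ} (h : m ≤ m') : η.relKU J m → η.relKU J m' :=
  Quotient.map' (Subgroup.inclusion (η.relU_mono J h)) (by
    intro a b hab
    rw [QuotientGroup.leftRel_apply, Subgroup.mem_subgroupOf] at hab ⊢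
    exact η.relE_mono J h hab)

end Relative

end FreeHyperbolicFamily

/-- A finite sequence `x` in a unital ring is right unimodular if `∑ y_i x_i = 1` for some `y`. -/
def RightUnimodular {A : Type*} [Ring A] {k : ℕ} (x : Fin k → A) : Prop :=
  ∃ y : Fin k → A, ∑ i, y i * x i = 1

/-- The condition `sr(A) ≤ m`: each right unimodular sequence `x_1, …, x_{m+1}` can be shortened,
i.e. `x_1 + a_1 x_{m+1}, …, x_m + a_m x_{m+1}` is right unimodular for some `a_1, …, a_m`. -/
def StableRankLE (A : Type*) [Ring A] (m : ℕ) : Prop :=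
  ∀ x : Fin (m + 1) → A, RightUnimodular x →
    ∃ a : Fin m → A, RightUnimodular fun i => x i.castSucc + a i * x (Fin.last m)

/-- The semidirect product ring `I ⋊ R` of a ring `R` and a two-sided ideal `I`: the group
`I ⊕ R` with the multiplication `(x, y) (x', y') = (x x' + x y' + y x', y y')`. -/
def IdealSemidirect {R : Type*} [NonUnitalRing R] (I : TwoSidedIdeal R) : Type _ := I × R

namespace IdealSemidirect

section

variable {R : Type*} [NonUnitalRing R] (I : TwoSidedIdeal R)

instance : AddCommGroup (IdealSemidirect I) := inferInstanceAs (AddCommGroup (I × R))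

instance : Mul (IdealSemidirect I) where
  mul a b :=
    (⟨a.1.1 * b.1.1 + a.1.1 * b.2 + a.2 * b.1.1,
      I.add_mem (I.add_mem (I.mul_mem_left _ _ b.1.2) (I.mul_mem_right _ _ a.1.2))
        (I.mul_mem_left _ _ b.1.2)⟩, a.2 * b.2)

lemma ext' {a b : IdealSemidirect I} (h1 : a.1.1 = b.1.1) (h2 : a.2 = b.2) : a = b :=
  Prod.ext (Subtype.ext h1) h2

lemma mul_fst (a b : IdealSemidirect I) :
    (a * b).1.1 = a.1.1 * b.1.1 + a.1.1 * b.2 + a.2 * b.1.1 := rfl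

lemma mul_snd (a b : IdealSemidirect I) : (a * b).2 = a.2 * b.2 := rfl

lemma add_fst (a b : IdealSemidirect I) : (a + b).1.1 = a.1.1 + b.1.1 := rfl

lemma add_snd (a b : IdealSemidirect I) : (a + b).2 = a.2 + b.2 := rfl

lemma zero_fst : (0 : IdealSemidirect I).1.1 = 0 := rfl

lemma zero_snd : (0 : IdealSemidirect I).2 = 0 := rfl

instance : NonUnitalRing (IdealSemidirect I) where
  left_distrib a b c := by
    apply ext' <;> simp only [mul_fst, mul_snd, add_fst, add_snd, mul_add]
    abel
  right_distrib a b c := by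
    apply ext' <;> simp only [mul_fst, mul_snd, add_fst, add_snd, add_mul]
    abel
  zero_mul a := by
    apply ext' <;> simp [mul_fst, mul_snd, zero_fst, zero_snd]
  mul_zero a := by
    apply ext' <;> simp [mul_fst, mul_snd, zero_fst, zero_snd]
  mul_assoc a b c := by
    apply ext' <;> simp only [mul_fst, mul_snd, mul_add, add_mul, mul_assoc]
    abel

/-- The diagonal embedding `d : R → I ⋊ R`, `d y = (0, y)`. -/
def diag (y : R) : IdealSemidirect I := (0, y)

lemma diag_idem {y : R} (h : IsIdempotentElem y) : IsIdempotentElem (diag I y) := by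
  apply ext'
  · rw [mul_fst]; simp [diag]
  · exact h

end

end IdealSemidirect

namespace FreeHyperbolicFamily

section Corner

variable {R Δ : Type*} [NonUnitalRing R] [StarRing R] [AddGroup Δ] [OddFormRing R Δ] {n : ℕ}
  (η : FreeHyperbolicFamily R Δ n)

lemma ePos_idem (k : Fin n) : IsIdempotentElem (η.e (k, true)) := η.e_idem _

/-- For `k = i - 1`, the ring `R_i = e_i R e_i` with the identity element `e_i`. -/
abbrev cornerRing (k : Fin n) : Type _ := (η.ePos_idem k).Corner

/-- For `k = i - 1`, the ring `(I ⋊ R)_i = d(e_i) (I ⋊ R) d(e_i)` with the identity element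
`d(e_i) = (0, e_i)`. -/
abbrev relCornerRing (J : OddFormIdeal R Δ) (k : Fin n) : Type _ :=
  (IdealSemidirect.diag_idem J.I (η.ePos_idem k)).Corner

end Corner

end FreeHyperbolicFamily

/-! Both assertions reduce to one intersection property: an element of the unitary group of rank `n
- 1` that is elementary in rank `n` is already elementary in rank `n - 1` (`U_inf_E_pred_le`, and
`relU_inf_relE_pred_le` for ideals). The proof uses a decomposition of Dennis–Vaserstein type.

Calculations take place in the ring `R ⊕ Δ / φ(R)`. A unitary element is determined by its image
there (`mat_injective`), the `q_i` become idempotents over the `e_i`, and the commutator relations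
between transvections become identities between products of matrix entries.

A weight on the signed indices gives a unipotent radical (roots of positive weight) normalized by a
Levi subgroup (roots of weight zero), see `levi_le_normalizer`. Three weights are needed. The line
weight belongs to the line of index `n`; its Levi subgroup is `E(n - 1)`, and its parabolic subgroup
is called `P` here. The flag weight belongs to the flag spanned by `2, …, n` and by `1, …, n`; its
parabolic subgroup is `Q`, and its Levi subgroup is a linear elementary group on `2, …, n`. The tail
weight belongs to the span of `3, …, n`.

The group `E(n)` is generated by `Q` and by opposite root elements in the Levi subgroup of the tail
(`E_le_sup`). With `X` the intersection of the unipotent radicals opposite to the line and to the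
flag, `E(n) = Q X P` (`exists_decomposition`): it suffices that `Q X P` is stable under left
multiplication by those opposite elements. Stable rank enters in `exists_reduce`, which changes the
linear part of an element of `Q` until the entry `(n, 2)` of its inverse vanishes. Then the part of
the radical of `Q` that gets in the way is conjugated into `E(n - 1)` (`unipotentCorner_conj_mem`)
and can be moved to the right into `P`.

Let `q x p` be trivial at the index `n`. Comparing columns `n` gives `x = 1`, because the column of
an element of `Q` lies in the span of `2, …, n`, where that of `x - 1` vanishes. What is left is a
linear element fixing the last basis vector; a Weyl element that exchanges `n` with the unused index
`1` commutes with it and conjugates it into `E(n - 1)` (`levi_inf_U_le`).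

The relative statement is the absolute one for the fibre product of `(R, Δ)` with itself over the
quotient by `(I, Γ)`, whose ring is isomorphic to `I ⋊ R`. The relative elementary group consists of
the first components of elementary elements with trivial second component (`exists_of_mem_relE`,
`of_mem_E_diagFamily`). -/

namespace OddFormRing

/-! ### Classes modulo `φ(R)` and the model ring -/

/-- The image of `φ`, a central subgroup of `Δ`. -/
def φRange (R Δ : Type*) [NonUnitalRing R] [StarRing R] [AddGroup Δ] [OddFormRing R Δ] :
    AddSubgroup Δ where
  carrier := Set.range (φ : R → Δ)
  zero_mem' := ⟨0, φ_zero⟩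
  add_mem' := by
    rintro _ _ ⟨x, rfl⟩ ⟨y, rfl⟩
    exact ⟨x + y, φ_add x y⟩
  neg_mem' := by
    rintro _ ⟨x, rfl⟩
    exact ⟨-x, φ_neg x⟩

instance (R Δ : Type*) [NonUnitalRing R] [StarRing R] [AddGroup Δ] [OddFormRing R Δ] :
    (φRange R Δ).Normal where
  conj_mem := by
    rintro _ ⟨x, rfl⟩ u
    refine ⟨x, ?_⟩
    rw [add_φ, add_assoc, add_neg_cancel, add_zero]

/-- The abelian group `Δ / φ(R)`, a right `R`-module. -/
def FormClass (R Δ : Type*) [NonUnitalRing R] [StarRing R] [AddGroup Δ] [OddFormRing R Δ] :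
    Type _ := Δ ⧸ φRange R Δ

section FormClass

variable {R Δ : Type*} [NonUnitalRing R] [StarRing R] [AddGroup Δ] [OddFormRing R Δ]

instance : AddGroup (FormClass R Δ) := inferInstanceAs (AddGroup (Δ ⧸ φRange R Δ))

variable (R) in
/-- The class of `u` in `Δ / φ(R)`. -/
def cls : Δ →+ FormClass R Δ := QuotientAddGroup.mk' (φRange R Δ)

lemma cls_surjective : Function.Surjective (cls R : Δ → FormClass R Δ) :=
  QuotientAddGroup.mk'_surjective _

lemma cls_φ (x : R) : cls R (φ x : Δ) = 0 :=
  (QuotientAddGroup.eq_zero_iff _).2 ⟨x, rfl⟩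

/-- By `add_swap`, commutators in `Δ` are values of `φ`. -/
instance : AddCommGroup (FormClass R Δ) where
  add_comm a b := by
    obtain ⟨u, rfl⟩ := cls_surjective a
    obtain ⟨v, rfl⟩ := cls_surjective b
    rw [← map_add, ← map_add, add_swap (R := R), map_add _ (v + u), cls_φ, add_zero]

/-- An element of `Δ` is determined by its class modulo `φ(R)` and by `ρ`. -/
lemma eq_of_cls_of_ρ {u v : Δ} (h1 : cls R u = cls R v) (h2 : (ρ u : R) = ρ v) : u = v := by
  -- Two elements of one class differ by some `φ x`; equality of `ρ` makes `x` hermitian, and `φ`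
  -- vanishes on hermitian elements.
  obtain ⟨x, hx⟩ : -u + v ∈ φRange R Δ := QuotientAddGroup.eq.1 h1
  obtain rfl : v = u + φ x := by rw [hx]; simp
  rw [ρ_add, π_φ, ρ_φ] at h2
  simp only [mul_zero, sub_zero, left_eq_add, sub_eq_zero] at h2
  rw [φ_hermitian x h2.symm, add_zero]

/-- The additive endomorphism of `Δ / φ(R)` induced by the action of `x`. -/
def clsAct (x : R) : FormClass R Δ →+ FormClass R Δ :=
  QuotientAddGroup.map (φRange R Δ) (φRange R Δ)
    { toFun := fun u => act u x
      map_zero' := zero_act x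
      map_add' := fun u v => add_act u v x }
    (by
      rintro _ ⟨y, rfl⟩
      exact ⟨star x * y * x, φ_conj x y⟩)

lemma clsAct_cls (x : R) (u : Δ) : clsAct x (cls R u) = cls R (act u x) := rfl

lemma clsAct_add (x y : R) (a : FormClass R Δ) : clsAct (x + y) a = clsAct x a + clsAct y a := by
  obtain ⟨u, rfl⟩ := cls_surjective a
  simp only [clsAct_cls, act_add, map_add, cls_φ, add_zero]

lemma clsAct_mul (x y : R) (a : FormClass R Δ) : clsAct (x * y) a = clsAct y (clsAct x a) := by
  obtain ⟨u, rfl⟩ := cls_surjective a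
  simp only [clsAct_cls, act_mul]

lemma clsAct_zero (a : FormClass R Δ) : clsAct (0 : R) a = 0 := by
  simpa using clsAct_add (0 : R) 0 a

end FormClass

/-- The ring `R ⊕ Δ / φ(R)` with the multiplication `(x, a) (y, b) = (x y, a · y)`. -/
def Model (R Δ : Type*) [NonUnitalRing R] [StarRing R] [AddGroup Δ] [OddFormRing R Δ] :
    Type _ := R × FormClass R Δ

namespace Model

variable {R Δ : Type*} [NonUnitalRing R] [StarRing R] [AddGroup Δ] [OddFormRing R Δ]

instance : AddCommGroup (Model R Δ) := inferInstanceAs (AddCommGroup (R × FormClass R Δ))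

instance : Mul (Model R Δ) where
  mul a b := (a.1 * b.1, clsAct b.1 a.2)

instance : NonUnitalRing (Model R Δ) where
  left_distrib a b c := Prod.ext (mul_add a.1 b.1 c.1) (clsAct_add b.1 c.1 a.2)
  right_distrib a b c := Prod.ext (add_mul a.1 b.1 c.1) (map_add (clsAct c.1) a.2 b.2)
  zero_mul a := Prod.ext (zero_mul a.1) (map_zero (clsAct a.1))
  mul_zero a := Prod.ext (mul_zero a.1) (clsAct_zero a.2)
  mul_assoc a b c := Prod.ext (mul_assoc a.1 b.1 c.1) (clsAct_mul b.1 c.1 a.2).symm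

variable (Δ) in
/-- The embedding of `R` into `R ⊕ Δ / φ(R)`. -/
def emb : R →ₙ+* Model R Δ where
  toFun x := (x, 0)
  map_zero' := rfl
  map_add' _ _ := Prod.ext rfl (add_zero 0).symm
  map_mul' _ y := Prod.ext rfl (map_zero (clsAct y)).symm

/-- The projection of `R ⊕ Δ / φ(R)` to `R`. -/
def proj : Model R Δ →ₙ+* R where
  toFun a := a.1
  map_zero' := rfl
  map_add' _ _ := rfl
  map_mul' _ _ := rfl

lemma proj_emb (x : R) : proj (emb Δ x) = x := rfl

/-- The element of the model given by `u ∈ Δ`. -/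
def vec : Δ →+ Model R Δ where
  toFun u := (π u, cls R u)
  map_zero' := by rw [π_zero, map_zero]; rfl
  map_add' u v := by rw [π_add, map_add]; rfl

lemma vec_φ (x : R) : vec (φ x : Δ) = (0 : Model R Δ) :=
  Prod.ext (π_φ x) (cls_φ x)

lemma vec_act (u : Δ) (x : R) : vec (act u x) = (vec u : Model R Δ) * emb Δ x :=
  Prod.ext (π_act u x) (clsAct_cls x u).symm

lemma eq_of_vec_of_ρ {u v : Δ} (h1 : (vec u : Model R Δ) = vec v) (h2 : (ρ u : R) = ρ v) :
    u = v :=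
  eq_of_cls_of_ρ (congrArg Prod.snd h1) h2

end Model

end OddFormRing

/-! ### The unitary group as a group of matrices over the model -/

namespace OddUnitary

open OddFormRing.Model

variable {R Δ : Type*} [NonUnitalRing R] [StarRing R] [AddGroup Δ] [OddFormRing R Δ]

/-- The element `α - 1` of the model given by `g`; it determines `g`. -/
def mat (g : OddUnitary R Δ) : Model R Δ := vec g.γ

lemma proj_mat (g : OddUnitary R Δ) : proj g.mat = g.β := g.π_γ

lemma mat_one : (1 : OddUnitary R Δ).mat = 0 := map_zero vec

lemma mat_mul (g h : OddUnitary R Δ) : (g * h).mat = g.mat * emb Δ h.β + g.mat + h.mat := by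
  rw [mat, γ_mul, map_add, map_add, vec_act]
  change g.mat * _ + h.mat + g.mat = _
  abel

/-- The model forgets the `φ(R)`-part of `γ`, but `ρ γ = star β` recovers it. -/
lemma mat_injective {g h : OddUnitary R Δ} (H : g.mat = h.mat) : g = h := by
  have h1 : g.β = h.β := by rw [← proj_mat, ← proj_mat, H]
  refine OddUnitary.ext h1 (eq_of_vec_of_ρ H ?_)
  rw [g.ρ_γ, h.ρ_γ, h1]

lemma eq_one_of_mat {g : OddUnitary R Δ} (H : g.mat = 0) : g = 1 :=
  mat_injective (H.trans mat_one.symm)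

lemma mat_inv (g : OddUnitary R Δ) : (g⁻¹).mat = -(g.mat * emb Δ (star g.β)) - g.mat := by
  have h := mat_mul g g⁻¹
  rw [mul_inv_cancel, mat_one, β_inv] at h
  rw [← sub_eq_zero, h]
  abel

end OddUnitary

namespace FreeHyperbolicFamily

open OddFormRing.Model

variable {R Δ : Type*} [NonUnitalRing R] [StarRing R] [AddGroup Δ] [OddFormRing R Δ] {n : ℕ}
  (η : FreeHyperbolicFamily R Δ n)

/-- The idempotent of the model given by `q_i`. -/
def qv (i : SignedIndex n) : Model R Δ := vec (η.q i)

lemma proj_qv (i : SignedIndex n) : proj (η.qv i) = η.e i := η.π_q i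

lemma mat_short (i j : SignedIndex n) (hij : i.1 ≠ j.1) (x : R) (hx : x ∈ η.peirce i j) :
    (η.shortTransvection i j hij x hx).mat =
      η.qv i * emb Δ x - η.qv j.opp * emb Δ (star x) := by
  change vec (act (η.q i) x + act (η.q j.opp) (-star x) - φ x) = _
  rw [map_sub, map_add, vec_φ, vec_act, vec_act, map_neg, sub_zero, mul_neg, ← sub_eq_add_neg]
  rfl

lemma β_short (i j : SignedIndex n) (hij : i.1 ≠ j.1) (x : R) (hx : x ∈ η.peirce i j) :
    (η.shortTransvection i j hij x hx).β = x - star x := rfl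

lemma mat_ultrashort (k : SignedIndex n) (u : Δ) (hu : u ∈ η.delta0At k) :
    (η.ultrashortTransvection k u hu).mat =
      η.qv k.opp * emb Δ (ρ u) - η.qv k.opp * emb Δ (star (π u)) + vec u := by
  change vec (act (η.q k.opp) (ρ u - star (π u)) + u - φ (ρ u + π u)) = _
  rw [map_sub, map_add, vec_φ, vec_act, map_sub, sub_zero, mul_sub]
  rfl

lemma β_ultrashort (k : SignedIndex n) (u : Δ) (hu : u ∈ η.delta0At k) :
    (η.ultrashortTransvection k u hu).β = ρ u + π u - star (π u) := rfl

end FreeHyperbolicFamily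

/-! ### Signed indices and Peirce calculus -/

namespace SignedIndex

variable {n : ℕ}

@[simp] lemma opp_opp (i : SignedIndex n) : i.opp.opp = i := by simp [opp]

@[simp] lemma opp_fst (i : SignedIndex n) : i.opp.1 = i.1 := rfl

lemma opp_ne (i : SignedIndex n) : i.opp ≠ i := by
  rcases i with ⟨i, _ | _⟩ <;> simp [opp]

lemma ne_opp (i : SignedIndex n) : i ≠ i.opp := (opp_ne i).symm

lemma ne_of_fst {i j : SignedIndex n} (h : i.1 ≠ j.1) : i ≠ j := fun e => h (congrArg _ e)

lemma eq_or_eq_opp {i j : SignedIndex n} (h : i.1 = j.1) : i = j ∨ i = j.opp := by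
  rcases i with ⟨i, a⟩
  rcases j with ⟨j, b⟩
  obtain rfl : i = j := h
  cases a <;> cases b <;> simp [opp]

end SignedIndex

namespace FreeHyperbolicFamily

open OddFormRing.Model SignedIndex
open OddUnitary (mat mat_mul β_mul mat_injective mat_one eq_one_of_mat mat_inv proj_mat β_inv)

variable {R Δ : Type*} [NonUnitalRing R] [StarRing R] [AddGroup Δ] [OddFormRing R Δ] {n : ℕ}
  (η : FreeHyperbolicFamily R Δ n)

lemma mul_eq_zero_of_ne {j k : SignedIndex n} {x y : R} (hx : x * η.e j = x) (hy : η.e k * y = y)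
    (h : j ≠ k) : x * y = 0 := by
  rw [← hx, ← hy, mul_assoc, ← mul_assoc (η.e j), η.e_mul_e h, zero_mul, mul_zero]

lemma add_mem_peirce {i j : SignedIndex n} {x y : R} (hx : x ∈ η.peirce i j)
    (hy : y ∈ η.peirce i j) : x + y ∈ η.peirce i j := by
  change _ * (x + y) * _ = _
  rw [mul_add, add_mul, show _ = x from hx, show _ = y from hy]

lemma neg_mem_peirce {i j : SignedIndex n} {x : R} (hx : x ∈ η.peirce i j) :
    -x ∈ η.peirce i j := by
  change _ * (-x) * _ = _
  rw [mul_neg, neg_mul, show _ = x from hx]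

lemma zero_mem_peirce (i j : SignedIndex n) : (0 : R) ∈ η.peirce i j := by
  change _ * (0 : R) * _ = _
  simp

lemma mul_mem_peirce {i j k : SignedIndex n} {x y : R} (hx : x ∈ η.peirce i j)
    (hy : y ∈ η.peirce j k) : x * y ∈ η.peirce i k := by
  change _ * (x * y) * _ = _
  rw [← mul_assoc, η.mem_peirce_left hx, mul_assoc, η.mem_peirce_right hy]

lemma star_mem_peirce_opp {i j : SignedIndex n} {x : R} (hx : x ∈ η.peirce i.opp j) :
    star x ∈ η.peirce j.opp i := by
  simpa using η.star_mem_peirce hx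

lemma act_mem_delta0At {k l : SignedIndex n} {u : Δ} (hu : u ∈ η.delta0) {x : R}
    (hx : x ∈ η.peirce k l) : act u x ∈ η.delta0At l := by
  refine ⟨fun i => ?_, ?_⟩
  · rw [π_act, ← mul_assoc, hu i, zero_mul]
  · rw [← act_mul, η.mem_peirce_right hx]

lemma neg_mem_delta0At {k : SignedIndex n} {u : Δ} (hu : u ∈ η.delta0At k) :
    -u ∈ η.delta0At k := by
  refine ⟨fun i => ?_, ?_⟩
  · rw [π_neg, mul_neg, hu.1 i, neg_zero]
  · rw [neg_act, hu.2]

lemma add_mem_delta0At {k : SignedIndex n} {u v : Δ} (hu : u ∈ η.delta0At k)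
    (hv : v ∈ η.delta0At k) : u + v ∈ η.delta0At k := by
  refine ⟨fun i => ?_, ?_⟩
  · rw [π_add, mul_add, hu.1 i, hv.1 i, add_zero]
  · rw [add_act, hu.2, hv.2]

lemma φ_mem_delta0At {k : SignedIndex n} {x : R} (hx : x ∈ η.peirce k.opp k) :
    (φ x : Δ) ∈ η.delta0At k := by
  refine ⟨fun i => ?_, ?_⟩
  · rw [π_φ, mul_zero]
  · rw [← φ_conj, star_e, show _ = x from hx]

lemma emb_mul_emb_zero {x y : R} (h : x * y = 0) (a : Model R Δ) :
    a * emb Δ x * emb Δ y = 0 := by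
  rw [mul_assoc, ← map_mul, h, map_zero, mul_zero]

lemma star_π_mul_e {u : Δ} (hu : u ∈ η.delta0) (i : SignedIndex n) : star (π u : R) * η.e i = 0 := by
  have h := congrArg star (hu i.opp)
  rwa [star_mul, star_e, star_zero, opp_opp] at h

lemma mul_π {u : Δ} (hu : u ∈ η.delta0) {j : SignedIndex n} {x : R} (hx : x * η.e j = x) :
    x * π u = 0 := by
  rw [← hx, mul_assoc, hu, mul_zero]

lemma star_π_mul {u : Δ} (hu : u ∈ η.delta0) {j : SignedIndex n} {x : R} (hx : η.e j * x = x) :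
    star (π u : R) * x = 0 := by
  rw [← hx, ← mul_assoc, η.star_π_mul_e hu, zero_mul]

lemma vec_mul_e {k : SignedIndex n} {u : Δ} (hu : u ∈ η.delta0At k) :
    (vec u : Model R Δ) * emb Δ (η.e k) = vec u := by
  rw [← vec_act, hu.2]

lemma vec_mul_zero {k l : SignedIndex n} {u : Δ} (hu : u ∈ η.delta0At k) {x : R}
    (hx : η.e l * x = x) (h : k ≠ l) : (vec u : Model R Δ) * emb Δ x = 0 := by
  rw [← η.vec_mul_e hu, ← hx]
  apply emb_mul_emb_zero
  rw [← mul_assoc, η.e_mul_e h, zero_mul]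

lemma e_mul_star_π {k : SignedIndex n} {u : Δ} (hu : u ∈ η.delta0At k) :
    η.e k.opp * star (π u : R) = star (π u) := by
  have h := congrArg star (η.mem_delta0At_π hu)
  rwa [star_mul, star_e] at h

/-- Expansion of `ρ (-u + u) = 0` with `star (ρ u) = ρ (-u)`. -/
lemma ρ_add_star {u : Δ} : (ρ u : R) + star (ρ u) + star (π u : R) * π u = 0 := by
  have h := ρ_add (R := R) (-u) u
  rw [neg_add_cancel, ρ_zero, ← star_ρ, π_neg, star_neg] at h
  rw [h]
  simp only [neg_mul, sub_neg_eq_add]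
  abel

/-! ### Relations between the elementary transvections -/

/-- Every short root element has two names. This reduces the four ways in which two short roots can
meet to a single one. -/
lemma shortTransvection_flip (i j : SignedIndex n) (hij : i.1 ≠ j.1) (x : R)
    (hx : x ∈ η.peirce i j) (hji : j.opp.1 ≠ i.opp.1) :
    η.shortTransvection i j hij x hx =
      η.shortTransvection j.opp i.opp hji (-star x)
        (η.neg_mem_peirce (η.star_mem_peirce hx)) := by
  apply mat_injective
  rw [mat_short, mat_short, opp_opp, star_neg, star_star, map_neg, map_neg]
  noncomm_ring

/-- `x * star y = 0` and the like: elements of `T_{ij}(x) - 1` multiply to zero unless the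
indices match. -/
lemma short_mul_short {i j k l : SignedIndex n} {x y : R} (hx : x ∈ η.peirce i j)
    (hy : y ∈ η.peirce k l) :
    (j ≠ k → x * y = 0) ∧ (j ≠ l.opp → x * star y = 0) ∧ (i ≠ k.opp → star x * y = 0) ∧
      (i ≠ l → star x * star y = 0) := by
  have hx' := η.star_mem_peirce hx
  have hy' := η.star_mem_peirce hy
  refine ⟨fun h => η.peirce_mul_zero hx hy h, fun h => η.peirce_mul_zero hx hy' h,
    fun h => η.peirce_mul_zero hx' hy fun h' => h ?_,
    fun h => η.peirce_mul_zero hx' hy' fun h' => h ?_⟩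
  · rw [← h', opp_opp]
  · rw [← opp_opp i, h', opp_opp]

/-- A commutator formula `[g, h] = k` comes down to the cross terms, since the linear terms `g.mat`
and `h.mat` occur on both sides and cancel. -/
lemma mul_eq_mul_of_mat {g h k : OddUnitary R Δ}
    (H : g.mat * emb Δ h.β = k.mat * emb Δ (h.β * g.β + h.β + g.β) + k.mat + h.mat * emb Δ g.β) :
    g * h = k * (h * g) := by
  apply mat_injective
  rw [mat_mul, mat_mul, mat_mul, H, β_mul]
  abel

lemma shortTransvection_add (i j : SignedIndex n) (hij : i.1 ≠ j.1) (x y : R)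
    (hx : x ∈ η.peirce i j) (hy : y ∈ η.peirce i j) :
    η.shortTransvection i j hij (x + y) (η.add_mem_peirce hx hy) =
      η.shortTransvection i j hij x hx * η.shortTransvection i j hij y hy := by
  apply mat_injective
  obtain ⟨z1, z2, z3, z4⟩ := η.short_mul_short hx hy
  have z1 := z1 (ne_of_fst hij.symm)
  have z2 := z2 (ne_opp _)
  have z3 := z3 (ne_opp _)
  have z4 := z4 (ne_of_fst hij)
  simp only [mat_mul, mat_short, β_short, star_add, map_add, map_sub, mul_add, mul_sub, sub_mul,
    emb_mul_emb_zero z1, emb_mul_emb_zero z2, emb_mul_emb_zero z3, emb_mul_emb_zero z4]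
  abel

lemma shortTransvection_zero (i j : SignedIndex n) (hij : i.1 ≠ j.1) :
    η.shortTransvection i j hij 0 (η.zero_mem_peirce i j) = 1 := by
  apply mat_injective
  simp [mat_short, mat_one]

lemma shortTransvection_inv (i j : SignedIndex n) (hij : i.1 ≠ j.1) (x : R)
    (hx : x ∈ η.peirce i j) :
    (η.shortTransvection i j hij x hx)⁻¹ =
      η.shortTransvection i j hij (-x) (η.neg_mem_peirce hx) := by
  rw [inv_eq_iff_mul_eq_one, ← shortTransvection_add, ← η.shortTransvection_zero i j hij]
  simp only [add_neg_cancel]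

lemma ultrashortTransvection_add (k : SignedIndex n) (u v : Δ) (hu : u ∈ η.delta0At k)
    (hv : v ∈ η.delta0At k) :
    η.ultrashortTransvection k (u + v) (η.add_mem_delta0At hu hv) =
      η.ultrashortTransvection k u hu * η.ultrashortTransvection k v hv := by
  apply mat_injective
  have ru := η.mem_delta0At_ρ hu
  have rv := η.mem_delta0At_ρ hv
  have ra := η.mem_peirce_right ru
  have rb := η.mem_peirce_left rv
  have pv := η.e_mul_star_π hv
  have z1 : (ρ u : R) * ρ v = 0 := η.mul_eq_zero_of_ne ra rb (ne_opp _)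
  have z2 : (ρ u : R) * π v = 0 := η.mul_π hv.1 ra
  have z3 : (ρ u : R) * star (π v) = 0 := η.mul_eq_zero_of_ne ra pv (ne_opp _)
  have z4 : star (π u : R) * ρ v = 0 := η.star_π_mul hu.1 rb
  have z5 : star (π u : R) * star (π v) = 0 := η.star_π_mul hu.1 pv
  have z6 := η.vec_mul_zero hu rb (ne_opp _)
  have z7 := η.vec_mul_zero hu pv (ne_opp _)
  have z8 : (vec u : Model R Δ) * emb Δ (π v) = 0 := by
    rw [← η.vec_mul_e hu]
    exact emb_mul_emb_zero (hv.1 k) _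
  simp only [mat_mul, mat_ultrashort, β_ultrashort, ρ_add, π_add, star_add, map_add, map_sub,
    mul_add, mul_sub, sub_mul, add_mul, emb_mul_emb_zero z1, emb_mul_emb_zero z2,
    emb_mul_emb_zero z3, emb_mul_emb_zero z4, emb_mul_emb_zero z5, z6, z7, z8, map_mul, mul_assoc]
  abel

lemma ultrashortTransvection_inv (k : SignedIndex n) (u : Δ) (hu : u ∈ η.delta0At k) :
    (η.ultrashortTransvection k u hu)⁻¹ =
      η.ultrashortTransvection k (-u) (η.neg_mem_delta0At hu) := by
  rw [inv_eq_iff_mul_eq_one, ← ultrashortTransvection_add]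
  apply mat_injective
  simp [mat_ultrashort, mat_one, π_zero, ρ_zero]

lemma commute_short_short {i j k l : SignedIndex n} (hij : i.1 ≠ j.1) (hkl : k.1 ≠ l.1) {x y : R}
    (hx : x ∈ η.peirce i j) (hy : y ∈ η.peirce k l) (h1 : j ≠ k) (h2 : i ≠ l) (h3 : j ≠ l.opp)
    (h4 : i ≠ k.opp) :
    Commute (η.shortTransvection i j hij x hx) (η.shortTransvection k l hkl y hy) := by
  apply mat_injective
  obtain ⟨z1, z2, z3, z4⟩ := η.short_mul_short hx hy
  obtain ⟨w1, w2, w3, w4⟩ := η.short_mul_short hy hx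
  have z1 := z1 h1
  have z2 := z2 h3
  have z3 := z3 h4
  have z4 := z4 h2
  have w1 := w1 h2.symm
  have w2 := w2 (fun h => h3 (by rw [h, opp_opp]))
  have w3 := w3 (fun h => h4 (by rw [h, opp_opp]))
  have w4 := w4 h1.symm
  simp only [mat_mul, mat_short, β_short, map_sub, mul_sub, sub_mul,
    emb_mul_emb_zero z1, emb_mul_emb_zero z2, emb_mul_emb_zero z3, emb_mul_emb_zero z4,
    emb_mul_emb_zero w1, emb_mul_emb_zero w2, emb_mul_emb_zero w3, emb_mul_emb_zero w4]
  abel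

/-- The Steinberg relation. Of all products of entries of the two factors, only `x * y` and its
involute survive. -/
lemma short_mul_short_comp {i j l : SignedIndex n} (hij : i.1 ≠ j.1) (hjl : j.1 ≠ l.1)
    (hil : i.1 ≠ l.1) {x y : R} (hx : x ∈ η.peirce i j) (hy : y ∈ η.peirce j l) :
    η.shortTransvection i j hij x hx * η.shortTransvection j l hjl y hy =
      η.shortTransvection i l hil (x * y) (η.mul_mem_peirce hx hy) *
        (η.shortTransvection j l hjl y hy * η.shortTransvection i j hij x hx) := by
  apply mul_eq_mul_of_mat
  obtain ⟨-, z2, z3, z4⟩ := η.short_mul_short hx hy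
  obtain ⟨w1, w2, w3, -⟩ := η.short_mul_short hy hx
  have hxy := η.mul_mem_peirce hx hy
  obtain ⟨a1, a2, a3, a4⟩ := η.short_mul_short hxy hx
  obtain ⟨b1, b2, b3, b4⟩ := η.short_mul_short hxy hy
  obtain ⟨c1, c2, c3, c4⟩ := η.short_mul_short hxy hxy
  have z2 := z2 (ne_of_fst (j := l.opp) hjl)
  have z3 := z3 (ne_of_fst (j := j.opp) hij)
  have z4 := z4 (ne_of_fst hil)
  have w1 := w1 (ne_of_fst hil.symm)
  have w2 := w2 (ne_of_fst (j := j.opp) hjl.symm)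
  have w3 := w3 (ne_of_fst (j := i.opp) hij.symm)
  have a1 := a1 (ne_of_fst hil.symm)
  have a2 := a2 (ne_of_fst (j := j.opp) hjl.symm)
  have a3 := a3 (ne_opp _)
  have a4 := a4 (ne_of_fst hij)
  have b1 := b1 (ne_of_fst hjl.symm)
  have b2 := b2 (ne_opp _)
  have b3 := b3 (ne_of_fst (j := j.opp) hij)
  have b4 := b4 (ne_of_fst hil)
  have c2 := c2 (ne_opp _)
  have c4 := c4 (ne_of_fst hil)
  have e1 : (y - star y) * (x - star x) = star (x * y) := by
    simp only [mul_sub, sub_mul, w1, w2, w3, star_mul]; abel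
  simp only [mat_short, β_short, e1]
  simp only [map_sub, map_add, mul_sub, sub_mul, mul_add,
    emb_mul_emb_zero z2, emb_mul_emb_zero z3, emb_mul_emb_zero z4,
    emb_mul_emb_zero w1, emb_mul_emb_zero w2, emb_mul_emb_zero w3,
    emb_mul_emb_zero a1, emb_mul_emb_zero a2, emb_mul_emb_zero a3, emb_mul_emb_zero a4,
    emb_mul_emb_zero b1, emb_mul_emb_zero b2, emb_mul_emb_zero b3, emb_mul_emb_zero b4,
    emb_mul_emb_zero c2, emb_mul_emb_zero c4]
  simp only [star_mul, map_mul, mul_assoc]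
  abel

/-- When the outer indices are opposite, `x * y` lies in `R_{i,-i}`, where no short transvection is
available; the commutator is then an ultrashort transvection with vanishing `π`. -/
lemma short_mul_short_opp {i j : SignedIndex n} (hij : i.1 ≠ j.1) (hji : j.1 ≠ i.opp.1) {x y : R}
    (hx : x ∈ η.peirce i j) (hy : y ∈ η.peirce j i.opp)
    (hxy : x * y ∈ η.peirce i.opp.opp i.opp) :
    η.shortTransvection i j hij x hx * η.shortTransvection j i.opp hji y hy =
      η.ultrashortTransvection i.opp (φ (x * y)) (η.φ_mem_delta0At hxy) *
        (η.shortTransvection j i.opp hji y hy * η.shortTransvection i j hij x hx) := by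
  apply mul_eq_mul_of_mat
  obtain ⟨-, z2, z3, z4⟩ := η.short_mul_short hx hy
  obtain ⟨w1, w2, w3, -⟩ := η.short_mul_short hy hx
  have hxy' := η.mul_mem_peirce hx hy
  obtain ⟨a1, a2, a3, a4⟩ := η.short_mul_short hxy' hx
  obtain ⟨b1, b2, b3, b4⟩ := η.short_mul_short hxy' hy
  obtain ⟨c1, c2, c3, c4⟩ := η.short_mul_short hxy' hxy'
  have z2 := z2 (by rw [opp_opp]; exact ne_of_fst hij.symm)
  have z3 := z3 (ne_of_fst (j := j.opp) hij)
  have z4 := z4 (ne_opp _)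
  have w1 := w1 (opp_ne _)
  have w2 := w2 (ne_of_fst (j := j.opp) hij)
  have w3 := w3 (ne_of_fst (j := i.opp) hij.symm)
  have a1 := a1 (opp_ne _)
  have a2 := a2 (ne_of_fst (j := j.opp) hij)
  have a3 := a3 (ne_opp _)
  have a4 := a4 (ne_of_fst hij)
  have b1 := b1 (ne_of_fst (i := i.opp) hij)
  have b2 := b2 (ne_opp _)
  have b3 := b3 (ne_of_fst (j := j.opp) hij)
  have b4 := b4 (ne_opp _)
  have c2 := c2 (ne_opp _)
  have c4 := c4 (ne_opp _)
  have e1 : (y - star y) * (x - star x) = star (x * y) := by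
    simp only [mul_sub, sub_mul, w1, w2, w3, star_mul]; abel
  simp only [mat_short, β_short, mat_ultrashort, e1, vec_φ, π_φ, ρ_φ, star_zero, map_zero, mul_zero,
    opp_opp, add_zero, sub_zero]
  simp only [map_sub, map_add, mul_sub, sub_mul, mul_add,
    emb_mul_emb_zero z2, emb_mul_emb_zero z3, emb_mul_emb_zero z4,
    emb_mul_emb_zero w1, emb_mul_emb_zero w2, emb_mul_emb_zero w3,
    emb_mul_emb_zero a1, emb_mul_emb_zero a2, emb_mul_emb_zero a3, emb_mul_emb_zero a4,
    emb_mul_emb_zero b1, emb_mul_emb_zero b2, emb_mul_emb_zero b3, emb_mul_emb_zero b4,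
    emb_mul_emb_zero c2, emb_mul_emb_zero c4]
  simp only [star_mul, map_mul, mul_assoc]
  abel

lemma commute_ultrashort_short {i j k : SignedIndex n} (hij : i.1 ≠ j.1) {x : R} {u : Δ}
    (hx : x ∈ η.peirce i j) (hu : u ∈ η.delta0At k) (h1 : k ≠ i) (h2 : k ≠ j.opp) :
    Commute (η.ultrashortTransvection k u hu) (η.shortTransvection i j hij x hx) := by
  apply mat_injective
  have hr := η.mem_delta0At_ρ hu
  have hx' := η.star_mem_peirce hx
  have xl := η.mem_peirce_left hx
  have xl' := η.mem_peirce_left hx'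
  have xr := η.mem_peirce_right hx
  have xr' := η.mem_peirce_right hx'
  have h3 : j ≠ k.opp := fun h => h2 (by rw [h, opp_opp])
  have h4 : i.opp ≠ k.opp := fun h => h1 (by rw [← opp_opp k, ← h, opp_opp])
  have pl := η.e_mul_star_π hu
  have z1 := η.mul_eq_zero_of_ne (η.mem_peirce_right hr) xl h1
  have z2 := η.mul_eq_zero_of_ne (η.mem_peirce_right hr) xl' h2
  have z3 := η.star_π_mul hu.1 xl
  have z4 := η.star_π_mul hu.1 xl'
  have z5 := η.vec_mul_zero hu xl h1
  have z6 := η.vec_mul_zero hu xl' h2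
  have w1 := η.mul_eq_zero_of_ne xr (η.mem_peirce_left hr) h3
  have w2 := η.mul_eq_zero_of_ne xr' (η.mem_peirce_left hr) h4
  have w3 := η.mul_π hu.1 xr
  have w4 := η.mul_π hu.1 xr'
  have w5 := η.mul_eq_zero_of_ne xr pl h3
  have w6 := η.mul_eq_zero_of_ne xr' pl h4
  simp only [mat_mul, mat_short, β_short, mat_ultrashort, β_ultrashort, map_sub, map_add,
    mul_sub, sub_mul, mul_add, add_mul,
    emb_mul_emb_zero z1, emb_mul_emb_zero z2, emb_mul_emb_zero z3, emb_mul_emb_zero z4, z5, z6,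
    emb_mul_emb_zero w1, emb_mul_emb_zero w2, emb_mul_emb_zero w3, emb_mul_emb_zero w4,
    emb_mul_emb_zero w5, emb_mul_emb_zero w6]
  abel

/-- The vectors `π u` and `π v` both lie in `e₀ R`, so their pairing `star (π u) * π v` is the only
obstruction to commuting. -/
lemma ultrashort_mul_ultrashort {i j : SignedIndex n} (hij : i.opp.1 ≠ j.1) {u v : Δ}
    (hu : u ∈ η.delta0At i) (hv : v ∈ η.delta0At j)
    (huv : -(star (π u : R) * π v) ∈ η.peirce i.opp j) :
    η.ultrashortTransvection i u hu * η.ultrashortTransvection j v hv =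
      η.shortTransvection i.opp j hij (-(star (π u : R) * π v)) huv *
        (η.ultrashortTransvection j v hv * η.ultrashortTransvection i u hu) := by
  apply mul_eq_mul_of_mat
  have ru := η.mem_delta0At_ρ hu
  have rv := η.mem_delta0At_ρ hv
  have ul := η.mem_peirce_left ru
  have ur := η.mem_peirce_right ru
  have vl := η.mem_peirce_left rv
  have vr := η.mem_peirce_right rv
  have pu := η.e_mul_star_π hu
  have pv := η.e_mul_star_π hv
  have hu0 : ∀ l, η.e l * π u = 0 := hu.1
  have hv0 : ∀ l, η.e l * π v = 0 := hv.1
  have hij' : i ≠ j.opp := ne_of_fst hij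
  have hji' : j ≠ i.opp := ne_of_fst hij.symm
  have z1 := η.mul_eq_zero_of_ne ur vl hij'
  have z2 := η.mul_π hv.1 ur
  have z3 := η.mul_eq_zero_of_ne ur pv hij'
  have z4 := η.star_π_mul hu.1 vl
  have z5 := η.star_π_mul hu.1 pv
  have z6 := η.vec_mul_zero hu vl hij'
  have z7 := η.vec_mul_zero hu pv hij'
  have z8 : (vec u : Model R Δ) * emb Δ (π v) = 0 := by
    rw [← η.vec_mul_e hu]
    exact emb_mul_emb_zero (hv.1 _) _
  have w1 := η.mul_eq_zero_of_ne vr ul hji'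
  have w2 := η.mul_π hu.1 vr
  have w3 := η.mul_eq_zero_of_ne vr pu hji'
  have w4 := η.star_π_mul hv.1 ul
  have w5 := η.star_π_mul hv.1 pu
  have w6 := η.vec_mul_zero hv ul hji'
  have w7 := η.vec_mul_zero hv pu hji'
  have w8 : (vec v : Model R Δ) * emb Δ (π u) = 0 := by
    rw [← η.vec_mul_e hv]
    exact emb_mul_emb_zero (hu.1 _) _
  have w9 : (π v : R) * ρ u = 0 := η.mul_eq_zero_of_ne (η.mem_delta0At_π hv) ul hji'
  have w10 : (π v : R) * star (π u) = 0 := η.mul_eq_zero_of_ne (η.mem_delta0At_π hv) pu hji'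
  have w11 : (π v : R) * π u = 0 := η.mul_π hu.1 (η.mem_delta0At_π hv)
  have e1 : (ρ v + π v - star (π v)) * (ρ u + π u - star (π u) : R) = -(star (π v) * π u) := by
    simp only [mul_sub, mul_add, sub_mul, add_mul, w1, w2, w3, w4, w5, w9, w10, w11]; abel
  have e2 : star (-(star (π u : R) * π v)) = -(star (π v) * π u) := by
    rw [star_neg, star_mul, star_star]
  -- The two nonzero columns of the short transvection on the left are `j` and `i`, so only these
  -- two rows of the right factor matter.
  have key : ∀ t : R, η.e j * t = 0 → η.e i * t = 0 →
      (η.shortTransvection i.opp j hij (-(star (π u : R) * π v)) huv).mat * emb Δ t = 0 := by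
    intro t ht1 ht2
    rw [mat_short, sub_mul, emb_mul_emb_zero, emb_mul_emb_zero, sub_zero]
    · rw [e2, ← η.mem_delta0At_π hu, neg_mul, mul_assoc, mul_assoc (π u), ht2]
      simp
    · rw [← η.mem_delta0At_π hv, neg_mul, mul_assoc, mul_assoc (π v), ht1]
      simp
  have hz : ∀ {k l : SignedIndex n} {x : R}, η.e l * x = x → k ≠ l → η.e k * x = 0 :=
    fun {k l x} h1 h2 => η.mul_eq_zero_of_ne (η.e_idem k) h1 h2
  have zz : ∀ {k l : SignedIndex n} {x y : R}, η.e l * x = x → k ≠ l → η.e k * (x * y) = 0 :=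
    fun {k l x y} h1 h2 => by rw [← mul_assoc, hz h1 h2, zero_mul]
  rw [key, mat_short, β_ultrashort, β_ultrashort, mat_ultrashort, mat_ultrashort]
  · simp only [map_sub, map_add, map_neg, mul_sub, sub_mul, mul_add, add_mul, mul_neg,
      emb_mul_emb_zero z1, emb_mul_emb_zero z2, emb_mul_emb_zero z3, emb_mul_emb_zero z4,
      emb_mul_emb_zero z5, z6, z7, z8, emb_mul_emb_zero w1, emb_mul_emb_zero w2,
      emb_mul_emb_zero w3, emb_mul_emb_zero w4, emb_mul_emb_zero w5, w6, w7, w8, e2]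
    simp only [map_mul, mul_assoc]
    abel
  · rw [β_ultrashort, β_ultrashort, e1]
    simp only [mul_add, mul_sub, mul_neg, hv0, hu0, hz vl (ne_opp j), hz pv (ne_opp j),
      zz pv (ne_opp j), hz ul hji', hz pu hji']
    abel
  · rw [β_ultrashort, β_ultrashort, e1]
    simp only [mul_add, mul_sub, mul_neg, hv0, hu0, hz vl hij', hz pv hij',
      zz pv hij', hz ul (ne_opp i), hz pu (ne_opp i)]
    abel

/-- The relation with two factors. The elements `-act u (-x)` and `act u x` have the same class
modulo `φ(R)`, but the values of `ρ` on them are involutes of each other; the relation needs the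
former. -/
lemma ultrashort_mul_short {i j : SignedIndex n} (hij : i.1 ≠ j.1) (hij' : i.opp.1 ≠ j.1) {x : R}
    {u : Δ}
    (hx : x ∈ η.peirce i j) (hu : u ∈ η.delta0At i) (hux : (ρ u : R) * x ∈ η.peirce i.opp j)
    (hux' : -act u (-x) ∈ η.delta0At j) :
    η.ultrashortTransvection i u hu * η.shortTransvection i j hij x hx =
      (η.shortTransvection i.opp j hij' (ρ u * x) hux *
        η.ultrashortTransvection j (-act u (-x)) hux') *
        (η.shortTransvection i j hij x hx * η.ultrashortTransvection i u hu) := by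
  apply mul_eq_mul_of_mat
  have ru := η.mem_delta0At_ρ hu
  have hx' := η.star_mem_peirce hx
  have xl := η.mem_peirce_left hx
  have xr := η.mem_peirce_right hx
  have xl' := η.mem_peirce_left hx'
  have xr' := η.mem_peirce_right hx'
  have ul := η.mem_peirce_left ru
  have ur := η.mem_peirce_right ru
  have pu := η.e_mul_star_π hu
  have hu0 : ∀ l, η.e l * π u = 0 := hu.1
  have hii : i ≠ j.opp := ne_of_fst hij
  have hji : j ≠ i.opp := ne_of_fst hij.symm
  have zi : ∀ {k l : SignedIndex n} {x : R}, η.e l * x = x → k ≠ l → η.e k * x = 0 :=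
    fun {k l x} h1 h2 => η.mul_eq_zero_of_ne (η.e_idem k) h1 h2
  have zz : ∀ {k l : SignedIndex n} {x y : R}, η.e l * x = x → k ≠ l → η.e k * (x * y) = 0 :=
    fun {k l x y} h1 h2 => by rw [← mul_assoc, zi h1 h2, zero_mul]
  have ev : (vec (-act u (-x)) : Model R Δ) = vec u * emb Δ x := by
    rw [map_neg, vec_act, map_neg, mul_neg, neg_neg]
  have eπ : (π (-act u (-x)) : R) = π u * x := by rw [π_neg, π_act, mul_neg, neg_neg]
  have eρ : (ρ (-act u (-x)) : R) = star x * star (ρ u) * x := by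
    rw [← star_ρ, ρ_act]
    simp only [star_mul, star_neg, star_star, neg_mul, mul_neg, neg_neg, mul_assoc]
  have w1 : x * ρ u = 0 := η.mul_eq_zero_of_ne xr ul hji
  have w2 : x * π u = 0 := η.mul_π hu.1 xr
  have w3 : x * star (π u) = 0 := η.mul_eq_zero_of_ne xr pu hji
  have w4 : star x * π u = 0 := η.mul_π hu.1 xr'
  have z1 : (ρ u : R) * star x = 0 := η.mul_eq_zero_of_ne ur xl' hii
  have z2 : star (π u) * x = 0 := η.star_π_mul hu.1 xl
  have z3 : star (π u) * star x = 0 := η.star_π_mul hu.1 xl'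
  have z4 := η.vec_mul_zero hu xl' hii
  have z5 : star (π u) * (ρ u : R) = 0 := η.star_π_mul hu.1 ul
  have z6 : star (π u) * star (π u : R) = 0 := η.star_π_mul hu.1 pu
  -- This is `β` of the product `T_{ij}(x) T_i(u)`. The factors on its left see only its rows `i`
  -- and `j` and its product with `star (π u)`.
  set t : R := (x - star x) * (ρ u + π u - star (π u)) + (x - star x) + (ρ u + π u - star (π u))
    with ht
  have ht' : t = x - star x + ρ u + π u - star (π u) - star x * ρ u + star x * star (π u) := by
    rw [ht]
    simp only [mul_sub, mul_add, sub_mul, w1, w2, w3, w4]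
    abel
  have tj : η.e j * t = 0 := by
    rw [ht']
    simp only [mul_add, mul_sub, hu0, zi xl (ne_of_fst hij.symm), zi xl' (ne_opp j), zi ul hji,
      zi pu hji, zz xl' (ne_opp j)]
    abel
  have ti : η.e i * t = x := by
    rw [ht']
    simp only [mul_add, mul_sub, hu0, xl, zi xl' hii, zi ul (ne_opp i), zi pu (ne_opp i),
      zz xl' hii]
    abel
  have tπ : star (π u) * t = -ρ u - star (ρ u) := by
    have h := ρ_add_star (R := R) (u := u)
    rw [ht']
    simp only [mul_add, mul_sub, ← mul_assoc, z2, z3, z5, z6, zero_mul]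
    rw [← sub_eq_zero, ← h]
    abel
  have t1 : (ρ u * x) * t = 0 := by
    rw [← xr, mul_assoc, mul_assoc x, tj, mul_zero, mul_zero]
  have t2 : star (ρ u * x) * t = star x * star (ρ u) * x := by
    have h := congrArg star (η.mem_peirce_left ru)
    rw [star_mul, star_e, opp_opp] at h
    rw [star_mul, mul_assoc, ← h, mul_assoc (star (ρ u)), ti, h, mul_assoc]
  have t3 : (star x * star (ρ u) * x) * t = 0 := by
    rw [mul_assoc, ← xr, mul_assoc x, tj, mul_zero, mul_zero]
  have t4 : star (π u * x) * t = -(star x * ρ u) - star x * star (ρ u) := by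
    rw [star_mul, mul_assoc, tπ, mul_sub, mul_neg]
  have t5 : (vec u : Model R Δ) * emb Δ x * emb Δ t = 0 := by
    apply emb_mul_emb_zero
    rw [← xr, mul_assoc, tj, mul_zero]
  have b1 : (η.shortTransvection i.opp j hij' (ρ u * x) hux).mat *
      emb Δ (η.ultrashortTransvection j (-act u (-x)) hux').β = 0 := by
    have e1 : η.e j * (η.ultrashortTransvection j (-act u (-x)) hux').β = 0 := by
      have hv := η.mem_peirce_left (η.mem_delta0At_ρ hux')
      rw [β_ultrashort, mul_sub, mul_add, hux'.1 j, zi hv (ne_opp j),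
        zi (η.e_mul_star_π hux') (ne_opp j)]
      abel
    have e2 : η.e i * (η.ultrashortTransvection j (-act u (-x)) hux').β = 0 := by
      have hv := η.mem_peirce_left (η.mem_delta0At_ρ hux')
      rw [β_ultrashort, mul_sub, mul_add, hux'.1 i, zi hv hii,
        zi (η.e_mul_star_π hux') hii]
      abel
    have h := congrArg star (η.mem_peirce_left ru)
    rw [star_mul, star_e, opp_opp] at h
    rw [mat_short, sub_mul, emb_mul_emb_zero, emb_mul_emb_zero, sub_zero]
    · generalize (η.ultrashortTransvection j (-act u (-x)) hux').β = t' at e2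
      rw [star_mul, ← h, mul_assoc, mul_assoc, e2, mul_zero, mul_zero]
    · generalize (η.ultrashortTransvection j (-act u (-x)) hux').β = t' at e1
      rw [← xr, mul_assoc, mul_assoc, e1, mul_zero, mul_zero]
  rw [β_short, β_ultrashort, ← ht, mat_mul, b1, zero_add, mat_short, mat_short, mat_ultrashort,
    mat_ultrashort, ev, eπ, eρ]
  simp only [add_mul, sub_mul, t5]
  simp only [mul_assoc (η.qv _), ← map_mul, t1, t2, t3, t4]
  simp only [star_mul, map_sub, map_add, map_neg, map_zero, mul_add, mul_sub, w1, w2, w3, w4, z1,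
    z2, z3, z4, mul_zero, mul_neg]
  abel

end FreeHyperbolicFamily

/-! ### Weights of signed indices, and two lemmas on normalizers -/

namespace SignedIndex

variable {n : ℕ}

/-- The odd extension of a function `w` of the indices `1, …, n` to `±1, …, ±n`. -/
def wt (w : Fin n → ℤ) (i : SignedIndex n) : ℤ := if i.2 then w i.1 else -w i.1

@[simp] lemma wt_opp (w : Fin n → ℤ) (i : SignedIndex n) : wt w i.opp = -wt w i := by
  rcases i with ⟨i, _ | _⟩ <;> simp [wt, opp]

@[simp] lemma wt_neg (w : Fin n → ℤ) (i : SignedIndex n) : wt (-w) i = -wt w i := by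
  rcases i with ⟨i, _ | _⟩ <;> simp [wt]

@[simp] lemma wt_true (w : Fin n → ℤ) (i : Fin n) : wt w (i, true) = w i := rfl

@[simp] lemma wt_false (w : Fin n → ℤ) (i : Fin n) : wt w (i, false) = -w i := rfl

end SignedIndex

section Group

variable {G : Type*} [Group G]

/-- Conjugation by a generator maps the second closure into itself; since the inverse generator does
the same, the map is onto. -/
lemma closure_le_normalizer {S T : Set G} (hS : ∀ g ∈ S, g⁻¹ ∈ S)
    (h : ∀ g ∈ S, ∀ t ∈ T, g * t * g⁻¹ ∈ Subgroup.closure T) :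
    Subgroup.closure S ≤ Subgroup.normalizer (Subgroup.closure T : Set G) := by
  have key : ∀ g ∈ S, ∀ t ∈ Subgroup.closure T, g * t * g⁻¹ ∈ Subgroup.closure T := by
    intro g hg t ht
    induction ht using Subgroup.closure_induction with
    | mem t ht => exact h g hg t ht
    | one => simp
    | mul a b _ _ ha hb => simpa using mul_mem ha hb
    | inv a _ ha => simpa [mul_assoc] using inv_mem ha
  rw [Subgroup.closure_le]
  intro g hg
  rw [SetLike.mem_coe, Subgroup.mem_normalizer_iff]
  refine fun t => ⟨key g hg t, fun ht => ?_⟩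
  simpa [mul_assoc] using key g⁻¹ (hS g hg) _ ht

lemma conj_mem_of_le_normalizer {A B : Subgroup G} (h : A ≤ Subgroup.normalizer (B : Set G))
    {a b : G} (ha : a ∈ A) (hb : b ∈ B) : a * b * a⁻¹ ∈ B :=
  (Subgroup.mem_normalizer_iff.1 (h ha) b).1 hb

lemma conj_mem_of_le_normalizer' {A B : Subgroup G} (h : A ≤ Subgroup.normalizer (B : Set G))
    {a b : G} (ha : a ∈ A) (hb : b ∈ B) : a⁻¹ * b * a ∈ B := by
  simpa using conj_mem_of_le_normalizer h (inv_mem ha) hb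

/-- If `A` normalizes `B`, and all generators of `C` are in `A` or in `B`, then `C ⊆ B A`. -/
lemma exists_mul_of_le_normalizer {A B : Subgroup G} (h : A ≤ Subgroup.normalizer (B : Set G))
    {S : Set G} (hS : ∀ s ∈ S, s ∈ A ∨ s ∈ B) {c : G} (hc : c ∈ Subgroup.closure S) :
    ∃ b ∈ B, ∃ a ∈ A, c = b * a := by
  induction hc using Subgroup.closure_induction with
  | mem s hs =>
    rcases hS s hs with hs | hs
    · exact ⟨1, one_mem _, s, hs, (one_mul s).symm⟩
    · exact ⟨s, hs, 1, one_mem _, (mul_one s).symm⟩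
  | one => exact ⟨1, one_mem _, 1, one_mem _, (mul_one 1).symm⟩
  | mul x y _ _ hx hy =>
    obtain ⟨b, hb, a, ha, rfl⟩ := hx
    obtain ⟨b', hb', a', ha', rfl⟩ := hy
    exact ⟨b * (a * b' * a⁻¹), mul_mem hb (conj_mem_of_le_normalizer h ha hb'), a * a',
      mul_mem ha ha', by group⟩
  | inv x _ hx =>
    obtain ⟨b, hb, a, ha, rfl⟩ := hx
    exact ⟨a⁻¹ * b⁻¹ * a, conj_mem_of_le_normalizer' h ha (inv_mem hb), a⁻¹, inv_mem ha, by group⟩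

end Group

/-! ### Unipotent radical and Levi subgroup of a weight -/

namespace FreeHyperbolicFamily

open OddFormRing.Model SignedIndex
open OddUnitary (mat mat_mul β_mul mat_injective mat_one eq_one_of_mat mat_inv proj_mat β_inv)

variable {R Δ : Type*} [NonUnitalRing R] [StarRing R] [AddGroup Δ] [OddFormRing R Δ] {n : ℕ}
  (η : FreeHyperbolicFamily R Δ n) (w : Fin n → ℤ)

/-- The elementary transvections of positive weight; `T_{ij}` has the weight `wt i - wt j` and
`T_k` has the weight `-wt k`. -/
def unipotentGenerators : Set (OddUnitary R Δ) :=
  {g | ∃ (i j : SignedIndex n) (hij : i.1 ≠ j.1) (x : R) (hx : x ∈ η.peirce i j),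
      wt w j < wt w i ∧ g = η.shortTransvection i j hij x hx} ∪
  {g | ∃ (k : SignedIndex n) (u : Δ) (hu : u ∈ η.delta0At k),
      wt w k < 0 ∧ g = η.ultrashortTransvection k u hu}

/-- The elementary transvections of weight zero. -/
def leviGenerators : Set (OddUnitary R Δ) :=
  {g | ∃ (i j : SignedIndex n) (hij : i.1 ≠ j.1) (x : R) (hx : x ∈ η.peirce i j),
      wt w j = wt w i ∧ g = η.shortTransvection i j hij x hx} ∪
  {g | ∃ (k : SignedIndex n) (u : Δ) (hu : u ∈ η.delta0At k),
      wt w k = 0 ∧ g = η.ultrashortTransvection k u hu}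

/-- The unipotent radical of the elementary parabolic subgroup given by the weight `w`. -/
def unipotent : Subgroup (OddUnitary R Δ) := Subgroup.closure (η.unipotentGenerators w)

/-- The Levi subgroup of the elementary parabolic subgroup given by the weight `w`. -/
def levi : Subgroup (OddUnitary R Δ) := Subgroup.closure (η.leviGenerators w)

variable {w}

lemma short_mem_unipotent {i j : SignedIndex n} (hij : i.1 ≠ j.1) {x : R} (hx : x ∈ η.peirce i j)
    (h : wt w j < wt w i) : η.shortTransvection i j hij x hx ∈ η.unipotent w :=
  Subgroup.subset_closure (Or.inl ⟨i, j, hij, x, hx, h, rfl⟩)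

lemma ultrashort_mem_unipotent {k : SignedIndex n} {u : Δ} (hu : u ∈ η.delta0At k)
    (h : wt w k < 0) : η.ultrashortTransvection k u hu ∈ η.unipotent w :=
  Subgroup.subset_closure (Or.inr ⟨k, u, hu, h, rfl⟩)

lemma short_mem_levi {i j : SignedIndex n} (hij : i.1 ≠ j.1) {x : R} (hx : x ∈ η.peirce i j)
    (h : wt w j = wt w i) : η.shortTransvection i j hij x hx ∈ η.levi w :=
  Subgroup.subset_closure (Or.inl ⟨i, j, hij, x, hx, h, rfl⟩)

lemma ultrashort_mem_levi {k : SignedIndex n} {u : Δ} (hu : u ∈ η.delta0At k)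
    (h : wt w k = 0) : η.ultrashortTransvection k u hu ∈ η.levi w :=
  Subgroup.subset_closure (Or.inr ⟨k, u, hu, h, rfl⟩)

lemma inv_mem_leviGenerators {g : OddUnitary R Δ} (hg : g ∈ η.leviGenerators w) :
    g⁻¹ ∈ η.leviGenerators w := by
  rcases hg with ⟨i, j, hij, x, hx, h, rfl⟩ | ⟨k, u, hu, h, rfl⟩
  · exact Or.inl ⟨i, j, hij, -x, η.neg_mem_peirce hx, h, η.shortTransvection_inv i j hij x hx⟩
  · exact Or.inr ⟨k, -u, η.neg_mem_delta0At hu, h, η.ultrashortTransvection_inv k u hu⟩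

lemma conj_eq_of_mul_eq {g h k : OddUnitary R Δ} (H : g * h = k * (h * g)) :
    g * h * g⁻¹ = k * h := by
  rw [H]; group

lemma conj_eq_of_commute {g h : OddUnitary R Δ} (H : Commute g h) :
    g * h * g⁻¹ = h := by
  rw [H.eq]; group

/-- The weight of a commutator is the sum of the weights, whether the result is short or, for `l =
-i`, ultrashort. The case `l = i` is excluded by the weights. -/
lemma short_conj_short_of_contact {i j l : SignedIndex n} (hij : i.1 ≠ j.1) (hjl : j.1 ≠ l.1)
    {x y : R} (hx : x ∈ η.peirce i j) (hy : y ∈ η.peirce j l) (h1 : wt w j = wt w i)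
    (h2 : wt w l < wt w j) :
    η.shortTransvection i j hij x hx * η.shortTransvection j l hjl y hy *
      (η.shortTransvection i j hij x hx)⁻¹ ∈ η.unipotent w := by
  by_cases hil : i.1 = l.1
  · rcases eq_or_eq_opp hil.symm with rfl | rfl
    · omega
    · have hxy : x * y ∈ η.peirce i.opp.opp i.opp := by
        rw [opp_opp]; exact η.mul_mem_peirce hx hy
      rw [conj_eq_of_mul_eq (η.short_mul_short_opp hij hjl hx hy hxy)]
      refine mul_mem (η.ultrashort_mem_unipotent _ ?_) (η.short_mem_unipotent _ _ h2)
      rw [wt_opp] at *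
      omega
  · rw [conj_eq_of_mul_eq (η.short_mul_short_comp hij hjl hil hx hy)]
    exact mul_mem (η.short_mem_unipotent _ _ (by omega)) (η.short_mem_unipotent _ _ h2)

/-- Each of the four possible contacts becomes `j = k` after one or both transvections are flipped;
without contact they commute. -/
lemma short_conj_short {i j k l : SignedIndex n} (hij : i.1 ≠ j.1) (hkl : k.1 ≠ l.1)
    {x y : R} (hx : x ∈ η.peirce i j) (hy : y ∈ η.peirce k l) (h1 : wt w j = wt w i)
    (h2 : wt w l < wt w k) :
    η.shortTransvection i j hij x hx * η.shortTransvection k l hkl y hy *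
      (η.shortTransvection i j hij x hx)⁻¹ ∈ η.unipotent w := by
  have hij' : j.opp.1 ≠ i.opp.1 := hij.symm
  have hkl' : l.opp.1 ≠ k.opp.1 := hkl.symm
  by_cases c1 : j = k
  · subst c1
    exact η.short_conj_short_of_contact hij hkl hx hy h1 h2
  by_cases c2 : i = l
  · subst c2
    rw [η.shortTransvection_flip i j hij x hx hij', η.shortTransvection_flip k i hkl y hy hkl']
    apply η.short_conj_short_of_contact <;> simp only [wt_opp] <;> omega
  by_cases c3 : j = l.opp
  · subst c3
    rw [η.shortTransvection_flip k l hkl y hy hkl']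
    apply η.short_conj_short_of_contact <;> simp only [wt_opp] at * <;> omega
  by_cases c4 : i = k.opp
  · subst c4
    have hk : j.opp.1 ≠ k.1 := hij.symm
    have : η.shortTransvection k.opp j hij x hx = η.shortTransvection j.opp k hk (-star x)
        (η.neg_mem_peirce (η.star_mem_peirce_opp hx)) := by
      rw [η.shortTransvection_flip _ j hij x hx hij']
      simp only [opp_opp]
    rw [this]
    apply η.short_conj_short_of_contact <;> simp only [wt_opp] at * <;> omega
  rw [conj_eq_of_commute (η.commute_short_short hij hkl hx hy c1 c2 c3 c4)]
  exact η.short_mem_unipotent _ _ h2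

lemma ultrashort_conj_short_eq {i j : SignedIndex n} (hij : i.1 ≠ j.1) {x : R} {u : Δ}
    (hx : x ∈ η.peirce i j) (hu : u ∈ η.delta0At i) :
    ∃ (hij' : i.opp.1 ≠ j.1) (hux : (ρ u : R) * x ∈ η.peirce i.opp j)
      (hux' : -act u (-x) ∈ η.delta0At j),
    η.ultrashortTransvection i u hu * η.shortTransvection i j hij x hx =
      (η.shortTransvection i.opp j hij' (ρ u * x) hux *
        η.ultrashortTransvection j (-act u (-x)) hux') *
        (η.shortTransvection i j hij x hx * η.ultrashortTransvection i u hu) :=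
  have hux := η.mul_mem_peirce (η.mem_delta0At_ρ hu) hx
  have hux' := η.neg_mem_delta0At (η.act_mem_delta0At hu.1 (η.neg_mem_peirce hx))
  ⟨hij, hux, hux', η.ultrashort_mul_short hij hij hx hu hux hux'⟩

lemma ultrashort_conj_short_of_contact {i j : SignedIndex n} (hij : i.1 ≠ j.1) {x : R} {u : Δ}
    (hx : x ∈ η.peirce i j) (hu : u ∈ η.delta0At i) (h1 : wt w i = 0) (h2 : wt w j < 0) :
    η.ultrashortTransvection i u hu * η.shortTransvection i j hij x hx *
      (η.ultrashortTransvection i u hu)⁻¹ ∈ η.unipotent w := by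
  obtain ⟨hij', hux, hux', H⟩ := η.ultrashort_conj_short_eq hij hx hu
  rw [conj_eq_of_mul_eq H]
  refine mul_mem (mul_mem (η.short_mem_unipotent _ _ ?_) (η.ultrashort_mem_unipotent _ h2))
    (η.short_mem_unipotent _ _ ?_)
  · rw [wt_opp]; omega
  · omega

lemma ultrashort_conj_short {i j k : SignedIndex n} (hij : i.1 ≠ j.1) {x : R} {u : Δ}
    (hx : x ∈ η.peirce i j) (hu : u ∈ η.delta0At k) (h1 : wt w k = 0) (h2 : wt w j < wt w i) :
    η.ultrashortTransvection k u hu * η.shortTransvection i j hij x hx *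
      (η.ultrashortTransvection k u hu)⁻¹ ∈ η.unipotent w := by
  have hij' : j.opp.1 ≠ i.opp.1 := hij.symm
  by_cases c1 : k = i
  · subst c1
    exact η.ultrashort_conj_short_of_contact hij hx hu h1 (by omega)
  by_cases c2 : k = j.opp
  · subst c2
    rw [η.shortTransvection_flip i j hij x hx hij']
    apply η.ultrashort_conj_short_of_contact <;> simp only [wt_opp] at * <;> omega
  rw [conj_eq_of_commute (η.commute_ultrashort_short hij hx hu c1 c2)]
  exact η.short_mem_unipotent _ _ h2

/-- The relation for the opposite order of the factors, solved for the other conjugate; its extra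
factors again have positive weight. -/
lemma short_conj_ultrashort_of_contact {i j : SignedIndex n} (hij : i.1 ≠ j.1) {x : R} {u : Δ}
    (hx : x ∈ η.peirce i j) (hu : u ∈ η.delta0At i) (h1 : wt w j = wt w i) (h2 : wt w i < 0) :
    η.shortTransvection i j hij x hx * η.ultrashortTransvection i u hu *
      (η.shortTransvection i j hij x hx)⁻¹ ∈ η.unipotent w := by
  obtain ⟨hij', hux, hux', H⟩ := η.ultrashort_conj_short_eq hij hx hu
  have : η.shortTransvection i j hij x hx * η.ultrashortTransvection i u hu *
      (η.shortTransvection i j hij x hx)⁻¹ =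
      (η.shortTransvection i.opp j hij' (ρ u * x) hux *
        η.ultrashortTransvection j (-act u (-x)) hux')⁻¹ * η.ultrashortTransvection i u hu := by
    rw [mul_inv_eq_iff_eq_mul, mul_assoc, H]
    group
  rw [this]
  refine mul_mem (inv_mem (mul_mem (η.short_mem_unipotent _ _ ?_)
    (η.ultrashort_mem_unipotent _ ?_))) (η.ultrashort_mem_unipotent _ h2)
  · rw [wt_opp]; omega
  · omega

lemma short_conj_ultrashort {i j k : SignedIndex n} (hij : i.1 ≠ j.1) {x : R} {u : Δ}
    (hx : x ∈ η.peirce i j) (hu : u ∈ η.delta0At k) (h1 : wt w j = wt w i) (h2 : wt w k < 0) :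
    η.shortTransvection i j hij x hx * η.ultrashortTransvection k u hu *
      (η.shortTransvection i j hij x hx)⁻¹ ∈ η.unipotent w := by
  have hij' : j.opp.1 ≠ i.opp.1 := hij.symm
  by_cases c1 : k = i
  · subst c1
    exact η.short_conj_ultrashort_of_contact hij hx hu h1 h2
  by_cases c2 : k = j.opp
  · subst c2
    rw [η.shortTransvection_flip i j hij x hx hij']
    apply η.short_conj_ultrashort_of_contact <;> simp only [wt_opp] at * <;> omega
  rw [conj_eq_of_commute (η.commute_ultrashort_short hij hx hu c1 c2).symm]
  exact η.ultrashort_mem_unipotent _ h2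

/-- An index of weight zero and one of negative weight differ in absolute value, so the commutator
is a short transvection. -/
lemma ultrashort_conj_ultrashort {i j : SignedIndex n} {u v : Δ}
    (hu : u ∈ η.delta0At i) (hv : v ∈ η.delta0At j) (h1 : wt w i = 0) (h2 : wt w j < 0) :
    η.ultrashortTransvection i u hu * η.ultrashortTransvection j v hv *
      (η.ultrashortTransvection i u hu)⁻¹ ∈ η.unipotent w := by
  have hij : i.opp.1 ≠ j.1 := by
    intro h
    rcases eq_or_eq_opp h.symm with rfl | rfl <;> simp only [wt_opp] at h2 <;> omega
  have huv : -(star (π u : R) * π v) ∈ η.peirce i.opp j := by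
    apply η.neg_mem_peirce
    change _ * (_ * _) * _ = _
    rw [← mul_assoc, η.e_mul_star_π hu, mul_assoc, η.mem_delta0At_π hv]
  rw [conj_eq_of_mul_eq (η.ultrashort_mul_ultrashort hij hu hv huv)]
  refine mul_mem (η.short_mem_unipotent _ _ ?_) (η.ultrashort_mem_unipotent _ h2)
  rw [wt_opp]; omega

variable (w)

/-- The Levi subgroup normalizes the unipotent radical. -/
lemma levi_le_normalizer :
    η.levi w ≤ Subgroup.normalizer (η.unipotent w : Set (OddUnitary R Δ)) := by
  refine closure_le_normalizer (fun g hg => η.inv_mem_leviGenerators hg) ?_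
  rintro _ (⟨i, j, hij, x, hx, h1, rfl⟩ | ⟨k, u, hu, h1, rfl⟩) _
    (⟨i', j', hij', x', hx', h2, rfl⟩ | ⟨k', u', hu', h2, rfl⟩)
  · exact η.short_conj_short hij hij' hx hx' h1 h2
  · exact η.short_conj_ultrashort hij hx hu' h1 h2
  · exact η.ultrashort_conj_short hij' hx' hu h1 h2
  · exact η.ultrashort_conj_ultrashort hu hu' h1 h2

variable {w}

lemma leviGenerators_neg : η.leviGenerators (-w) = η.leviGenerators w := by
  simp [leviGenerators]

lemma levi_neg : η.levi (-w) = η.levi w := by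
  rw [levi, levi, leviGenerators_neg]

end FreeHyperbolicFamily

/-! ### The flag, line and tail weights -/

namespace FreeHyperbolicFamily

open OddFormRing.Model SignedIndex
open OddUnitary (mat mat_mul β_mul mat_injective mat_one eq_one_of_mat mat_inv proj_mat β_inv)

section Weights

variable {n : ℕ}

/-- The weight whose parabolic subgroup stabilizes the isotropic flag given by the indices
`2, …, n` and `1, …, n`. -/
def flagWeight (n : ℕ) (i : Fin n) : ℤ := if i.val = 0 then 1 else 2

/-- The weight whose parabolic subgroup stabilizes the isotropic line given by the index `n`. -/
def lineWeight (n : ℕ) (i : Fin n) : ℤ := if i.val + 1 = n then 1 else 0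

/-- The weight whose parabolic subgroup stabilizes the isotropic subspace given by the indices
`3, …, n`. -/
def tailWeight (n : ℕ) (i : Fin n) : ℤ := if i.val ≤ 1 then 0 else 1

/-- Passing to the flag weight may lose strictness but never the sign, so the radical of the tail
lies in the parabolic subgroup of the flag. -/
lemma flagWeight_le_of_tailWeight_lt {i j : SignedIndex n}
    (h : wt (tailWeight n) j < wt (tailWeight n) i) :
    wt (flagWeight n) j ≤ wt (flagWeight n) i := by
  rcases i with ⟨i, _ | _⟩ <;> rcases j with ⟨j, _ | _⟩ <;>
    simp only [wt_true, wt_false, flagWeight, tailWeight] at * <;> split_ifs at * <;> omega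

lemma flagWeight_neg_of_tailWeight_neg {k : SignedIndex n}
    (h : wt (tailWeight n) k < 0) : wt (flagWeight n) k < 0 := by
  rcases k with ⟨i, _ | _⟩ <;>
    simp only [wt_true, wt_false, flagWeight, tailWeight] at * <;> split_ifs at * <;> omega

lemma flagWeight_le_of_lineWeight_lt (hn : 3 ≤ n) {i j : SignedIndex n}
    (h : wt (lineWeight n) j < wt (lineWeight n) i) :
    wt (flagWeight n) j ≤ wt (flagWeight n) i := by
  rcases i with ⟨i, _ | _⟩ <;> rcases j with ⟨j, _ | _⟩ <;>
    simp only [wt_true, wt_false, flagWeight, lineWeight] at * <;> split_ifs at * <;> omega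

lemma flagWeight_neg_of_lineWeight_neg {k : SignedIndex n}
    (h : wt (lineWeight n) k < 0) : wt (flagWeight n) k < 0 := by
  rcases k with ⟨i, _ | _⟩ <;>
    simp only [wt_true, wt_false, flagWeight, lineWeight] at * <;> split_ifs at * <;> omega

lemma lineWeight_cases (k : SignedIndex n) :
    IdxLE (n - 1) k ∧ wt (lineWeight n) k = 0 ∨
      k.1.val + 1 = n ∧ wt (lineWeight n) k = if k.2 then 1 else -1 := by
  have := k.1.isLt
  by_cases h : k.1.val + 1 = n
  · exact Or.inr ⟨h, by simp [wt, lineWeight, h]⟩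
  · refine Or.inl ⟨?_, by simp [wt, lineWeight, h]⟩
    change k.1.val < n - 1
    omega

lemma lineWeight_eq_zero_iff {k : SignedIndex n} : wt (lineWeight n) k = 0 ↔ IdxLE (n - 1) k := by
  rcases lineWeight_cases k with ⟨h1, h2⟩ | ⟨h1, h2⟩
  · simp [h1, h2]
  · have : ¬ IdxLE (n - 1) k := by change ¬ k.1.val < n - 1; omega
    rw [h2]
    simp only [this, iff_false]
    split_ifs <;> decide

/-- Only `±n` have nonzero line weight, and indices of distinct absolute values cannot both be `±n`.
-/
lemma lineWeight_eq_iff {i j : SignedIndex n} (hij : i.1 ≠ j.1) :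
    wt (lineWeight n) j = wt (lineWeight n) i ↔ IdxLE (n - 1) i ∧ IdxLE (n - 1) j := by
  constructor
  · intro h
    rcases lineWeight_cases i with ⟨h1, h2⟩ | ⟨h1, h2⟩ <;>
      rcases lineWeight_cases j with ⟨h3, h4⟩ | ⟨h3, h4⟩
    · exact ⟨h1, h3⟩
    · rw [h2, h4] at h; split_ifs at h; omega
    · rw [h2, h4] at h; split_ifs at h; omega
    · exact absurd (Fin.ext (by omega)) hij
  · rintro ⟨h1, h2⟩
    rw [lineWeight_eq_zero_iff.2 h1, lineWeight_eq_zero_iff.2 h2]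

end Weights

variable {R Δ : Type*} [NonUnitalRing R] [StarRing R] [AddGroup Δ] [OddFormRing R Δ] {n : ℕ}
  (η : FreeHyperbolicFamily R Δ n)

lemma levi_lineWeight : η.levi (lineWeight n) = η.E (n - 1) := by
  apply le_antisymm <;> refine (Subgroup.closure_mono ?_)
  · rintro _ (⟨i, j, hij, x, hx, h, rfl⟩ | ⟨k, u, hu, h, rfl⟩)
    · obtain ⟨h1, h2⟩ := (lineWeight_eq_iff hij).1 h
      exact Or.inl ⟨i, j, hij, x, hx, h1, h2, rfl⟩
    · exact Or.inr ⟨k, u, hu, lineWeight_eq_zero_iff.1 h, rfl⟩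
  · rintro _ (⟨i, j, hij, x, hx, h1, h2, rfl⟩ | ⟨k, u, hu, h, rfl⟩)
    · exact Or.inl ⟨i, j, hij, x, hx, (lineWeight_eq_iff hij).2 ⟨h1, h2⟩, rfl⟩
    · exact Or.inr ⟨k, u, hu, lineWeight_eq_zero_iff.2 h, rfl⟩

/-- The elementary parabolic subgroup of the flag given by `2, …, n` and `1, …, n`. -/
def flagParabolic : Subgroup (OddUnitary R Δ) :=
  η.unipotent (flagWeight n) ⊔ η.levi (flagWeight n)

lemma short_mem_flagParabolic {i j : SignedIndex n} (hij : i.1 ≠ j.1) {x : R}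
    (hx : x ∈ η.peirce i j) (h : wt (flagWeight n) j ≤ wt (flagWeight n) i) :
    η.shortTransvection i j hij x hx ∈ η.flagParabolic := by
  rcases h.eq_or_lt with h | h
  · exact Subgroup.mem_sup_right (η.short_mem_levi hij hx h)
  · exact Subgroup.mem_sup_left (η.short_mem_unipotent hij hx h)

lemma ultrashort_mem_flagParabolic {k : SignedIndex n} {u : Δ}
    (hu : u ∈ η.delta0At k) (h : wt (flagWeight n) k < 0) :
    η.ultrashortTransvection k u hu ∈ η.flagParabolic :=
  Subgroup.mem_sup_left (η.ultrashort_mem_unipotent hu h)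

lemma unipotent_tailWeight_le : η.unipotent (tailWeight n) ≤ η.flagParabolic := by
  rw [unipotent, Subgroup.closure_le]
  rintro _ (⟨i, j, hij, x, hx, h, rfl⟩ | ⟨k, u, hu, h, rfl⟩)
  · exact η.short_mem_flagParabolic hij hx (flagWeight_le_of_tailWeight_lt h)
  · exact η.ultrashort_mem_flagParabolic hu (flagWeight_neg_of_tailWeight_neg h)

lemma unipotent_lineWeight_le (hn : 3 ≤ n) : η.unipotent (lineWeight n) ≤ η.flagParabolic := by
  rw [unipotent, Subgroup.closure_le]
  rintro _ (⟨i, j, hij, x, hx, h, rfl⟩ | ⟨k, u, hu, h, rfl⟩)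
  · exact η.short_mem_flagParabolic hij hx (flagWeight_le_of_lineWeight_lt hn h)
  · exact η.ultrashort_mem_flagParabolic hu (flagWeight_neg_of_lineWeight_neg h)

lemma mem_flagParabolic {q : OddUnitary R Δ} :
    q ∈ η.flagParabolic ↔
      ∃ v ∈ η.unipotent (flagWeight n), ∃ l ∈ η.levi (flagWeight n), q = v * l := by
  constructor
  · intro hq
    rw [flagParabolic, unipotent, levi, ← Subgroup.closure_union] at hq
    exact exists_mul_of_le_normalizer (η.levi_le_normalizer _)
      (fun s hs => hs.symm.imp (fun h => Subgroup.subset_closure h)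
        fun h => Subgroup.subset_closure h) hq
  · rintro ⟨v, hv, l, hl, rfl⟩
    exact mul_mem (Subgroup.mem_sup_left hv) (Subgroup.mem_sup_right hl)

/-! ### Generators of the elementary group -/

/-- For negative indices the units are the involutes of the given ones, in the reversed order. They
serve to write any root element as a commutator. -/
lemma exists_matrix_units (s : Bool) (i j : Fin n) :
    ∃ a ∈ η.peirce (i, s) (j, s), ∃ b ∈ η.peirce (j, s) (i, s), a * b = η.e (i, s) := by
  obtain ⟨E, h1, h2⟩ := η.free
  have hE : ∀ k, E k k = η.e (k, true) := fun k => by simp [h1, e]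
  have hm : ∀ i j, E i j ∈ η.peirce (i, true) (j, true) := fun i j => by
    change _ * _ * _ = _
    rw [← hE, ← hE, h2, h2]
  cases s
  · refine ⟨star (E j i), η.star_mem_peirce (hm j i), star (E i j), η.star_mem_peirce (hm i j), ?_⟩
    rw [← star_mul, h2, hE, star_e]
    rfl
  · exact ⟨E i j, hm i j, E j i, hm j i, by rw [h2, hE]⟩

section Generation

variable {η} {G : Subgroup (OddUnitary R Δ)}

/-- Matrix units factor `x` as `(x * a) * b` through the index `k`, so `T_{ij}(x)` is a commutator
of `T_{ik}` and `T_{kj}`. -/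
lemma short_mem_of_comp {i : SignedIndex n} {k j : Fin n} {s : Bool} (hik : i.1 ≠ k)
    (hkj : k ≠ j)
    (h1 : ∀ (h : i.1 ≠ (k, s).1) (x : R) (hx : x ∈ η.peirce i (k, s)),
      η.shortTransvection i (k, s) h x hx ∈ G)
    (h2 : ∀ (h : (k, s).1 ≠ (j, s).1) (x : R) (hx : x ∈ η.peirce (k, s) (j, s)),
      η.shortTransvection (k, s) (j, s) h x hx ∈ G)
    (h : i.1 ≠ (j, s).1) (x : R) (hx : x ∈ η.peirce i (j, s)) :
    η.shortTransvection i (j, s) h x hx ∈ G := by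
  obtain ⟨a, ha, b, hb, hab⟩ := η.exists_matrix_units s j k
  have hxa := η.mul_mem_peirce hx ha
  have H := η.short_mul_short_comp (j := (k, s)) (l := (j, s)) hik hkj h hxa hb
  have e1 : x = x * a * b := by rw [mul_assoc, hab, η.mem_peirce_right hx]
  have e2 : η.shortTransvection i (j, s) h x hx =
      η.shortTransvection i (j, s) h (x * a * b) (η.mul_mem_peirce hxa hb) := by
    congr 1
  rw [e2, ← mul_inv_eq_iff_eq_mul.2 H]
  exact mul_mem (mul_mem (h1 _ _ _) (h2 _ _ _)) (inv_mem (mul_mem (h2 _ _ _) (h1 _ _ _)))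

lemma short_mem_of_flip {i j : SignedIndex n}
    (H : ∀ (h : j.opp.1 ≠ i.opp.1) (x : R) (hx : x ∈ η.peirce j.opp i.opp),
      η.shortTransvection j.opp i.opp h x hx ∈ G)
    (h : i.1 ≠ j.1) (x : R) (hx : x ∈ η.peirce i j) : η.shortTransvection i j h x hx ∈ G := by
  have h' : j.opp.1 ≠ i.opp.1 := h.symm
  rw [η.shortTransvection_flip i j h x hx h']
  exact H _ _ _

/-- The commutator of `T_i(v)` and `T_{ij}(b)` is `T_j` up to a short factor `T_{-i,j}`, and every
`u` is reached by a suitable `v`. -/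
lemma ultrashort_mem_of_contact {s : Bool} {i j : Fin n} (hij : i ≠ j)
    (h1 : ∀ (u : Δ) (hu : u ∈ η.delta0At (i, s)), η.ultrashortTransvection (i, s) u hu ∈ G)
    (h2 : ∀ (h : (i, s).1 ≠ (j, s).1) (x : R) (hx : x ∈ η.peirce (i, s) (j, s)),
      η.shortTransvection (i, s) (j, s) h x hx ∈ G)
    (h3 : ∀ (h : (i, !s).1 ≠ (j, s).1) (x : R) (hx : x ∈ η.peirce (i, !s) (j, s)),
      η.shortTransvection (i, !s) (j, s) h x hx ∈ G)
    (u : Δ) (hu : u ∈ η.delta0At (j, s)) : η.ultrashortTransvection (j, s) u hu ∈ G := by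
  obtain ⟨a, ha, b, hb, hab⟩ := η.exists_matrix_units s j i
  -- This element is the `v` with `-act v (-b) = u`: the inner twist by `-e_j` undoes the signs of
  -- the commutator relation.
  have hv : act (-act u (-η.e (j, s))) a ∈ η.delta0At (i, s) := by
    refine η.act_mem_delta0At (fun k => ?_) ha
    rw [π_neg, π_act, mul_neg, ← mul_assoc, hu.1, zero_mul, neg_zero]
  obtain ⟨hij', hx, hx', H⟩ := η.ultrashort_conj_short_eq (i := (i, s)) (j := (j, s)) hij hb hv
  have e1 : -act (act (-act u (-η.e (j, s))) a) (-b) = u := by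
    rw [← act_mul, mul_neg, hab, neg_act, neg_neg, ← act_mul, neg_mul_neg, e_idem, hu.2]
  have e2 : η.ultrashortTransvection (j, s) u hu = η.ultrashortTransvection (j, s) _ hx' := by
    congr 1
    exact e1.symm
  rw [e2, ← inv_mul_eq_iff_eq_mul.2 (mul_inv_eq_iff_eq_mul.2 H)]
  exact mul_mem (inv_mem (h3 _ _ _)) (mul_mem (mul_mem (h1 _ _) (h2 _ _ _))
    (inv_mem (mul_mem (h2 _ _ _) (h1 _ _))))

end Generation

/-- The opposite root subgroups that generate the elementary group together with the parabolic
subgroup of the flag. -/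
def oppositeCorner : Subgroup (OddUnitary R Δ) :=
  η.levi (tailWeight n) ⊓ η.unipotent (-flagWeight n)

/-- The flag parabolic subgroup contains all roots of nonnegative flag weight, and the corner adds
`T_{±1,2}` and `T_1`. Commuting `T_{±1,2}` with `T_{2,j}` gives `T_{±1,j}`; then `T_{-i,j}` arises
through the index `1`, and `T_k` from `T_1` by contact. The indices `1` and `2` are the elements `o`
and `t`. -/
lemma E_le_sup (hn : 3 ≤ n) : η.E n ≤ η.flagParabolic ⊔ η.oppositeCorner := by
  set G := η.flagParabolic ⊔ η.oppositeCorner with hG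
  obtain ⟨o, ho⟩ : ∃ o : Fin n, o.val = 0 := ⟨⟨0, by omega⟩, rfl⟩
  obtain ⟨t, ht⟩ : ∃ t : Fin n, t.val = 1 := ⟨⟨1, by omega⟩, rfl⟩
  have Qs : ∀ {i j : SignedIndex n}, wt (flagWeight n) j ≤ wt (flagWeight n) i →
      ∀ (hij : i.1 ≠ j.1) (x : R) (hx : x ∈ η.peirce i j), η.shortTransvection i j hij x hx ∈ G :=
    fun h hij x hx => Subgroup.mem_sup_left (η.short_mem_flagParabolic hij hx h)
  have Ss : ∀ {i j : SignedIndex n}, wt (tailWeight n) j = wt (tailWeight n) i →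
      wt (flagWeight n) i < wt (flagWeight n) j →
      ∀ (hij : i.1 ≠ j.1) (x : R) (hx : x ∈ η.peirce i j), η.shortTransvection i j hij x hx ∈ G :=
    fun h1 h2 hij x hx => Subgroup.mem_sup_right (Subgroup.mem_inf.2
      ⟨η.short_mem_levi hij hx h1, η.short_mem_unipotent hij hx (by simpa using h2)⟩)
  have Su : ∀ {k : SignedIndex n}, wt (tailWeight n) k = 0 → 0 < wt (flagWeight n) k →
      ∀ (u : Δ) (hu : u ∈ η.delta0At k), η.ultrashortTransvection k u hu ∈ G :=
    fun h1 h2 u hu => Subgroup.mem_sup_right (Subgroup.mem_inf.2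
      ⟨η.ultrashort_mem_levi hu h1, η.ultrashort_mem_unipotent hu (by simpa using h2)⟩)
  have hot : o ≠ t := fun h => by rw [h] at ho; omega
  have A0 : ∀ (s : Bool) (h : (o, s).1 ≠ (t, true).1) (x : R) (hx : x ∈ η.peirce (o, s) (t, true)),
      η.shortTransvection (o, s) (t, true) h x hx ∈ G := by
    intro s
    apply Ss <;> cases s <;> simp [tailWeight, flagWeight, ho, ht]
  have A : ∀ (s : Bool) (j : Fin n) (h : (o, s).1 ≠ (j, true).1) (x : R)
      (hx : x ∈ η.peirce (o, s) (j, true)), η.shortTransvection (o, s) (j, true) h x hx ∈ G := by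
    intro s j
    by_cases hj : t = j
    · subst hj
      exact A0 s
    · intro h
      exact short_mem_of_comp hot hj (A0 s) (Qs (by
        have : o.val ≠ j.val := fun h' => h (Fin.ext h')
        simp only [wt_true, flagWeight]
        split_ifs <;> omega)) h
  have B : ∀ (i j : Fin n) (h : (i, false).1 ≠ (j, true).1) (x : R)
      (hx : x ∈ η.peirce (i, false) (j, true)),
      η.shortTransvection (i, false) (j, true) h x hx ∈ G := by
    intro i j
    by_cases hi : i = o
    · subst hi
      exact A false j
    by_cases hj : o = j
    · subst hj
      exact short_mem_of_flip (A false i)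
    · exact short_mem_of_comp hi hj (short_mem_of_flip (A false i)) (A true j)
  have C : ∀ (i j : Fin n) (h : (i, true).1 ≠ (j, true).1) (x : R)
      (hx : x ∈ η.peirce (i, true) (j, true)),
      η.shortTransvection (i, true) (j, true) h x hx ∈ G := by
    intro i j
    by_cases hi : i = o
    · subst hi
      exact A true j
    · have : i.val ≠ 0 := fun h => hi (Fin.ext (h.trans ho.symm))
      apply Qs
      simp only [wt_true, flagWeight]
      split_ifs <;> omega
  rw [E, Subgroup.closure_le]
  rintro _ (⟨⟨i, s⟩, ⟨j, r⟩, hij, x, hx, -, -, rfl⟩ | ⟨⟨k, s⟩, u, hu, -, rfl⟩)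
  · cases s <;> cases r
    · exact short_mem_of_flip (C j i) hij x hx
    · exact B i j hij x hx
    · apply Qs
      simp only [wt_true, wt_false, flagWeight]
      split_ifs <;> omega
    · exact C i j hij x hx
  · cases s
    · refine Subgroup.mem_sup_left (η.ultrashort_mem_flagParabolic hu ?_)
      simp only [wt_false, flagWeight]
      split_ifs <;> omega
    · have D : ∀ (u : Δ) (hu : u ∈ η.delta0At (o, true)),
          η.ultrashortTransvection (o, true) u hu ∈ G := by
        apply Su <;> simp [tailWeight, flagWeight, ho]
      by_cases hk : o = k
      · subst hk
        exact D u hu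
      · exact ultrashort_mem_of_contact hk D (C o k) (B o k) u hu

end FreeHyperbolicFamily

namespace FreeHyperbolicFamily

open OddFormRing.Model SignedIndex
open OddUnitary (mat mat_mul β_mul mat_injective mat_one eq_one_of_mat mat_inv proj_mat β_inv)

variable {R Δ : Type*} [NonUnitalRing R] [StarRing R] [AddGroup Δ] [OddFormRing R Δ] {n : ℕ}
  (η : FreeHyperbolicFamily R Δ n)

/-! ### Partial sums of the idempotents -/

/-- The idempotent `∑ e_i` over a finite set of indices. -/
def es (A : Finset (SignedIndex n)) : R := ∑ i ∈ A, η.e i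

/-- The idempotent `∑ q_i` of the model over a finite set of indices. -/
def qs (A : Finset (SignedIndex n)) : Model R Δ := ∑ i ∈ A, η.qv i

lemma qv_mul_e (i : SignedIndex n) : η.qv i * emb Δ (η.e i) = η.qv i := by
  rw [qv, ← vec_act]
  congr 1
  rcases i with ⟨k, _ | _⟩
  · simpa [e, q] using (η.pair k).act_qNeg
  · simpa [e, q] using (η.pair k).act_qPos

lemma qv_mul_zero {i j : SignedIndex n} {x : R} (hx : η.e j * x = x) (h : i ≠ j) :
    η.qv i * emb Δ x = 0 := by
  rw [← qv_mul_e, ← hx]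
  apply emb_mul_emb_zero
  rw [← mul_assoc, η.e_mul_e h, zero_mul]

variable {A B : Finset (SignedIndex n)}

lemma proj_qs : proj (η.qs A) = η.es A := by
  rw [qs, es, map_sum]
  exact Finset.sum_congr rfl fun i _ => η.proj_qv i

lemma es_mul_of_mem {i : SignedIndex n} {x : R} (hx : η.e i * x = x) (h : i ∈ A) :
    η.es A * x = x := by
  rw [es, Finset.sum_mul, Finset.sum_eq_single_of_mem i h, hx]
  exact fun j _ hj => η.mul_eq_zero_of_ne (η.e_idem j) hx hj

lemma es_mul_of_notMem {i : SignedIndex n} {x : R} (hx : η.e i * x = x) (h : i ∉ A) :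
    η.es A * x = 0 := by
  rw [es, Finset.sum_mul]
  exact Finset.sum_eq_zero fun j hj =>
    η.mul_eq_zero_of_ne (η.e_idem j) hx fun e => h (e ▸ hj)

lemma mul_es_of_mem {i : SignedIndex n} {x : R} (hx : x * η.e i = x) (h : i ∈ A) :
    x * η.es A = x := by
  rw [es, Finset.mul_sum, Finset.sum_eq_single_of_mem i h, hx]
  exact fun j _ hj => η.mul_eq_zero_of_ne hx (η.e_idem j) hj.symm

lemma mul_es_of_notMem {i : SignedIndex n} {x : R} (hx : x * η.e i = x) (h : i ∉ A) :
    x * η.es A = 0 := by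
  rw [es, Finset.mul_sum]
  exact Finset.sum_eq_zero fun j hj =>
    η.mul_eq_zero_of_ne hx (η.e_idem j) fun e => h (e ▸ hj)

lemma qs_mul_of_mem {i : SignedIndex n} {x : R} (hx : η.e i * x = x) (h : i ∈ A) :
    η.qs A * emb Δ x = η.qv i * emb Δ x := by
  rw [qs, Finset.sum_mul, Finset.sum_eq_single_of_mem i h]
  exact fun j _ hj => η.qv_mul_zero hx hj

lemma es_mul_es (h : A ⊆ B) : η.es B * η.es A = η.es A := by
  nth_rw 2 [es]
  rw [Finset.mul_sum]
  exact Finset.sum_congr rfl fun i hi => η.es_mul_of_mem (η.e_idem i) (h hi)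

lemma es_mul_es' (h : A ⊆ B) : η.es A * η.es B = η.es A := by
  nth_rw 1 [es]
  rw [Finset.sum_mul]
  exact Finset.sum_congr rfl fun i hi => η.mul_es_of_mem (η.e_idem i) (h hi)

lemma qs_mul_es (h : A ⊆ B) : η.qs B * emb Δ (η.es A) = η.qs A := by
  rw [es, map_sum, Finset.mul_sum]
  exact Finset.sum_congr rfl fun i hi => by
    rw [η.qs_mul_of_mem (η.e_idem i) (h hi), qv_mul_e]

lemma qs_mul_eq (h : A ⊆ B) {x : R} (hx : η.es A * x = x) :
    η.qs B * emb Δ x = η.qs A * emb Δ x := by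
  rw [← hx, map_mul, ← mul_assoc, ← mul_assoc, η.qs_mul_es h, η.qs_mul_es subset_rfl]

lemma star_es : star (η.es A) = ∑ i ∈ A, η.e i.opp := by
  rw [es, star_sum]
  exact Finset.sum_congr rfl fun i _ => η.star_e i

lemma star_es_mul_of_notMem {i : SignedIndex n} {x : R} (hx : η.e i * x = x)
    (h : i.opp ∉ A) : star (η.es A) * x = 0 := by
  rw [star_es, Finset.sum_mul]
  exact Finset.sum_eq_zero fun j hj =>
    η.mul_eq_zero_of_ne (η.e_idem _) hx fun e => h (by rw [← e, opp_opp]; exact hj)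

lemma star_es_mul_of_mem {i : SignedIndex n} {x : R} (hx : η.e i * x = x)
    (h : i.opp ∈ A) : star (η.es A) * x = x := by
  rw [star_es, Finset.sum_mul, Finset.sum_eq_single_of_mem _ h, opp_opp, hx]
  intro j _ hj
  refine η.mul_eq_zero_of_ne (η.e_idem _) hx fun e => hj ?_
  rw [← e, opp_opp]

lemma mul_star_es_of_notMem {i : SignedIndex n} {x : R} (hx : x * η.e i = x)
    (h : i.opp ∉ A) : x * star (η.es A) = 0 := by
  rw [star_es, Finset.mul_sum]
  exact Finset.sum_eq_zero fun j hj =>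
    η.mul_eq_zero_of_ne hx (η.e_idem _) fun e => h (by rw [e, opp_opp]; exact hj)

lemma mul_star_es_of_mem {i : SignedIndex n} {x : R} (hx : x * η.e i = x)
    (h : i.opp ∈ A) : x * star (η.es A) = x := by
  rw [star_es, Finset.mul_sum, Finset.sum_eq_single_of_mem _ h, opp_opp, hx]
  intro j _ hj
  refine η.mul_eq_zero_of_ne hx (η.e_idem _) fun e => hj ?_
  rw [e, opp_opp]

lemma es_insert {i : SignedIndex n} (h : i ∉ A) : η.es (insert i A) = η.e i + η.es A :=
  Finset.sum_insert h

lemma qs_insert {i : SignedIndex n} (h : i ∉ A) : η.qs (insert i A) = η.qv i + η.qs A :=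
  Finset.sum_insert h

/-! ### Products of transvections with a common column -/

section Column

variable {η} {G : Subgroup (OddUnitary R Δ)}

/-- The matrices of the factors simply add up: their products vanish, since `A` does not meet `±r`
and contains no two opposite indices. -/
lemma exists_column_aux {r : SignedIndex n} {a : R} (ha : a * η.e r = a)
    (hA : ∀ i ∈ A, i.1 ≠ r.1) (hs : ∀ i ∈ A, ∀ j ∈ A, i.opp ≠ j)
    (hG : ∀ i ∈ A, ∀ (h : i.1 ≠ r.1) (x : R) (hx : x ∈ η.peirce i r),
      η.shortTransvection i r h x hx ∈ G) :
    ∃ g ∈ G, g.mat = η.qs A * emb Δ a - η.qv r.opp * emb Δ (star (η.es A * a)) := by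
  classical
  induction A using Finset.induction_on with
  | empty => exact ⟨1, one_mem _, by simp [mat_one, qs, es]⟩
  | insert i A hi ih =>
    obtain ⟨g, hg, hm⟩ := ih (fun j hj => hA j (Finset.mem_insert_of_mem hj))
      (fun j hj k hk => hs j (Finset.mem_insert_of_mem hj) k (Finset.mem_insert_of_mem hk))
      (fun j hj => hG j (Finset.mem_insert_of_mem hj))
    have hir := hA i (Finset.mem_insert_self _ _)
    have hx : η.e i * a ∈ η.peirce i r := by
      change _ * (_ * a) * _ = _
      rw [← mul_assoc, e_idem, mul_assoc, ha]
    have hT := hG i (Finset.mem_insert_self _ _) hir _ hx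
    refine ⟨g * η.shortTransvection i r hir _ hx, mul_mem hg hT, ?_⟩
    have xl := η.mem_peirce_left hx
    have sl := η.mem_peirce_left (η.star_mem_peirce hx)
    have rA : ∀ j ∈ insert i A, j ≠ r := fun j hj => ne_of_fst (hA j hj)
    have z1 : a * (η.e i * a) = 0 := η.mul_eq_zero_of_ne ha xl (rA i (by simp)).symm
    have z2 : a * star (η.e i * a) = 0 := η.mul_eq_zero_of_ne ha sl (ne_opp r)
    have z3 : star (η.es A * a) * (η.e i * a) = 0 := by
      rw [star_mul, mul_assoc, η.star_es_mul_of_notMem xl, mul_zero]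
      exact fun h => hs i (by simp) _ (Finset.mem_insert_of_mem h) rfl
    have z4 : star (η.es A * a) * star (η.e i * a) = 0 := by
      rw [← star_mul, mul_assoc, ← mul_assoc a,
        η.mul_es_of_notMem ha fun h => rA r (Finset.mem_insert_of_mem h) rfl]
      simp
    rw [mat_mul, hm, mat_short, β_short, qs_insert _ hi, es_insert _ hi]
    simp only [map_sub, mul_sub, sub_mul, emb_mul_emb_zero z1, emb_mul_emb_zero z2,
      emb_mul_emb_zero z3, emb_mul_emb_zero z4, add_mul, star_add, map_add, mul_add]
    rw [map_mul, ← mul_assoc (η.qv i), qv_mul_e]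
    abel

/-- The product of the transvections `T_{ir}(e_i a)`, where `i` runs through `A`. -/
lemma exists_column {r : SignedIndex n} {a : R} (ha : a * η.e r = a) (haA : η.es A * a = a)
    (hA : ∀ i ∈ A, i.1 ≠ r.1) (hs : ∀ i ∈ A, ∀ j ∈ A, i.opp ≠ j)
    (hG : ∀ i ∈ A, ∀ (h : i.1 ≠ r.1) (x : R) (hx : x ∈ η.peirce i r),
      η.shortTransvection i r h x hx ∈ G) :
    ∃ g ∈ G, g.mat = η.qs A * emb Δ a - η.qv r.opp * emb Δ (star a) := by
  obtain ⟨g, hg, h⟩ := exists_column_aux (G := G) ha hA hs hG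
  exact ⟨g, hg, by rw [h, haA]⟩

end Column

/-! ### The Levi subgroup of the flag -/

/-- The indices `2, …, n`. -/
def flagSet (n : ℕ) : Finset (SignedIndex n) := {i | 1 ≤ i.1.val ∧ i.2 = true}

/-- The indices `3, …, n`. -/
def tailSet (n : ℕ) : Finset (SignedIndex n) := {i | 2 ≤ i.1.val ∧ i.2 = true}

/-- The indices `±2, …, ±n`. -/
def flagSetAbs (n : ℕ) : Finset (SignedIndex n) := {i | 1 ≤ i.1.val}

lemma mem_flagSet {i : SignedIndex n} : i ∈ flagSet n ↔ 1 ≤ i.1.val ∧ i.2 = true := by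
  simp [flagSet]

lemma mem_tailSet {i : SignedIndex n} : i ∈ tailSet n ↔ 2 ≤ i.1.val ∧ i.2 = true := by
  simp [tailSet]

lemma mem_flagSetAbs {i : SignedIndex n} : i ∈ flagSetAbs n ↔ 1 ≤ i.1.val := by
  simp [flagSetAbs]

lemma flagSet_subset : flagSet n ⊆ flagSetAbs n := fun _ h =>
  mem_flagSetAbs.2 (mem_flagSet.1 h).1

/-- Only `±1` have flag weight `±1`, so a short root of weight zero joins two indices of the same
sign among `±2, …, ±n`. -/
lemma of_flagWeight_eq {i j : SignedIndex n} (hij : i.1 ≠ j.1)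
    (h : wt (flagWeight n) j = wt (flagWeight n) i) :
    1 ≤ i.1.val ∧ 1 ≤ j.1.val ∧ i.2 = j.2 := by
  rcases i with ⟨i, a⟩
  rcases j with ⟨j, b⟩
  have hij' : i.val ≠ j.val := fun h => hij (Fin.ext h)
  cases a <;> cases b <;> simp only [wt_true, wt_false, flagWeight] at h ⊢ <;>
    split_ifs at h <;> (first | omega | exact ⟨by omega, by omega, trivial⟩)

lemma flagWeight_ne_zero (k : SignedIndex n) : wt (flagWeight n) k ≠ 0 := by
  rcases k with ⟨k, _ | _⟩ <;> simp only [wt_true, wt_false, flagWeight] <;> split_ifs <;> omega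

/-- The Levi subgroup of the flag is generated by `T_{ij}(x)` for positive `i` and `j`. -/
lemma levi_flag_induction {p : OddUnitary R Δ → Prop} {g : OddUnitary R Δ}
    (hg : g ∈ η.levi (flagWeight n))
    (short : ∀ (i j : SignedIndex n) (hij : i.1 ≠ j.1) (x : R) (hx : x ∈ η.peirce i j),
      i ∈ flagSet n → j ∈ flagSet n → p (η.shortTransvection i j hij x hx))
    (one : p 1) (mul : ∀ g h, p g → p h → p (g * h)) (inv : ∀ g, p g → p g⁻¹) : p g := by
  induction hg using Subgroup.closure_induction with
  | mem g hg =>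
    rcases hg with ⟨i, j, hij, x, hx, h, rfl⟩ | ⟨k, u, hu, h, rfl⟩
    · obtain ⟨h1, h2, h3⟩ := of_flagWeight_eq hij h
      cases hi : i.2
      · have hij' : j.opp.1 ≠ i.opp.1 := hij.symm
        rw [η.shortTransvection_flip i j hij x hx hij']
        exact short _ _ _ _ _ (mem_flagSet.2 ⟨h2, by simp [opp, ← h3, hi]⟩)
          (mem_flagSet.2 ⟨h1, by simp [opp, hi]⟩)
      · exact short _ _ _ _ _ (mem_flagSet.2 ⟨h1, hi⟩) (mem_flagSet.2 ⟨h2, h3 ▸ hi⟩)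
    · exact absurd h (flagWeight_ne_zero k)
  | one => exact one
  | mul g h _ _ h1 h2 => exact mul g h h1 h2
  | inv g _ h1 => exact inv g h1

/-- Elements of this Levi subgroup are block diagonal: linear on `2, …, n`, dual on `-2, …, -n`,
trivial elsewhere. The two block conditions are exchanged by inversion, which is why they are proved
together. -/
lemma levi_flag_aux {g : OddUnitary R Δ} (hg : g ∈ η.levi (flagWeight n)) :
    g.mat = η.qs (flagSetAbs n) * emb Δ g.β ∧ η.es (flagSet n) * g.β = g.β * η.es (flagSet n) ∧
      star (η.es (flagSet n)) * g.β = g.β * star (η.es (flagSet n)) := by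
  refine η.levi_flag_induction (p := fun g => g.mat = η.qs (flagSetAbs n) * emb Δ g.β ∧
      η.es (flagSet n) * g.β = g.β * η.es (flagSet n) ∧
      star (η.es (flagSet n)) * g.β = g.β * star (η.es (flagSet n))) hg ?_ ?_ ?_ ?_
  · intro i j hij x hx hi hj
    have hx' := η.star_mem_peirce hx
    have ni : i.opp ∉ flagSet n := fun h => by
      have h1 := (mem_flagSet.1 hi).2
      simpa [opp, h1] using (mem_flagSet.1 h).2
    have nj : j.opp ∉ flagSet n := fun h => by
      have h1 := (mem_flagSet.1 hj).2
      simpa [opp, h1] using (mem_flagSet.1 h).2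
    refine ⟨?_, ?_, ?_⟩
    · rw [mat_short, β_short, map_sub, mul_sub, η.qs_mul_of_mem (η.mem_peirce_left hx),
        η.qs_mul_of_mem (η.mem_peirce_left hx')]
      · exact mem_flagSetAbs.2 (mem_flagSet.1 hj).1
      · exact flagSet_subset hi
    · rw [β_short, mul_sub, sub_mul, η.es_mul_of_mem (η.mem_peirce_left hx) hi,
        η.es_mul_of_notMem (η.mem_peirce_left hx') nj,
        η.mul_es_of_mem (η.mem_peirce_right hx) hj,
        η.mul_es_of_notMem (η.mem_peirce_right hx') ni]
    · rw [β_short, mul_sub, sub_mul, η.star_es_mul_of_notMem (η.mem_peirce_left hx) ni,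
        η.star_es_mul_of_mem (η.mem_peirce_left hx') (by rwa [opp_opp]),
        η.mul_star_es_of_notMem (η.mem_peirce_right hx) nj,
        η.mul_star_es_of_mem (η.mem_peirce_right hx') (by rwa [opp_opp])]
  · simp [mat_one, OddUnitary.β_one]
  · rintro g h ⟨a1, a2, a3⟩ ⟨b1, b2, b3⟩
    refine ⟨?_, ?_, ?_⟩
    · rw [mat_mul, β_mul, a1, b1]
      simp only [map_add, map_mul, mul_add, mul_assoc]
    · simp only [β_mul, mul_add, add_mul, a2, b2, ← mul_assoc]
      rw [mul_assoc, b2, mul_assoc]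
    · simp only [β_mul, mul_add, add_mul, a3, b3, ← mul_assoc]
      rw [mul_assoc, b3, mul_assoc]
  · rintro g ⟨a1, a2, a3⟩
    refine ⟨?_, ?_, ?_⟩
    · have h : star g.β = -(g.β * star g.β) - g.β := by
        rw [← sub_eq_zero, ← g.mul_star]; abel
      rw [mat_inv, β_inv, a1]
      conv_rhs => rw [h]
      simp only [map_sub, map_neg, map_mul, mul_sub, mul_neg, mul_assoc]
    · have := congrArg star a3
      simpa only [star_mul, star_star, β_inv] using this.symm
    · have := congrArg star a2
      simpa only [star_mul, β_inv] using this.symm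

lemma mat_of_mem_levi {g : OddUnitary R Δ} (hg : g ∈ η.levi (flagWeight n)) :
    g.mat = η.qs (flagSetAbs n) * emb Δ g.β := (η.levi_flag_aux hg).1

lemma es_mul_β {g : OddUnitary R Δ} (hg : g ∈ η.levi (flagWeight n)) :
    η.es (flagSet n) * g.β = g.β * η.es (flagSet n) := (η.levi_flag_aux hg).2.1

lemma es_abs_mul_β {g : OddUnitary R Δ} (hg : g ∈ η.levi (flagWeight n)) :
    η.es (flagSetAbs n) * g.β = g.β := by
  have := congrArg proj (η.mat_of_mem_levi hg)
  rw [proj_mat, map_mul, proj_emb, proj_qs] at this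
  exact this.symm

lemma e_mul_β_of_mem_levi {g : OddUnitary R Δ} (hg : g ∈ η.levi (flagWeight n))
    {i : SignedIndex n} (hi : i.1.val = 0) : η.e i * g.β = 0 := by
  rw [← η.es_abs_mul_β hg, ← mul_assoc, η.mul_es_of_notMem (η.e_idem i), zero_mul]
  rw [mem_flagSetAbs]
  omega

lemma β_mul_e_of_mem_levi {g : OddUnitary R Δ} (hg : g ∈ η.levi (flagWeight n))
    {i : SignedIndex n} (hi : i.1.val = 0) : g.β * η.e i = 0 := by
  have := congrArg star (η.e_mul_β_of_mem_levi (inv_mem hg) (i := i.opp) hi)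
  simpa [β_inv, star_e] using this

end FreeHyperbolicFamily

/-! ### Conjugation by the Levi subgroup of the flag -/

namespace FreeHyperbolicFamily

open OddFormRing.Model SignedIndex
open OddUnitary (mat mat_mul β_mul mat_injective mat_one eq_one_of_mat mat_inv proj_mat β_inv)

variable {R Δ : Type*} [NonUnitalRing R] [StarRing R] [AddGroup Δ] [OddFormRing R Δ] {n : ℕ}
  (η : FreeHyperbolicFamily R Δ n)

lemma inv_mul_β (g : OddUnitary R Δ) : star g.β * g.β + star g.β + g.β = 0 := by
  rw [← g.star_mul]; abel

/-- Conjugation by an element of the Levi subgroup acts on the root elements of a column. -/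
lemma levi_conj_column {m : OddUnitary R Δ} (hm : m ∈ η.levi (flagWeight n))
    {i r : SignedIndex n} (hi : i ∈ flagSet n) (hr : r.1.val = 0) (hir : i.1 ≠ r.1) {x : R}
    (hx : x ∈ η.peirce i r) {A : Finset (SignedIndex n)} (hA : A ⊆ flagSet n)
    (ha : η.es A * (x + m.β * x) = x + m.β * x) {g : OddUnitary R Δ}
    (hg : g.mat = η.qs A * emb Δ (x + m.β * x) - η.qv r.opp * emb Δ (star (x + m.β * x))) :
    m * η.shortTransvection i r hir x hx * m⁻¹ = g := by
  rw [mul_inv_eq_iff_eq_mul]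
  apply mat_injective
  have xl := η.mem_peirce_left hx
  have xr := η.mem_peirce_right hx
  have sl := η.mem_peirce_left (η.star_mem_peirce hx)
  have z1 : m.β * star x = 0 := by
    rw [← sl, ← mul_assoc, η.β_mul_e_of_mem_levi hm (i := r.opp) hr, zero_mul]
  have z2 : x * m.β = 0 := by
    rw [← xr, mul_assoc, η.e_mul_β_of_mem_levi hm hr, mul_zero]
  -- With `α = 1 + β`, unitarity gives `star (α x) α = star x`; subtracting `star (α x)` leaves this
  -- identity.
  have z3 : star (x + m.β * x) * m.β = -star (m.β * x) := by
    have h1 : star m.β * (x + m.β * x) = -(m.β * x) := by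
      rw [mul_add, ← mul_assoc, ← add_mul, ← neg_mul]
      congr 1
      have := inv_mul_β m
      rw [← sub_eq_zero, ← this]
      abel
    have := congrArg star h1
    rwa [star_mul, star_star, star_neg] at this
  have e1 : η.qs (flagSetAbs n) * emb Δ (m.β * x) + η.qv i * emb Δ x =
      η.qs A * emb Δ (x + m.β * x) := by
    rw [← η.qs_mul_eq (hA.trans flagSet_subset) ha, map_add, mul_add,
      η.qs_mul_of_mem xl (flagSet_subset hi)]
    abel
  rw [mat_mul, mat_mul, hg, mat_short, β_short, sub_mul, mul_assoc, mul_assoc, ← map_mul,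
    ← map_mul, z3, add_mul, mul_assoc m.β, z2, mul_zero, ← e1, map_sub, mul_sub,
    η.mat_of_mem_levi hm, mul_assoc, mul_assoc, ← map_mul, ← map_mul, z1, star_add]
  simp only [map_add, map_neg, map_zero, mul_add, mul_neg, mul_zero, add_zero]
  abel

/-- The elementary transvections of positive weight for the flag and of weight zero for the
tail. -/
def unipotentCornerGenerators : Set (OddUnitary R Δ) :=
  {g | ∃ (i j : SignedIndex n) (hij : i.1 ≠ j.1) (x : R) (hx : x ∈ η.peirce i j),
      wt (flagWeight n) j < wt (flagWeight n) i ∧ wt (tailWeight n) j = wt (tailWeight n) i ∧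
      g = η.shortTransvection i j hij x hx} ∪
  {g | ∃ (k : SignedIndex n) (u : Δ) (hu : u ∈ η.delta0At k),
      wt (flagWeight n) k < 0 ∧ wt (tailWeight n) k = 0 ∧ g = η.ultrashortTransvection k u hu}

/-- The root subgroups that generate the unipotent radical of the flag parabolic subgroup
together with the unipotent radical of the tail parabolic subgroup. -/
def unipotentCorner : Subgroup (OddUnitary R Δ) :=
  Subgroup.closure η.unipotentCornerGenerators

lemma unipotentCorner_le : η.unipotentCorner ≤ η.levi (tailWeight n) := by
  refine Subgroup.closure_mono ?_
  rintro _ (⟨i, j, hij, x, hx, -, h, rfl⟩ | ⟨k, u, hu, -, h, rfl⟩)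
  · exact Or.inl ⟨i, j, hij, x, hx, h, rfl⟩
  · exact Or.inr ⟨k, u, hu, h, rfl⟩

/-- A root of positive flag weight has nonnegative tail weight: those of positive weight generate a
normalized part, those of weight zero are the corner. -/
lemma unipotent_flag_eq {v : OddUnitary R Δ} (hv : v ∈ η.unipotent (flagWeight n)) :
    ∃ k ∈ η.unipotent (tailWeight n), ∃ b ∈ η.unipotentCorner, v = k * b := by
  refine exists_mul_of_le_normalizer (S := η.unipotentGenerators (flagWeight n))
    (η.unipotentCorner_le.trans (η.levi_le_normalizer _)) ?_ hv
  rintro _ (⟨i, j, hij, x, hx, h, rfl⟩ | ⟨k, u, hu, h, rfl⟩)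
  · rcases lt_trichotomy (wt (tailWeight n) j) (wt (tailWeight n) i) with h' | h' | h'
    · exact Or.inr (η.short_mem_unipotent hij hx h')
    · exact Or.inl (Subgroup.subset_closure
        (Or.inl ⟨i, j, hij, x, hx, h, h', rfl⟩))
    · exact absurd (flagWeight_le_of_tailWeight_lt h') (by omega)
  · rcases lt_trichotomy (wt (tailWeight n) k) 0 with h' | h' | h'
    · exact Or.inr (η.ultrashort_mem_unipotent hu h')
    · exact Or.inl (Subgroup.subset_closure
        (Or.inr ⟨k, u, hu, h, h', rfl⟩))
    · have := flagWeight_neg_of_tailWeight_neg (k := k.opp) (n := n) (by rw [wt_opp]; omega)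
      rw [wt_opp] at this
      omega

/-- The indices `2, …, n - 1`. -/
def innerSet (n : ℕ) : Finset (SignedIndex n) := {i | 1 ≤ i.1.val ∧ i.1.val + 1 < n ∧ i.2 = true}

lemma mem_innerSet {i : SignedIndex n} :
    i ∈ innerSet n ↔ 1 ≤ i.1.val ∧ i.1.val + 1 < n ∧ i.2 = true := by
  simp [innerSet]

lemma innerSet_subset : innerSet n ⊆ flagSet n := fun _ h =>
  mem_flagSet.2 ⟨(mem_innerSet.1 h).1, (mem_innerSet.1 h).2.2⟩

lemma es_flagSet {l : Fin n} (hl : l.val + 1 = n) (h2 : 2 ≤ n) :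
    η.es (flagSet n) = η.e (l, true) + η.es (innerSet n) := by
  rw [← es_insert]
  · congr 1
    ext i
    rw [Finset.mem_insert, mem_flagSet, mem_innerSet]
    constructor
    · rintro ⟨h1, h2⟩
      by_cases h : i.1.val + 1 < n
      · exact Or.inr ⟨h1, h, h2⟩
      · exact Or.inl (Prod.ext (Fin.ext (by dsimp only; omega)) h2)
    · rintro (rfl | h)
      · exact ⟨by dsimp only; omega, rfl⟩
      · exact ⟨h.1, h.2.2⟩
  · rw [mem_innerSet]
    dsimp only
    omega

lemma opp_ne_of_flagSet {A : Finset (SignedIndex n)} (hA : A ⊆ flagSet n) :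
    ∀ i ∈ A, ∀ j ∈ A, i.opp ≠ j := by
  intro i hi j hj h
  have h1 := (mem_flagSet.1 (hA hi)).2
  have h2 := (mem_flagSet.1 (hA hj)).2
  rw [← h] at h2
  simp [opp, h1] at h2

/-- The short roots of the corner are thus `T_{2,±1}` and their flips. -/
lemma corner_of_flagWeight_lt {i j : SignedIndex n} (hij : i.1 ≠ j.1)
    (h : wt (flagWeight n) j < wt (flagWeight n) i)
    (h' : wt (tailWeight n) j = wt (tailWeight n) i) :
    (i.1.val = 1 ∧ i.2 = true ∧ j.1.val = 0) ∨ (j.1.val = 1 ∧ j.2 = false ∧ i.1.val = 0) := by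
  rcases i with ⟨i, a⟩
  rcases j with ⟨j, b⟩
  have hij' : i.val ≠ j.val := fun h => hij (Fin.ext h)
  cases a <;> cases b <;> simp only [wt_true, wt_false, flagWeight, tailWeight] at h h' ⊢ <;>
    split_ifs at h h' <;> first | omega | (simp; omega)

/-- Conjugation by `m` turns `T_{2,±1}(x)` into the product of `T_{i,±1}(m_{i2} x)` over `i = 2, …,
n`. The hypothesis `hml` removes the factor with `i = n`, and the others have rank `n - 1`. -/
lemma unipotentCorner_conj_mem (hn : 3 ≤ n) {m : OddUnitary R Δ}
    (hm : m ∈ η.levi (flagWeight n)) {t l : Fin n} (ht : t.val = 1) (hl : l.val + 1 = n)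
    (hml : η.e (l, true) * m.β * η.e (t, true) = 0) {b : OddUnitary R Δ}
    (hb : b ∈ η.unipotentCorner) : m * b * m⁻¹ ∈ η.levi (lineWeight n) := by
  set G := (η.levi (lineWeight n)).comap (MulAut.conj m).toMonoidHom with hG
  have hGm : ∀ g, g ∈ G ↔ m * g * m⁻¹ ∈ η.levi (lineWeight n) := fun g => Iff.rfl
  obtain ⟨o, ho⟩ : ∃ o : Fin n, o.val = 0 := ⟨⟨0, by omega⟩, rfl⟩
  have hot : o ≠ t := fun h => by rw [h] at ho; omega
  have key : ∀ (r : SignedIndex n), r.1.val = 0 → ∀ (h : (t, true).1 ≠ r.1) (x : R)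
      (hx : x ∈ η.peirce (t, true) r), η.shortTransvection (t, true) r h x hx ∈ G := by
    intro r hr h x hx
    have htF : (t, true) ∈ flagSet n := mem_flagSet.2 ⟨ht.ge, rfl⟩
    have xl := η.mem_peirce_left hx
    have ha : η.es (innerSet n) * (x + m.β * x) = x + m.β * x := by
      have h1 : η.es (flagSet n) * (x + m.β * x) = x + m.β * x := by
        rw [mul_add, ← mul_assoc, η.es_mul_β hm, mul_assoc, η.es_mul_of_mem xl htF]
      have h2 : η.e (l, true) * (x + m.β * x) = 0 := by
        have h3 : η.e (l, true) * x = 0 := η.mul_eq_zero_of_ne (η.e_idem _) xl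
          (ne_of_fst fun h => by
            have : l.val = t.val := congrArg Fin.val h
            omega)
        rw [mul_add, h3, ← xl, ← mul_assoc, ← mul_assoc, hml, zero_mul, add_zero]
      rw [η.es_flagSet hl (by omega), add_mul, h2, zero_add] at h1
      exact h1
    obtain ⟨g, hg, hgm⟩ := exists_column (G := η.levi (lineWeight n)) (r := r)
      (a := x + m.β * x) (by rw [add_mul, mul_assoc, η.mem_peirce_right hx]) ha
      (fun i hi h => by
        have h1 := (mem_innerSet.1 hi).1
        rw [h] at h1
        omega)
      (opp_ne_of_flagSet innerSet_subset)
      (fun i hi h x hx => η.short_mem_levi h hx (by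
        have h1 := (mem_innerSet.1 hi).2.1
        rw [lineWeight_eq_iff h]
        exact ⟨show i.1.val < n - 1 by omega, show r.1.val < n - 1 by omega⟩))
    rw [hGm, η.levi_conj_column hm htF hr h hx innerSet_subset ha hgm]
    exact hg
  -- `T_{-1}(u)` meets no index moved by `m`, so it commutes with `m`.
  have ultra : ∀ (u : Δ) (hu : u ∈ η.delta0At (o, false)),
      η.ultrashortTransvection (o, false) u hu ∈ G := by
    intro u hu
    have : Commute m (η.ultrashortTransvection (o, false) u hu) := by
      refine η.levi_flag_induction (p := fun m => Commute m _) hm ?_ ?_ ?_ ?_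
      · intro i j hij x hx hi hj
        have hi1 := (mem_flagSet.1 hi).1
        have hj1 := (mem_flagSet.1 hj).1
        refine (η.commute_ultrashort_short hij hx hu ?_ ?_).symm
        · rintro rfl
          dsimp only at hi1
          omega
        · intro h
          rw [← opp_fst, ← h] at hj1
          dsimp only at hj1
          omega
      · exact Commute.one_left _
      · exact fun g h hg hh => hg.mul_left hh
      · exact fun g hg => hg.inv_left
    rw [hGm, this.eq, mul_inv_cancel_right]
    refine η.ultrashort_mem_levi hu (lineWeight_eq_zero_iff.2 ?_)
    change o.val < n - 1
    omega
  have key' : ∀ (r : SignedIndex n), r.1.val = 0 → ∀ (h : r.1 ≠ (t, false).1) (x : R)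
      (hx : x ∈ η.peirce r (t, false)), η.shortTransvection r (t, false) h x hx ∈ G :=
    fun r hr => short_mem_of_flip (key r.opp hr)
  have le : η.unipotentCorner ≤ G := by
    rw [unipotentCorner, Subgroup.closure_le]
    rintro _ (⟨⟨i, a⟩, ⟨j, b⟩, hij, x, hx, h, h', rfl⟩ | ⟨⟨k, a⟩, u, hu, h, h', rfl⟩)
    · rcases corner_of_flagWeight_lt hij h h' with ⟨h1, h2, h3⟩ | ⟨h1, h2, h3⟩
      · obtain rfl : i = t := Fin.ext (h1.trans ht.symm)
        obtain rfl : a = true := h2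
        exact key _ h3 hij x hx
      · obtain rfl : j = t := Fin.ext (h1.trans ht.symm)
        obtain rfl : b = false := h2
        exact key' _ h3 hij x hx
    · have h1 : a = false ∧ k.val ≤ 1 := by
        cases a <;> simp only [wt_true, wt_false, flagWeight, tailWeight] at h h' ⊢ <;>
          split_ifs at h h' <;> first | omega | (simp; omega)
      obtain ⟨rfl, h2⟩ := h1
      rcases h2.eq_or_lt with h2 | h2
      · obtain rfl : k = t := Fin.ext (h2.trans ht.symm)
        -- The conjugate of `T_{-2}(u)` needs no separate computation: `T_{-2}(u)` is generated by
        -- `T_{-1}` and `T_{±1,-2}`.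
        exact ultrashort_mem_of_contact hot ultra (key' (o, false) ho) (key' (o, true) ho) u hu
      · obtain rfl : k = o := Fin.ext (by omega)
        exact ultra u hu
  exact le hb

end FreeHyperbolicFamily

/-! ### Stable rank and shortening of unimodular columns -/

section StableRank

/-- The stable rank condition for the corner ring of an idempotent, in terms of elements of the
ambient ring. -/
def CornerStableRankLE {S : Type*} [NonUnitalRing S] (e : S) (m : ℕ) : Prop :=
  ∀ x y : Fin (m + 1) → S, (∀ k, e * x k = x k ∧ x k * e = x k) →
    (∀ k, e * y k = y k ∧ y k * e = y k) → ∑ k, y k * x k = e →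
    ∃ a z : Fin m → S, (∀ k, e * a k = a k ∧ a k * e = a k) ∧
      (∀ k, e * z k = z k ∧ z k * e = z k) ∧
      ∑ k, z k * (x k.castSucc + a k * x (Fin.last m)) = e

lemma StableRankLE.corner {S : Type*} [NonUnitalRing S] {e : S} (he : IsIdempotentElem e) {m : ℕ}
    (h : StableRankLE he.Corner m) : CornerStableRankLE e m := by
  have hv : ∀ {k} (f : Fin k → he.Corner), ((∑ i, f i : he.Corner)).1 = ∑ i, (f i).1 := by
    intro k f
    exact map_sum (⟨⟨Subtype.val, rfl⟩, fun _ _ => rfl⟩ : he.Corner →+ S) f Finset.univ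
  intro x y hx hy hxy
  have H : ∀ {z : S}, e * z = z ∧ z * e = z → z ∈ Subsemigroup.corner e :=
    fun hz => (Subsemigroup.mem_corner_iff he).2 hz
  obtain ⟨a, z, hz⟩ := h (fun k => ⟨x k, H (hx k)⟩)
    ⟨fun k => ⟨y k, H (hy k)⟩, Subtype.ext ((hv _).trans hxy)⟩
  exact ⟨fun k => (a k).1, fun k => (z k).1, fun k => (Subsemigroup.mem_corner_iff he).1 (a k).2,
    fun k => (Subsemigroup.mem_corner_iff he).1 (z k).2, (hv _).symm.trans (congrArg Subtype.val hz)⟩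

/-- A multiplicative section is enough: lift the column along `g`, shorten it, and push the result
forward along `f`. -/
lemma CornerStableRankLE.map {S T : Type*} [NonUnitalRing S] [NonUnitalRing T] {m : ℕ} {e : S}
    (h : CornerStableRankLE e m) (f : S →ₙ+* T) (g : T →ₙ+* S) (hfg : ∀ x, f (g x) = x)
    (he : g (f e) = e) : CornerStableRankLE (f e) m := by
  intro x y hx hy hxy
  have hg : ∀ {k} {x : Fin k → T}, (∀ k, f e * x k = x k ∧ x k * f e = x k) →
      ∀ k, e * g (x k) = g (x k) ∧ g (x k) * e = g (x k) := by
    intro k x hx k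
    have h1 := congrArg g (hx k).1
    have h2 := congrArg g (hx k).2
    rw [map_mul, he] at h1 h2
    exact ⟨h1, h2⟩
  obtain ⟨a, z, ha, hz, H⟩ := h (fun k => g (x k)) (fun k => g (y k)) (hg hx) (hg hy)
    (by simp only [← map_mul, ← map_sum, hxy, he])
  refine ⟨fun k => f (a k), fun k => f (z k), fun k => ?_, fun k => ?_, ?_⟩
  · rw [← map_mul, ← map_mul, (ha k).1, (ha k).2]
    exact ⟨rfl, rfl⟩
  · rw [← map_mul, ← map_mul, (hz k).1, (hz k).2]
    exact ⟨rfl, rfl⟩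
  · have := congrArg f H
    simpa only [map_sum, map_mul, map_add, hfg] using this

end StableRank

namespace FreeHyperbolicFamily

open OddFormRing.Model SignedIndex
open OddUnitary (mat mat_mul β_mul mat_injective mat_one eq_one_of_mat mat_inv proj_mat β_inv)

variable {R Δ : Type*} [NonUnitalRing R] [StarRing R] [AddGroup Δ] [OddFormRing R Δ]

lemma es_eq_sum {n : ℕ} (η : FreeHyperbolicFamily R Δ n) {p : Fin n → Prop} [DecidablePred p]
    (A : Finset (SignedIndex n)) (hA : ∀ i, i ∈ A ↔ p i.1 ∧ i.2 = true) :
    η.es A = ∑ k, if p k then η.e (k, true) else 0 := by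
  rw [es, ← Finset.sum_filter]
  refine Finset.sum_bij' (fun i _ => i.1) (fun k _ => (k, true)) ?_ ?_ ?_ ?_ ?_
  · intro i hi
    simpa using ((hA i).1 hi).1
  · intro k hk
    exact (hA _).2 ⟨(Finset.mem_filter.1 hk).2, rfl⟩
  · intro i hi
    exact Prod.ext rfl ((hA i).1 hi).2.symm
  · intro k hk
    rfl
  · intro i hi
    congr 1
    exact Prod.ext rfl ((hA i).1 hi).2

lemma es_tailSet {m : ℕ} (η : FreeHyperbolicFamily R Δ (m + 2)) :
    η.es (tailSet (m + 2)) = ∑ k : Fin m, η.e (k.succ.succ, true) := by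
  rw [η.es_eq_sum (p := fun k => 2 ≤ k.val) _ fun i => mem_tailSet, Fin.sum_univ_succ,
    Fin.sum_univ_succ]
  simp

lemma es_flagSet_eq {m : ℕ} (η : FreeHyperbolicFamily R Δ (m + 2)) :
    η.es (flagSet (m + 2)) = η.e (1, true) + ∑ k : Fin m, η.e (k.succ.succ, true) := by
  rw [η.es_eq_sum (p := fun k => 1 ≤ k.val) _ fun i => mem_flagSet, Fin.sum_univ_succ,
    Fin.sum_univ_succ]
  simp

/-- A unimodular column of length `n - 1` can be shortened. -/
lemma exists_shorten {m : ℕ} (η : FreeHyperbolicFamily R Δ (m + 2))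
    (hsr : CornerStableRankLE (η.e (0, true)) m) {l : Fin (m + 2)} {w ψ : R}
    (hw : w * η.e (l, true) = w)
    (h : ψ * η.es (flagSet (m + 2)) * w = η.e (l, true)) :
    ∃ a z : R, η.es (tailSet (m + 2)) * a = a ∧ a * η.e (1, true) = a ∧
      z * η.es (tailSet (m + 2)) = z ∧ η.e (l, true) * z = z ∧ z * (w + a * w) = η.e (l, true) := by
  obtain ⟨E, h1, h2⟩ := η.free
  have hE : ∀ k, E k k = η.e (k, true) := fun k => by simp [h1, e]
  have h3 : ∀ i j k (x : R), x * E i j * E j k = x * E i k := fun i j k x => by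
    rw [mul_assoc, h2]
  have h4 : ∀ i j k l, k ≠ l → E i k * E l j = 0 := fun i j k l hkl => by
    rw [← h2 i k k, ← h2 l l j, mul_assoc, ← mul_assoc (E k k), hE, hE, η.e_mul_e, zero_mul,
      mul_zero]
    simpa using hkl
  rw [es_flagSet_eq] at h
  simp only [← hE] at h hw ⊢
  -- The stable rank condition removes the last entry, so the index `2` is put at the end, after `3,
  -- …, n`.
  set idx : Fin (m + 1) → Fin (m + 2) := Fin.lastCases 1 fun k => k.succ.succ with hidx
  have i1 : idx (Fin.last m) = 1 := by simp [hidx]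
  have i2 : ∀ k : Fin m, idx k.castSucc = k.succ.succ := fun k => by simp [hidx]
  have mem : ∀ i j (x : R), E 0 0 * (E 0 i * x * E j 0) = E 0 i * x * E j 0 ∧
      E 0 i * x * E j 0 * E 0 0 = E 0 i * x * E j 0 := fun i j x => by
    refine ⟨?_, ?_⟩
    · rw [← mul_assoc, ← mul_assoc, h2]
    · rw [mul_assoc, h2]
  rw [← hE] at hsr
  -- Matrix units move all entries into the corner `e_1 R e_1`, where the hypothesis applies.
  obtain ⟨a, z, ha, hz, H⟩ := hsr (fun k => E 0 (idx k) * w * E l 0)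
    (fun k => E 0 l * ψ * E (idx k) 0) (fun k => mem _ _ _) (fun k => mem _ _ _) (by
      have e1 : ∀ k, E 0 l * ψ * E (idx k) 0 * (E 0 (idx k) * w * E l 0) =
          E 0 l * ψ * E (idx k) (idx k) * (w * E l 0) := fun k => by
        rw [mul_assoc (E 0 (idx k)), ← mul_assoc, h3]
      simp only [e1]
      rw [← Finset.sum_mul, ← Finset.mul_sum, Fin.sum_univ_castSucc, i1]
      simp only [i2]
      rw [add_comm (∑ k : Fin m, E k.succ.succ k.succ.succ), mul_assoc (E 0 l), ← mul_assoc _ w, mul_assoc (E 0 l), h, h2, h2])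
  simp only [i1, i2] at H
  have e1 : ∀ k : Fin m, E 0 k.succ.succ * (∑ k : Fin m, E k.succ.succ 0 * a k * E 0 1) =
      a k * E 0 1 := by
    intro k
    rw [Finset.mul_sum, Finset.sum_eq_single k]
    · rw [← mul_assoc, ← mul_assoc, h2, (ha k).1]
    · intro j _ hj
      rw [← mul_assoc, ← mul_assoc, h4 _ _ _ _ (by simpa using hj.symm), zero_mul, zero_mul]
    · simp
  refine ⟨∑ k, E k.succ.succ 0 * a k * E 0 1, ∑ k, E l 0 * z k * E 0 k.succ.succ, ?_, ?_, ?_, ?_,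
    ?_⟩
  · rw [es_tailSet, Finset.mul_sum]
    refine Finset.sum_congr rfl fun k _ => ?_
    rw [Finset.sum_mul, Finset.sum_eq_single k, ← hE, ← mul_assoc, ← mul_assoc, h2]
    · intro j _ hj
      rw [← hE, ← mul_assoc, ← mul_assoc, h4 _ _ _ _ (by simpa using hj), zero_mul, zero_mul]
    · simp
  · rw [Finset.sum_mul]
    exact Finset.sum_congr rfl fun k _ => by rw [mul_assoc, h2]
  · rw [es_tailSet, Finset.sum_mul]
    refine Finset.sum_congr rfl fun k _ => ?_
    rw [Finset.mul_sum, Finset.sum_eq_single k, ← hE, mul_assoc, h2]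
    · intro j _ hj
      rw [← hE, mul_assoc, h4 _ _ _ _ (by simpa using hj.symm), mul_zero]
    · simp
  · rw [Finset.mul_sum]
    exact Finset.sum_congr rfl fun k _ => by rw [← mul_assoc, ← mul_assoc, h2]
  · rw [Finset.sum_mul]
    have e2 : ∀ k : Fin m, E l 0 * z k * E 0 k.succ.succ *
        (w + (∑ k : Fin m, E k.succ.succ 0 * a k * E 0 1) * w) =
        E l 0 * (z k * (E 0 k.succ.succ * w * E l 0 + a k * (E 0 1 * w * E l 0))) * E 0 l := by
      intro k
      have e3 : ∀ x : R, x * w * E l 0 * E 0 l = x * w := fun x => by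
        rw [h3, mul_assoc, hw]
      rw [mul_add (E l 0 * z k * E 0 k.succ.succ), ← mul_assoc _ _ w,
        mul_assoc (E l 0 * z k) _ (∑ k : Fin m, E k.succ.succ 0 * a k * E 0 1), e1]
      simp only [mul_add, add_mul, ← mul_assoc, e3]
    rw [Finset.sum_congr rfl fun k _ => e2 k, ← Finset.sum_mul, ← Finset.mul_sum, H, h2, h2]

end FreeHyperbolicFamily

namespace FreeHyperbolicFamily

open OddFormRing.Model SignedIndex
open OddUnitary (mat mat_mul β_mul mat_injective mat_one eq_one_of_mat mat_inv proj_mat β_inv)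

variable {R Δ : Type*} [NonUnitalRing R] [StarRing R] [AddGroup Δ] [OddFormRing R Δ]

lemma star_es_eq {n : ℕ} (η : FreeHyperbolicFamily R Δ n) (A : Finset (SignedIndex n)) :
    star (η.es A) = η.es (A.image opp) := by
  rw [star_es, es, Finset.sum_image]
  intro i _ j _ h
  rw [← opp_opp i, h, opp_opp]

lemma tailSet_subset {n : ℕ} : tailSet n ⊆ flagSet n := fun _ h =>
  mem_flagSet.2 ⟨(le_trans one_le_two (mem_tailSet.1 h).1), (mem_tailSet.1 h).2⟩

/-- By the stable rank condition, multiplications from the parabolic subgroups bring an element of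
the Levi subgroup to a form with a zero entry in the inverse matrix. -/
lemma exists_reduce {m : ℕ} (hm : 1 ≤ m) (η : FreeHyperbolicFamily R Δ (m + 2))
    (hsr : CornerStableRankLE (η.e (0, true)) m) {l : Fin (m + 2)} (hl : l.val = m + 1)
    {g : OddUnitary R Δ} (hg : g ∈ η.levi (flagWeight (m + 2))) :
    ∃ c ∈ η.unipotent (tailWeight (m + 2)) ⊓ η.levi (flagWeight (m + 2)),
    ∃ y ∈ η.levi (flagWeight (m + 2)) ⊓ η.unipotent (lineWeight (m + 2)),
      η.e (l, true) * ((c⁻¹ * g * y)⁻¹).β * η.e (1, true) = 0 := by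
  have hlF : (l, true) ∈ flagSet (m + 2) := mem_flagSet.2 ⟨by dsimp only; omega, rfl⟩
  have hl1 : ((l, true) : SignedIndex (m + 2)) ≠ (1, true) := ne_of_fst fun h => by
    have : l.val = 1 := by
      rw [show l = 1 from h]; rfl
    omega
  set f := η.es (flagSet (m + 2)) with hf
  have f1 : f * η.e (l, true) = η.e (l, true) := η.es_mul_of_mem (η.e_idem _) hlF
  have f2 : η.e (l, true) * f = η.e (l, true) := η.mul_es_of_mem (η.e_idem _) hlF
  -- `w` is column `n` of the matrix of `g`, and `ψ` is row `n` of the inverse matrix, hence a left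
  -- inverse of that column.
  obtain ⟨a, z, a1, a2, z1, z2, H⟩ := η.exists_shorten hsr (l := l)
    (w := η.e (l, true) + g.β * η.e (l, true))
    (ψ := η.e (l, true) + η.e (l, true) * star g.β)
    (by rw [add_mul, mul_assoc, e_idem])
    (by
      rw [mul_assoc, mul_add, ← mul_assoc, η.es_mul_β hg, mul_assoc, f1, add_mul, mul_add,
        e_idem, mul_assoc, mul_add (star g.β), ← mul_assoc (star g.β), add_assoc, ← mul_add,
        ← add_mul, ← add_mul]
      have : g.β + (star g.β + star g.β * g.β) = 0 := by rw [← g.star_mul]; abel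
      rw [this, zero_mul, mul_zero, add_zero])
  have a3 : η.e (opp (1, true)) * star a = star a := by
    have := congrArg star a2
    rwa [star_mul, star_e] at this
  -- Left multiplication by `d` adds multiples of row `2` to the rows `3, …, n`.
  obtain ⟨d, hd, hdm⟩ := exists_column (A := tailSet (m + 2)) (r := (1, true))
    (G := η.unipotent (tailWeight (m + 2)) ⊓ η.levi (flagWeight (m + 2))) a2 a1
    (fun i hi h => by
      have h1 := (mem_tailSet.1 hi).1
      rw [h] at h1
      exact absurd h1 (by simp))
    (opp_ne_of_flagSet tailSet_subset)
    (by
      rintro ⟨i, s⟩ hi h x hx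
      obtain ⟨h1, h2⟩ := mem_tailSet.1 hi
      dsimp only at h1
      obtain rfl : s = true := h2
      refine Subgroup.mem_inf.2 ⟨η.short_mem_unipotent h hx ?_, η.short_mem_levi h hx ?_⟩
      · simp only [wt_true, tailWeight]
        rw [if_pos (by simp), if_neg (by omega)]
        norm_num
      · simp only [wt_true, flagWeight]
        rw [if_neg (by simp), if_neg (by omega)])
  have hdβ : d.β = a - star a := by
    rw [← proj_mat, hdm, map_sub, map_mul, map_mul, proj_qs, proj_qv, proj_emb, proj_emb, a1, a3]
  have hg' : d * g ∈ η.levi (flagWeight (m + 2)) := mul_mem (Subgroup.mem_inf.1 hd).2 hg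
  set b := (d * g).β with hb
  have zβ : z * b = z * a * g.β + z * a + z * g.β := by
    have : z * star a = 0 := by
      rw [← z1, ← a3, mul_assoc, ← mul_assoc (η.es _),
        ← star_star (η.es _ * η.e (opp (1, true))), star_mul, star_e,
        opp_opp, η.mul_star_es_of_notMem (η.e_idem _), star_zero, zero_mul, mul_zero]
      rw [mem_tailSet]
      simp [opp]
    rw [hb, β_mul, hdβ, mul_add, mul_add, ← mul_assoc, mul_sub, this, sub_zero]
  have zl : z * η.e (l, true) + z * b * η.e (l, true) = η.e (l, true) := by
    refine Eq.trans ?_ H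
    rw [zβ]
    simp only [mul_add, add_mul, mul_assoc]
    abel
  -- With `α = 1 + b` the matrix of `d * g`, this is `z α - e_n`. By the choice of `z` its entry at
  -- `n` vanishes, so `e_n + c` can be row `n` of an element `y` of the radical of the line.
  set c := z + z * b - η.e (l, true) with hc
  have c1 : η.e (l, true) * c = c := by
    rw [hc, mul_sub, mul_add, ← mul_assoc, z2, e_idem]
  have c2 : c * η.es (innerSet (m + 2)) = c := by
    have h1 : c * f = c := by
      have zf : z * f = z := by rw [← z1, mul_assoc, η.es_mul_es' tailSet_subset]
      rw [hc, sub_mul, add_mul, f2, mul_assoc, ← η.es_mul_β hg', ← mul_assoc, ← hf, zf]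
    have h2 : c * η.e (l, true) = 0 := by
      rw [hc, sub_mul, add_mul, zl, e_idem, sub_self]
    rwa [hf, η.es_flagSet (l := l) (by omega) (by omega), mul_add, h2, zero_add] at h1
  have c3 : η.es ((innerSet (m + 2)).image opp) * (-star c) = -star c := by
    rw [← star_es_eq, mul_neg, ← star_mul, c2]
  -- The row `n` of `y` is entered through its involute, the column `-n`.
  obtain ⟨y, hy, hym⟩ := exists_column (A := (innerSet (m + 2)).image opp) (r := (l, false))
    (G := η.levi (flagWeight (m + 2)) ⊓ η.unipotent (lineWeight (m + 2)))
    (a := -star c)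
    (by
      have := congrArg star c1
      rw [star_mul, star_e] at this
      rw [neg_mul]
      exact congrArg Neg.neg this) c3
    (by
      intro i hi h
      obtain ⟨i, hi', rfl⟩ := Finset.mem_image.1 hi
      have h1 := (mem_innerSet.1 hi').2.1
      rw [show i.1 = l from h] at h1
      omega)
    (by
      intro i hi j hj h
      obtain ⟨i, hi', rfl⟩ := Finset.mem_image.1 hi
      obtain ⟨j, hj', rfl⟩ := Finset.mem_image.1 hj
      rw [opp_opp] at h
      exact opp_ne_of_flagSet innerSet_subset j hj' i hi' h.symm)
    (by
      intro i hi h x hx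
      obtain ⟨⟨i, s⟩, hi', rfl⟩ := Finset.mem_image.1 hi
      obtain ⟨h1, h2, h3⟩ := mem_innerSet.1 hi'
      obtain rfl : s = true := h3
      dsimp only at h1 h2
      refine Subgroup.mem_inf.2 ⟨η.short_mem_levi h hx ?_, η.short_mem_unipotent h hx ?_⟩
      · simp only [wt_opp, wt_true, wt_false, flagWeight]
        rw [if_neg (by omega), if_neg (by omega)]
      · simp only [wt_opp, wt_true, wt_false, lineWeight]
        rw [if_pos (by omega), if_neg (by omega)]
        norm_num)
  have hyβ : η.e (l, true) * y.β = c := by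
    have h1 : η.e (l, true) * star c = 0 := by
      have := congrArg star c2
      rw [← this, star_mul, ← mul_assoc, η.mul_star_es_of_notMem (η.e_idem _), zero_mul]
      rw [mem_innerSet]
      simp [opp]
    rw [← proj_mat, hym, map_sub, map_mul, map_mul, proj_qs, proj_qv, proj_emb, proj_emb, c3,
      star_neg, star_star, mul_sub, mul_neg, h1, mul_neg]
    change -0 - η.e (l, true) * -(η.e (l, true) * c) = c
    rw [c1, mul_neg, c1]
    simp
  refine ⟨d⁻¹, inv_mem hd, y⁻¹, inv_mem hy, ?_⟩
  have e1 : (d⁻¹⁻¹ * g * y⁻¹)⁻¹ = y * (d * g)⁻¹ := by group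
  have z3 : z * η.e (1, true) = 0 := by
    rw [← z1, mul_assoc, η.es_mul_of_notMem (η.e_idem _), mul_zero]
    rw [mem_tailSet]
    simp
  have e2 : star b + b * star b + b = 0 := by
    rw [← (d * g).mul_star]; abel
  rw [e1, β_mul, β_inv, ← hb, mul_add, mul_add, ← mul_assoc, hyβ]
  -- Row `n` of the matrix of `y (d g)⁻¹` is `z α α⁻¹ = z`, which has no entry at the index `2`.
  have e3 : c * star b + c + η.e (l, true) * star b = z * (star b + b * star b + b) + z -
      η.e (l, true) := by
    rw [hc]
    simp only [mul_add, sub_mul, add_mul, mul_assoc]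
    abel
  rw [e3, e2, mul_zero, zero_add, sub_mul, z3, η.e_mul_e hl1, sub_zero]

end FreeHyperbolicFamily

/-! ### The decomposition of the elementary group -/

namespace FreeHyperbolicFamily

open OddFormRing.Model SignedIndex
open OddUnitary (mat mat_mul β_mul mat_injective mat_one eq_one_of_mat mat_inv proj_mat β_inv)

variable {R Δ : Type*} [NonUnitalRing R] [StarRing R] [AddGroup Δ] [OddFormRing R Δ]

section

variable {n : ℕ} (η : FreeHyperbolicFamily R Δ n)

lemma levi_le_normalizer_neg (w : Fin n → ℤ) :
    η.levi w ≤ Subgroup.normalizer (η.unipotent (-w) : Set (OddUnitary R Δ)) := by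
  rw [← levi_neg]
  exact η.levi_le_normalizer _

/-- A root of negative flag weight has nonpositive line weight, and the roots of line weight zero
normalize those of negative line weight. -/
lemma unipotent_neg_flag_eq (hn : 3 ≤ n) {g : OddUnitary R Δ}
    (hg : g ∈ η.unipotent (-flagWeight n)) :
    ∃ z ∈ η.unipotent (-lineWeight n), ∃ h ∈ η.levi (lineWeight n), g = z * h := by
  refine exists_mul_of_le_normalizer (S := η.unipotentGenerators (-flagWeight n))
    (η.levi_le_normalizer_neg _) ?_ hg
  rintro _ (⟨i, j, hij, x, hx, h, rfl⟩ | ⟨k, u, hu, h, rfl⟩) <;> rw [wt_neg] at h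
  · rcases lt_trichotomy (wt (lineWeight n) i) (wt (lineWeight n) j) with h' | h' | h'
    · exact Or.inr (η.short_mem_unipotent hij hx (by simpa using h'))
    · exact Or.inl (η.short_mem_levi hij hx h'.symm)
    · rw [wt_neg] at h
      exact absurd (flagWeight_le_of_lineWeight_lt hn h') (by omega)
  · rcases lt_trichotomy 0 (wt (lineWeight n) k) with h' | h' | h'
    · exact Or.inr (η.ultrashort_mem_unipotent hu (by simpa using h'))
    · exact Or.inl (η.ultrashort_mem_levi hu h'.symm)
    · exact absurd (flagWeight_neg_of_lineWeight_neg h') (by omega)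

/-- A root of negative line weight has nonpositive flag weight. Those of flag weight zero are split
off on the left, to be absorbed into `Q`. -/
lemma unipotent_neg_line_eq (hn : 3 ≤ n) {z : OddUnitary R Δ}
    (hz : z ∈ η.unipotent (-lineWeight n)) :
    ∃ y ∈ η.levi (flagWeight n),
      ∃ x ∈ η.unipotent (-lineWeight n) ⊓ η.unipotent (-flagWeight n), z = y * x := by
  -- Such elements normalize the opposite radical of the flag as Levi elements, and that of the line
  -- because they belong to it.
  have hN : η.unipotent (-lineWeight n) ⊓ η.levi (flagWeight n) ≤ Subgroup.normalizer
      ((η.unipotent (-lineWeight n) ⊓ η.unipotent (-flagWeight n) :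
        Subgroup (OddUnitary R Δ)) : Set (OddUnitary R Δ)) := by
    intro a ha
    obtain ⟨ha1, ha2⟩ := Subgroup.mem_inf.1 ha
    have h1 := Subgroup.mem_normalizer_iff.1 (η.levi_le_normalizer_neg _ ha2)
    rw [Subgroup.mem_normalizer_iff]
    intro h
    rw [Subgroup.mem_inf, Subgroup.mem_inf, ← h1, Subgroup.mul_mem_cancel_right _ (inv_mem ha1), Subgroup.mul_mem_cancel_left _ ha1]
  obtain ⟨b, hb, a, ha, rfl⟩ := exists_mul_of_le_normalizer (c := z)
    (B := η.unipotent (-lineWeight n) ⊓ η.unipotent (-flagWeight n))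
    (S := η.unipotentGenerators (-lineWeight n)) hN (by
      intro s hs
      have hs' : s ∈ η.unipotent (-lineWeight n) := Subgroup.subset_closure hs
      rcases hs with ⟨i, j, hij, x, hx, h, rfl⟩ | ⟨k, u, hu, h, rfl⟩
      · have h1 := flagWeight_le_of_lineWeight_lt hn (i := j) (j := i) (by simpa using h)
        rcases h1.eq_or_lt with h1 | h1
        · exact Or.inl ⟨hs', η.short_mem_levi hij hx h1.symm⟩
        · exact Or.inr ⟨hs', η.short_mem_unipotent hij hx (by simpa using h1)⟩
      · have h1 := flagWeight_neg_of_lineWeight_neg (n := n) (k := k.opp) (by simpa using h)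
        exact Or.inr ⟨hs', η.ultrashort_mem_unipotent hu (by simpa using h1)⟩) hz
  exact ⟨a, (Subgroup.mem_inf.1 ha).2, a⁻¹ * b * a, conj_mem_of_le_normalizer' hN ha hb, by group⟩

end

/-- The elementary group is the product of the flag parabolic subgroup, an opposite unipotent
subgroup, and the line parabolic subgroup. -/
lemma exists_decomposition {m : ℕ} (hm : 1 ≤ m) (η : FreeHyperbolicFamily R Δ (m + 2))
    (hsr : CornerStableRankLE (η.e (0, true)) m) {g : OddUnitary R Δ} (hg : g ∈ η.E (m + 2)) :
    ∃ q ∈ η.flagParabolic,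
    ∃ x ∈ η.unipotent (-lineWeight (m + 2)) ⊓ η.unipotent (-flagWeight (m + 2)),
    ∃ p ∈ η.levi (lineWeight (m + 2)) ⊔ η.unipotent (lineWeight (m + 2)), g = q * x * p := by
  have hl : (Fin.last (m + 1)).val = m + 1 := rfl
  set l : Fin (m + 2) := Fin.last (m + 1)
  -- The heart of the proof: `Q X P` is stable under left multiplication by the opposite corner.
  have step : ∀ T ∈ η.oppositeCorner, ∀ q ∈ η.flagParabolic,
      ∀ x ∈ η.unipotent (-lineWeight (m + 2)) ⊓ η.unipotent (-flagWeight (m + 2)),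
      ∀ p ∈ η.levi (lineWeight (m + 2)) ⊔ η.unipotent (lineWeight (m + 2)),
      ∃ q' ∈ η.flagParabolic,
      ∃ x' ∈ η.unipotent (-lineWeight (m + 2)) ⊓ η.unipotent (-flagWeight (m + 2)),
      ∃ p' ∈ η.levi (lineWeight (m + 2)) ⊔ η.unipotent (lineWeight (m + 2)),
        T * (q * x * p) = q' * x' * p' := by
    intro T hT q hq x hx p hp
    obtain ⟨hT1, hT2⟩ := Subgroup.mem_inf.1 hT
    obtain ⟨hx1, hx2⟩ := Subgroup.mem_inf.1 hx
    obtain ⟨v, hv, g, hg, rfl⟩ := η.mem_flagParabolic.1 hq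
    obtain ⟨k, hk, b, hb, rfl⟩ := η.unipotent_flag_eq hv
    obtain ⟨c, hc, y, hy, hm0⟩ := η.exists_reduce hm hsr hl hg
    obtain ⟨hc1, hc2⟩ := Subgroup.mem_inf.1 hc
    obtain ⟨hy1, hy2⟩ := Subgroup.mem_inf.1 hy
    have hg' : c⁻¹ * g * y ∈ η.levi (flagWeight (m + 2)) :=
      mul_mem (mul_mem (inv_mem hc2) hg) hy1
    set g' := c⁻¹ * g * y with hg'_def
    have hNK := η.levi_le_normalizer (tailWeight (m + 2))
    have hNH := η.levi_le_normalizer_neg (lineWeight (m + 2))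
    have hNL := η.levi_le_normalizer_neg (flagWeight (m + 2))
    -- Here `T q = T (k b) (c g' y⁻¹)`. The factors `k` and `b c b⁻¹` lie in the radical of the
    -- tail, which `T` normalizes, so they pass to the left of `T` and stay in `Q`.
    have hk' : T * (k * (b * c * b⁻¹)) * T⁻¹ ∈ η.unipotent (tailWeight (m + 2)) :=
      conj_mem_of_le_normalizer hNK hT1
        (mul_mem hk (conj_mem_of_le_normalizer hNK (η.unipotentCorner_le hb) hc1))
    -- This is where the vanishing entry `(n, 2)` of the inverse of `g'` is used.
    have hh : g'⁻¹ * b * g' ∈ η.levi (lineWeight (m + 2)) := by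
      simpa using η.unipotentCorner_conj_mem (by omega) (inv_mem hg') (t := 1) rfl
        (l := l) (by omega) hm0 hb
    have hT' : g'⁻¹ * T * g' ∈ η.unipotent (-flagWeight (m + 2)) :=
      conj_mem_of_le_normalizer' hNL hg' hT2
    have hx' : y⁻¹ * x * y ∈ η.unipotent (-flagWeight (m + 2)) :=
      conj_mem_of_le_normalizer' hNL hy1 hx2
    obtain ⟨z₁, hz₁, h₁, hh₁, e₁⟩ := η.unipotent_neg_flag_eq (by omega) hx'
    obtain ⟨z₂, hz₂, h₂, hh₂, e₂⟩ := η.unipotent_neg_flag_eq (by omega) hT'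
    set h := g'⁻¹ * b * g' with hh_def
    -- After `g'` is moved to the left, the middle part is `z₂ h₂ h z₁ h₁ y⁻¹`. Collecting the
    -- opposite line factors leaves `h₂ h h₁ y⁻¹`, an element of `P`.
    have hz₃ : z₂ * ((h₂ * h) * z₁ * (h₂ * h)⁻¹) ∈ η.unipotent (-lineWeight (m + 2)) :=
      mul_mem hz₂ (conj_mem_of_le_normalizer hNH (mul_mem hh₂ hh) hz₁)
    obtain ⟨y₂, hy₂, x₂, hx₂, e₃⟩ := η.unipotent_neg_line_eq (by omega) hz₃
    refine ⟨T * (k * (b * c * b⁻¹)) * T⁻¹ * (g' * y₂),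
      mul_mem (η.unipotent_tailWeight_le hk') (Subgroup.mem_sup_right (mul_mem hg' hy₂)),
      x₂, hx₂, (h₂ * h * h₁) * (y⁻¹ * p),
      mul_mem (Subgroup.mem_sup_left (mul_mem (mul_mem hh₂ hh) hh₁))
        (mul_mem (inv_mem (Subgroup.mem_sup_right hy2)) hp), ?_⟩
    have e4 : g = c * g' * y⁻¹ := by rw [hg'_def]; group
    have e5 : x = y * (z₁ * h₁) * y⁻¹ := by rw [← e₁]; group
    have e6 : T = g' * (z₂ * h₂) * g'⁻¹ := by rw [← e₂]; group
    have e7 : b = g' * h * g'⁻¹ := by rw [hh_def]; group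
    have e8 : x₂ = y₂⁻¹ * (z₂ * ((h₂ * h) * z₁ * (h₂ * h)⁻¹)) := by rw [e₃]; group
    clear_value h g'
    rw [e8, e4, e5, e7, e6]
    group
  have step' : ∀ T : OddUnitary R Δ,
      T ∈ (η.flagParabolic : Set (OddUnitary R Δ)) ∪ η.oppositeCorner → ∀ y : OddUnitary R Δ,
      (∃ q ∈ η.flagParabolic,
        ∃ x ∈ η.unipotent (-lineWeight (m + 2)) ⊓ η.unipotent (-flagWeight (m + 2)),
        ∃ p ∈ η.levi (lineWeight (m + 2)) ⊔ η.unipotent (lineWeight (m + 2)), y = q * x * p) →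
      ∃ q ∈ η.flagParabolic,
        ∃ x ∈ η.unipotent (-lineWeight (m + 2)) ⊓ η.unipotent (-flagWeight (m + 2)),
        ∃ p ∈ η.levi (lineWeight (m + 2)) ⊔ η.unipotent (lineWeight (m + 2)),
          T * y = q * x * p := by
    rintro T (hT | hT) _ ⟨q, hq, x, hx, p, hp, rfl⟩
    · exact ⟨T * q, mul_mem hT hq, x, hx, p, hp, by group⟩
    · exact step T hT q hq x hx p hp
  have hg' := η.E_le_sup (by omega) hg
  rw [Subgroup.sup_eq_closure] at hg'
  clear hg
  induction hg' using Subgroup.closure_induction_left with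
  | one => exact ⟨1, one_mem _, 1, one_mem _, 1, one_mem _, by simp⟩
  | mul_left T hT y hy ih => exact step' T hT y ih
  | inv_mul_cancel T hT y hy ih =>
    exact step' T⁻¹ (hT.imp (fun h => inv_mem h) fun h => inv_mem h) y ih

end FreeHyperbolicFamily

section

variable {G : Type*} [Group G]

/-- For a generating set closed under inversion no inverse step is needed; this suits one-sided
matrix conditions whose stability under inverses is not evident. -/
lemma closure_induction_of_inv_mem {S : Set G} (hS : ∀ s ∈ S, s⁻¹ ∈ S) {p : G → Prop}
    (mem : ∀ s ∈ S, p s) (one : p 1) (mul : ∀ a b, p a → p b → p (a * b)) {g : G}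
    (hg : g ∈ Subgroup.closure S) : p g := by
  induction hg using Subgroup.closure_induction_left with
  | one => exact one
  | mul_left s hs y _ ih => exact mul _ _ (mem s hs) ih
  | inv_mul_cancel s hs y _ ih => exact mul _ _ (mem _ (hS s hs)) ih

end

namespace FreeHyperbolicFamily

open OddFormRing.Model SignedIndex
open OddUnitary (mat mat_mul β_mul mat_injective mat_one eq_one_of_mat mat_inv proj_mat β_inv)

variable {R Δ : Type*} [NonUnitalRing R] [StarRing R] [AddGroup Δ] [OddFormRing R Δ] {n : ℕ}
  (η : FreeHyperbolicFamily R Δ n)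

/-! ### The unitary groups of smaller rank -/

/-- The condition on `act g.γ (η.e i)` can be tested in the model, since `ρ` of this element
vanishes together with `g.β * η.e i`. -/
lemma mem_U_iff {m : ℕ} {g : OddUnitary R Δ} :
    g ∈ η.U m ↔ ∀ i : SignedIndex n, ¬ IdxLE m i →
      η.e i * g.β = 0 ∧ g.mat * emb Δ (η.e i) = 0 := by
  refine forall₂_congr fun i hi => ⟨fun ⟨h1, h2, h3⟩ => ⟨h1, ?_⟩, fun ⟨h1, h2⟩ => ?_⟩
  · rw [mat, ← vec_act, h3, map_zero]
  · have h3 : g.β * η.e i = 0 := by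
      have := congrArg proj h2
      rwa [map_mul, proj_mat, proj_emb, map_zero] at this
    refine ⟨h1, h3, eq_of_vec_of_ρ (R := R) ?_ ?_⟩
    · rw [vec_act, map_zero]
      exact h2
    · rw [ρ_act, g.ρ_γ, ρ_zero, ← star_mul, h3, star_zero, zero_mul]

lemma E_le_U (m : ℕ) : η.E m ≤ η.U m := by
  rw [E, Subgroup.closure_le]
  rintro _ (⟨i, j, hij, x, hx, h1, h2, rfl⟩ | ⟨k, u, hu, h1, rfl⟩)
  · refine η.mem_U_iff.2 fun k hk => ?_
    have ki : k.1 ≠ i.1 := fun h => hk (by unfold IdxLE at *; rwa [h])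
    have kj : k.1 ≠ j.1 := fun h => hk (by unfold IdxLE at *; rwa [h])
    have hx' := η.star_mem_peirce hx
    constructor
    · rw [β_short, mul_sub, η.mul_eq_zero_of_ne (η.e_idem k) (η.mem_peirce_left hx) (ne_of_fst ki),
        η.mul_eq_zero_of_ne (η.e_idem k) (η.mem_peirce_left hx') (ne_of_fst (j := j.opp) kj),
        sub_zero]
    · rw [mat_short, sub_mul, emb_mul_emb_zero, emb_mul_emb_zero, sub_zero]
      · exact η.mul_eq_zero_of_ne (η.mem_peirce_right hx') (η.e_idem k)
          (ne_of_fst (i := i.opp) ki.symm)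
      · exact η.mul_eq_zero_of_ne (η.mem_peirce_right hx) (η.e_idem k) (ne_of_fst kj.symm)
  · refine η.mem_U_iff.2 fun l hl => ?_
    have kl : l.1 ≠ k.1 := fun h => hl (by unfold IdxLE at *; rwa [h])
    have hr := η.mem_delta0At_ρ hu
    constructor
    · rw [β_ultrashort, mul_sub, mul_add, hu.1,
        η.mul_eq_zero_of_ne (η.e_idem l) (η.mem_peirce_left hr) (ne_of_fst (j := k.opp) kl),
        η.mul_eq_zero_of_ne (η.e_idem l) (η.e_mul_star_π hu) (ne_of_fst (j := k.opp) kl)]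
      simp
    · rw [mat_ultrashort, add_mul, sub_mul, emb_mul_emb_zero, emb_mul_emb_zero,
        η.vec_mul_zero hu (η.e_idem l) (ne_of_fst kl.symm)]
      · simp
      · exact η.star_π_mul_e hu.1 l
      · exact η.mul_eq_zero_of_ne (η.mem_peirce_right hr) (η.e_idem l) (ne_of_fst kl.symm)

/-! ### The unipotent radicals of the line parabolic subgroups -/

section Line

variable {η} {w : Fin n → ℤ} {r : SignedIndex n}

lemma sub_mul_e_eq {g : OddUnitary R Δ}
    (h : g.mat = g.mat * emb Δ (η.e r) + η.qv r.opp * emb Δ (g.β - g.β * η.e r)) :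
    g.β - g.β * η.e r = η.e r.opp * (g.β - g.β * η.e r) := by
  have := congrArg proj h
  rw [map_add, map_mul, map_mul, proj_mat, proj_emb, proj_emb, proj_qv] at this
  rw [sub_eq_iff_eq_add, add_comm]
  exact this

lemma mat_mul_eq_zero {g : OddUnitary R Δ} {x : R}
    (h : g.mat = g.mat * emb Δ (η.e r) + η.qv r.opp * emb Δ (g.β - g.β * η.e r))
    (h' : g.β * η.e r.opp = 0) (hx : x = η.e r.opp * x) : g.mat * emb Δ x = 0 := by
  have a3 : g.mat * emb Δ (η.e r.opp) = 0 := by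
    rw [h, add_mul, mul_assoc, mul_assoc, ← map_mul, ← map_mul, e_mul_e_opp, sub_mul, h',
      mul_assoc, e_mul_e_opp]
    simp
  rw [hx, map_mul, ← mul_assoc, a3, zero_mul]

/-- The generators of the unipotent radical have nonzero entries only in the column `r` and in the
row `-r`. -/
lemma unipotent_line_aux (hw : ∀ i j, i.1 ≠ j.1 → wt w j < wt w i → j = r ∨ i = r.opp)
    (hk : ∀ k, wt w k < 0 → k = r) {g : OddUnitary R Δ} (hg : g ∈ η.unipotent w) :
    g.mat = g.mat * emb Δ (η.e r) + η.qv r.opp * emb Δ (g.β - g.β * η.e r) ∧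
      g.β * η.e r.opp = 0 := by
  have col : ∀ (i : SignedIndex n) (h : i.1 ≠ r.1) (x : R) (hx : x ∈ η.peirce i r),
      (η.shortTransvection i r h x hx).mat = (η.shortTransvection i r h x hx).mat * emb Δ (η.e r)
        + η.qv r.opp * emb Δ ((η.shortTransvection i r h x hx).β -
          (η.shortTransvection i r h x hx).β * η.e r) ∧
      (η.shortTransvection i r h x hx).β * η.e r.opp = 0 := by
    intro i h x hx
    have hx' := η.star_mem_peirce hx
    have z1 := η.mul_eq_zero_of_ne (η.mem_peirce_right hx') (η.e_idem r) (ne_of_fst (i := i.opp) h)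
    have z2 := η.mul_eq_zero_of_ne (η.mem_peirce_right hx') (η.e_idem r.opp)
      (ne_of_fst (i := i.opp) (j := r.opp) h)
    have z3 := η.mul_eq_zero_of_ne (η.mem_peirce_right hx) (η.e_idem r.opp) (ne_opp r)
    rw [mat_short, β_short, sub_mul, sub_mul, emb_mul_emb_zero z1, sub_mul, z1, z2, z3,
      mul_assoc, ← map_mul, η.mem_peirce_right hx]
    simp only [map_sub, mul_sub, sub_zero, and_true]
    abel
  induction hg using Subgroup.closure_induction with
  | mem g hg =>
    rcases hg with ⟨i, j, hij, x, hx, h, rfl⟩ | ⟨k, u, hu, h, rfl⟩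
    · rcases hw i j hij h with rfl | rfl
      · exact col _ _ _ _
      · have hij' : j.opp.1 ≠ r.opp.opp.1 := hij.symm
        rw [η.shortTransvection_flip _ j hij x hx hij']
        simp only [opp_opp]
        exact col _ _ _ _
    · obtain rfl := hk k h
      have hr := η.mem_delta0At_ρ hu
      have z1 := η.star_π_mul_e hu.1 k
      have z2 := η.star_π_mul_e hu.1 k.opp
      have z3 := η.mul_eq_zero_of_ne (η.mem_peirce_right hr) (η.e_idem k.opp) (ne_opp k)
      have z4 := η.mul_eq_zero_of_ne (η.mem_delta0At_π hu) (η.e_idem k.opp) (ne_opp k)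
      rw [mat_ultrashort, β_ultrashort, add_mul, sub_mul, emb_mul_emb_zero z1, mul_assoc,
        ← map_mul, η.mem_peirce_right hr, η.vec_mul_e hu]
      simp only [sub_mul, add_mul, z1, z2, z3, z4, η.mem_peirce_right hr, η.mem_delta0At_π hu]
      simp only [map_sub, map_add, mul_sub, mul_add, map_zero, mul_zero]
      constructor <;> abel
  | one => simp [mat_one, OddUnitary.β_one]
  | mul a b _ _ ha hb =>
    obtain ⟨a1, a2⟩ := ha
    obtain ⟨b1, b2⟩ := hb
    -- Outside the column `r`, the second factor has entries only in row `-r`, and `a` has zero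
    -- column `-r`; so the shape survives multiplication.
    have a4 := mat_mul_eq_zero a1 a2 (sub_mul_e_eq b1)
    have a5 : a.β * (b.β - b.β * η.e r) = 0 := by
      rw [sub_mul_e_eq b1, ← mul_assoc, a2, zero_mul]
    constructor
    · have key : (a * b).mat - ((a * b).mat * emb Δ (η.e r) +
          η.qv r.opp * emb Δ ((a * b).β - (a * b).β * η.e r)) =
          (a.mat - (a.mat * emb Δ (η.e r) + η.qv r.opp * emb Δ (a.β - a.β * η.e r))) +
          (b.mat - (b.mat * emb Δ (η.e r) + η.qv r.opp * emb Δ (b.β - b.β * η.e r))) +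
          a.mat * emb Δ (b.β - b.β * η.e r) -
          η.qv r.opp * emb Δ (a.β * (b.β - b.β * η.e r)) := by
        rw [mat_mul, β_mul]
        simp only [map_sub, map_add, map_mul, mul_sub, mul_add, add_mul, mul_assoc]
        abel
      rw [← sub_eq_zero, key, a4, a5, sub_eq_zero.2 a1, sub_eq_zero.2 b1]
      simp
    · rw [β_mul, add_mul, add_mul, mul_assoc, a2, b2]
      simp
  | inv a _ ha =>
    obtain ⟨a1, a2⟩ := ha
    have a3 : star a.β - star a.β * η.e r = η.e r.opp * (star a.β - star a.β * η.e r) := by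
      have := congrArg star (sub_mul_e_eq a1)
      simp only [star_sub, star_mul, star_e, opp_opp, sub_mul] at this
      rw [mul_sub, sub_eq_sub_iff_sub_eq_sub, this, ← mul_assoc]
    have a4 := mat_mul_eq_zero a1 a2 a3
    have a5 : a.β * (star a.β - star a.β * η.e r) = 0 := by
      rw [a3, ← mul_assoc, a2, zero_mul]
    have e1 : star a.β = -(a.β * star a.β) - a.β := by
      rw [← sub_eq_zero, ← a.mul_star]; abel
    have e2 : star a.β = -(star a.β * a.β) - a.β := by
      rw [← sub_eq_zero, ← a.star_mul]; abel
    constructor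
    · have key : -(a.mat * emb Δ (star a.β)) - a.mat -
          ((-(a.mat * emb Δ (star a.β)) - a.mat) * emb Δ (η.e r) +
          η.qv r.opp * emb Δ ((-(a.β * star a.β) - a.β) - (-(a.β * star a.β) - a.β) * η.e r)) =
          -(a.mat - (a.mat * emb Δ (η.e r) + η.qv r.opp * emb Δ (a.β - a.β * η.e r))) -
          a.mat * emb Δ (star a.β - star a.β * η.e r) +
          η.qv r.opp * emb Δ (a.β * (star a.β - star a.β * η.e r)) := by
        simp only [map_sub, map_neg, map_mul, mul_sub, sub_mul, mul_neg, neg_mul, mul_assoc]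
        abel
      rw [← e1, a4, a5, sub_eq_zero.2 a1] at key
      rw [← sub_eq_zero, mat_inv, β_inv, key]
      simp
    · rw [β_inv, e2, sub_mul, neg_mul, mul_assoc, a2]
      simp

/-- An element of the unipotent radical is determined by its column `r`. -/
lemma eq_one_of_mem_unipotent_line
    (hw : ∀ i j, i.1 ≠ j.1 → wt w j < wt w i → j = r ∨ i = r.opp)
    (hk : ∀ k, wt w k < 0 → k = r) {g : OddUnitary R Δ} (hg : g ∈ η.unipotent w)
    (h : g.mat * emb Δ (η.e r) = 0) : g = 1 := by
  have h0 : g.β * η.e r = 0 := by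
    have := congrArg proj h
    rwa [map_mul, proj_mat, proj_emb, map_zero] at this
  obtain ⟨a1, -⟩ := unipotent_line_aux hw hk hg
  rw [h, zero_add, h0, sub_zero] at a1
  have a2 : η.e r.opp * g.β = g.β := by
    have := congrArg proj a1
    rw [map_mul, proj_mat, proj_emb, proj_qv] at this
    exact this.symm
  have a3 : star g.β * η.e r = star g.β := by
    have := congrArg star a2
    rwa [star_mul, star_e, opp_opp] at this
  -- Multiplying the unitarity relation by `e_r` on the right gives `β star β + star β = 0`;
  -- subtracting it from that relation gives `β = 0`.
  have a4 : g.β = 0 := by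
    have h1 := g.mul_star
    have h2 := congrArg (· * η.e r) h1
    simp only [add_mul, mul_assoc, a3, h0, zero_mul, add_zero] at h2
    rwa [add_right_comm, h2, zero_add] at h1
  exact eq_one_of_mat (by rw [a1, a4, map_zero, mul_zero])

lemma mat_mul_e_opp_of_mem_unipotent_line
    (hw : ∀ i j, i.1 ≠ j.1 → wt w j < wt w i → j = r ∨ i = r.opp)
    (hk : ∀ k, wt w k < 0 → k = r) {g : OddUnitary R Δ} (hg : g ∈ η.unipotent w) :
    g.mat * emb Δ (η.e r.opp) = 0 := by
  obtain ⟨a1, a2⟩ := unipotent_line_aux hw hk hg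
  exact mat_mul_eq_zero a1 a2 (η.e_idem _).symm

/-- This supplies the hypotheses of the preceding lemmas with `r = -n`; the opposite radical
corresponds to `r = n`. -/
lemma of_lineWeight_lt {l : Fin n} (hl : l.val + 1 = n) :
    (∀ i j, i.1 ≠ j.1 → wt (lineWeight n) j < wt (lineWeight n) i →
      j = (l, false) ∨ i = (l, true)) ∧ ∀ k, wt (lineWeight n) k < 0 → k = (l, false) := by
  have key : ∀ k, wt (lineWeight n) k < 0 → k = (l, false) := by
    intro k hk
    rcases lineWeight_cases k with ⟨-, h⟩ | ⟨h, h'⟩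
    · omega
    · refine Prod.ext (Fin.ext (by dsimp only; omega)) ?_
      by_contra h2
      rw [if_pos (by simpa using h2)] at h'
      omega
  refine ⟨fun i j hij h => ?_, key⟩
  by_cases hj : wt (lineWeight n) j < 0
  · exact Or.inl (key j hj)
  · refine Or.inr ?_
    rw [← opp_opp i, key i.opp (by rw [wt_opp]; omega)]
    rfl

end Line

end FreeHyperbolicFamily

/-! ### Matrix shape of the flag subgroups, and Weyl elements -/

namespace FreeHyperbolicFamily

open OddFormRing.Model SignedIndex
open OddUnitary (mat mat_mul β_mul mat_injective mat_one eq_one_of_mat mat_inv proj_mat β_inv)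

variable {R Δ : Type*} [NonUnitalRing R] [StarRing R] [AddGroup Δ] [OddFormRing R Δ] {n : ℕ}
  (η : FreeHyperbolicFamily R Δ n)

lemma inv_mem_unipotentGenerators {w : Fin n → ℤ} {g : OddUnitary R Δ}
    (hg : g ∈ η.unipotentGenerators w) : g⁻¹ ∈ η.unipotentGenerators w := by
  rcases hg with ⟨i, j, hij, x, hx, h, rfl⟩ | ⟨k, u, hu, h, rfl⟩
  · exact Or.inl ⟨i, j, hij, -x, η.neg_mem_peirce hx, h, η.shortTransvection_inv i j hij x hx⟩
  · exact Or.inr ⟨k, -u, η.neg_mem_delta0At hu, h, η.ultrashortTransvection_inv k u hu⟩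

lemma le_two_of_flagSet {i : SignedIndex n} (hi : i ∉ flagSet n) :
    wt (flagWeight n) i < 2 := by
  rcases i with ⟨i, _ | _⟩ <;> rw [mem_flagSet] at hi <;>
    simp only [wt_true, wt_false, flagWeight] at hi ⊢ <;> split_ifs <;> simp at hi <;> omega

lemma flagWeight_of_mem {i : SignedIndex n} (hi : i ∈ flagSet n) : wt (flagWeight n) i = 2 := by
  rcases i with ⟨i, _ | _⟩ <;> rw [mem_flagSet] at hi
  · simp at hi
  · rw [wt_true, flagWeight, if_neg]
    have := hi.1
    dsimp only at this
    omega

lemma two_le_iff {i : SignedIndex n} : 2 ≤ wt (flagWeight n) i ↔ i ∈ flagSet n := by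
  constructor
  · intro h
    by_contra h'
    have := le_two_of_flagSet h'
    omega
  · exact fun h => (flagWeight_of_mem h).ge

lemma flagWeight_le (i : SignedIndex n) : wt (flagWeight n) i ≤ 2 := by
  by_cases h : i ∈ flagSet n
  · exact (flagWeight_of_mem h).le
  · exact (le_two_of_flagSet h).le

lemma vec_mul_es {k : SignedIndex n} {u : Δ} (hu : u ∈ η.delta0At k)
    {A : Finset (SignedIndex n)} (hk : k ∉ A) : (vec u : Model R Δ) * emb Δ (η.es A) = 0 := by
  rw [← η.vec_mul_e hu, mul_assoc, ← map_mul, η.mul_es_of_notMem (η.e_idem k) hk, map_zero,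
    mul_zero]

lemma star_π_mul_es {u : Δ} (hu : u ∈ η.delta0) (A : Finset (SignedIndex n)) :
    star (π u : R) * η.es A = 0 := by
  rw [es, Finset.mul_sum]
  exact Finset.sum_eq_zero fun i _ => η.star_π_mul_e hu i

lemma es_mul_π {u : Δ} (hu : u ∈ η.delta0) (A : Finset (SignedIndex n)) :
    η.es A * (π u : R) = 0 := by
  rw [es, Finset.sum_mul]
  exact Finset.sum_eq_zero fun i _ => hu i

lemma mat_ultrashort_mul_es {k : SignedIndex n} {u : Δ} (hu : u ∈ η.delta0At k)
    (hk : k ∉ flagSet n) :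
    (η.ultrashortTransvection k u hu).mat * emb Δ (η.es (flagSet n)) = 0 := by
  rw [mat_ultrashort, add_mul, sub_mul, emb_mul_emb_zero, emb_mul_emb_zero, η.vec_mul_es hu hk]
  · simp
  · exact η.star_π_mul_es hu.1 _
  · exact η.mul_es_of_notMem (η.mem_peirce_right (η.mem_delta0At_ρ hu)) hk

/-- The elements of the flag parabolic subgroup preserve the submodule given by `2, …, n`. -/
lemma mat_mul_es_of_mem_flagParabolic {q : OddUnitary R Δ} (hq : q ∈ η.flagParabolic) :
    q.mat * emb Δ (η.es (flagSet n)) =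
      η.qs (flagSet n) * emb Δ (q.β * η.es (flagSet n)) := by
  rw [flagParabolic, unipotent, levi, ← Subgroup.closure_union] at hq
  refine closure_induction_of_inv_mem (p := fun q => q.mat * emb Δ (η.es (flagSet n)) =
      η.qs (flagSet n) * emb Δ (q.β * η.es (flagSet n))) ?_ ?_ ?_ ?_ hq
  · exact fun s hs => hs.imp (fun h => η.inv_mem_unipotentGenerators h)
      fun h => η.inv_mem_leviGenerators h
  · have short : ∀ (i j : SignedIndex n) (hij : i.1 ≠ j.1) (x : R) (hx : x ∈ η.peirce i j),
        wt (flagWeight n) j ≤ wt (flagWeight n) i →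
        (η.shortTransvection i j hij x hx).mat * emb Δ (η.es (flagSet n)) =
        η.qs (flagSet n) * emb Δ ((η.shortTransvection i j hij x hx).β * η.es (flagSet n)) := by
      intro i j hij x hx h
      have key : ∀ (i j : SignedIndex n) (x : R) (hx : x ∈ η.peirce i j),
          wt (flagWeight n) j ≤ wt (flagWeight n) i →
          η.qv i * emb Δ x * emb Δ (η.es (flagSet n)) =
          η.qs (flagSet n) * emb Δ (x * η.es (flagSet n)) := by
        intro i j x hx h
        by_cases hj : j ∈ flagSet n
        · have hi : i ∈ flagSet n := two_le_iff.1 ((two_le_iff.2 hj).trans h)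
          rw [mul_assoc, ← map_mul, η.mul_es_of_mem (η.mem_peirce_right hx) hj,
            η.qs_mul_of_mem (η.mem_peirce_left hx) hi]
        · rw [mul_assoc, ← map_mul, η.mul_es_of_notMem (η.mem_peirce_right hx) hj, map_zero,
            mul_zero, mul_zero]
      rw [mat_short, β_short, sub_mul, key i j x hx h, key j.opp i.opp _ (η.star_mem_peirce hx)
        (by simpa using h), sub_mul, map_sub, mul_sub]
    rintro _ ((⟨i, j, hij, x, hx, h, rfl⟩ | ⟨k, u, hu, h, rfl⟩) |
      (⟨i, j, hij, x, hx, h, rfl⟩ | ⟨k, u, hu, h, rfl⟩))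
    · exact short i j hij x hx h.le
    · have h0 := η.mat_ultrashort_mul_es hu fun hk => by
        have := flagWeight_of_mem hk
        omega
      have h1 := congrArg proj h0
      rw [map_mul, proj_mat, proj_emb, map_zero] at h1
      rw [h0, h1, map_zero, mul_zero]
    · exact short i j hij x hx h.le
    · exact absurd h (flagWeight_ne_zero k)
  · simp [mat_one, OddUnitary.β_one]
  · intro a b ha hb
    have h1 : b.β * η.es (flagSet n) = η.es (flagSet n) * (b.β * η.es (flagSet n)) := by
      have := congrArg proj hb
      rwa [map_mul, map_mul, proj_mat, proj_emb, proj_emb, proj_qs] at this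
    have h2 : a.mat * emb Δ (b.β * η.es (flagSet n)) =
        η.qs (flagSet n) * emb Δ (a.β * (b.β * η.es (flagSet n))) := by
      rw [h1, map_mul, ← mul_assoc, ha, ← mul_assoc a.β, map_mul _ (a.β * _), mul_assoc]
    rw [mat_mul, β_mul, add_mul, add_mul, mul_assoc, ← map_mul, h2, ha, hb]
    simp only [add_mul, map_add, mul_add, mul_assoc]

/-- The indices `2, …, n` have the largest flag weight, so no root of negative weight has an entry
in their rows. -/
lemma es_mul_β_of_mem_unipotent_neg {g : OddUnitary R Δ} (hg : g ∈ η.unipotent (-flagWeight n)) :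
    η.es (flagSet n) * g.β = 0 := by
  refine closure_induction_of_inv_mem (p := fun g => η.es (flagSet n) * g.β = 0)
    (fun s hs => η.inv_mem_unipotentGenerators hs) ?_ ?_ ?_ hg
  · rintro _ (⟨i, j, hij, x, hx, h, rfl⟩ | ⟨k, u, hu, h, rfl⟩) <;> simp only [wt_neg] at h
    · have hx' := η.star_mem_peirce hx
      rw [β_short, mul_sub, η.es_mul_of_notMem (η.mem_peirce_left hx),
        η.es_mul_of_notMem (η.mem_peirce_left hx'), sub_zero]
      · intro hj
        have h1 := flagWeight_of_mem hj
        have h2 := flagWeight_le i.opp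
        rw [wt_opp] at h1 h2
        omega
      · intro hi
        have h1 := flagWeight_of_mem hi
        have h2 := flagWeight_le j
        omega
    · have hk : k.opp ∉ flagSet n := fun hk => by
        have h1 := flagWeight_of_mem hk
        rw [wt_opp] at h1
        omega
      rw [β_ultrashort, mul_sub, mul_add, η.es_mul_π hu.1,
        η.es_mul_of_notMem (η.mem_peirce_left (η.mem_delta0At_ρ hu)) hk,
        η.es_mul_of_notMem (η.e_mul_star_π hu) hk]
      simp
  · simp [OddUnitary.β_one]
  · intro a b ha hb
    rw [β_mul, mul_add, mul_add, ← mul_assoc, ha, hb]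
    simp

/-- Dually, a root of positive flag weight has no entry in a column of largest weight: the radical
acts trivially on the span of `2, …, n`. -/
lemma mat_mul_es_of_mem_unipotent {g : OddUnitary R Δ} (hg : g ∈ η.unipotent (flagWeight n)) :
    g.mat * emb Δ (η.es (flagSet n)) = 0 := by
  refine closure_induction_of_inv_mem (p := fun g => g.mat * emb Δ (η.es (flagSet n)) = 0)
    (fun s hs => η.inv_mem_unipotentGenerators hs) ?_ ?_ ?_ hg
  · rintro _ (⟨i, j, hij, x, hx, h, rfl⟩ | ⟨k, u, hu, h, rfl⟩)
    · have hx' := η.star_mem_peirce hx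
      rw [mat_short, sub_mul, emb_mul_emb_zero, emb_mul_emb_zero, sub_zero]
      · refine η.mul_es_of_notMem (η.mem_peirce_right hx') fun hi => ?_
        have h1 := flagWeight_of_mem hi
        have h2 := flagWeight_le j.opp
        rw [wt_opp] at h1 h2
        omega
      · refine η.mul_es_of_notMem (η.mem_peirce_right hx) fun hj => ?_
        have h1 := flagWeight_of_mem hj
        have h2 := flagWeight_le i
        omega
    · exact η.mat_ultrashort_mul_es hu fun hk => by
        have := flagWeight_of_mem hk
        omega
  · simp [mat_one]
  · intro a b ha hb
    have h1 : b.β * η.es (flagSet n) = 0 := by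
      have := congrArg proj hb
      rwa [map_mul, proj_mat, proj_emb, map_zero] at this
    rw [mat_mul, add_mul, add_mul, mul_assoc, ← map_mul, h1, ha, hb]
    simp

/-- Roots of positive flag weight have nonnegative line weight, so they lie in the radical of the
line or in its Levi subgroup. -/
lemma unipotent_flag_eq_line (hn : 3 ≤ n) {g : OddUnitary R Δ}
    (hg : g ∈ η.unipotent (flagWeight n)) :
    ∃ u ∈ η.unipotent (lineWeight n), ∃ h ∈ η.levi (lineWeight n), g = u * h := by
  refine exists_mul_of_le_normalizer (S := η.unipotentGenerators (flagWeight n))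
    (η.levi_le_normalizer _) ?_ hg
  rintro _ (⟨i, j, hij, x, hx, h, rfl⟩ | ⟨k, u, hu, h, rfl⟩)
  · rcases lt_trichotomy (wt (lineWeight n) j) (wt (lineWeight n) i) with h' | h' | h'
    · exact Or.inr (η.short_mem_unipotent hij hx h')
    · exact Or.inl (η.short_mem_levi hij hx h')
    · exact absurd (flagWeight_le_of_lineWeight_lt hn h') (by omega)
  · rcases lt_trichotomy (wt (lineWeight n) k) 0 with h' | h' | h'
    · exact Or.inr (η.ultrashort_mem_unipotent hu h')
    · exact Or.inl (η.ultrashort_mem_levi hu h')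
    · have := flagWeight_neg_of_lineWeight_neg (n := n) (k := k.opp) (by rw [wt_opp]; omega)
      rw [wt_opp] at this
      omega

/-! ### Conjugation by a Weyl element -/

lemma short_conj_short_right {i j l : SignedIndex n} (hij : i.1 ≠ j.1) (hjl : j.1 ≠ l.1)
    (hil : i.1 ≠ l.1) {x y z : R} (hx : x ∈ η.peirce i j) (hy : y ∈ η.peirce j l)
    (hz : z ∈ η.peirce i l) (h : z = x * y) :
    η.shortTransvection i j hij x hx * η.shortTransvection j l hjl y hy *
      (η.shortTransvection i j hij x hx)⁻¹ =
      η.shortTransvection i l hil z hz * η.shortTransvection j l hjl y hy := by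
  subst h
  exact conj_eq_of_mul_eq (η.short_mul_short_comp hij hjl hil hx hy)

lemma short_conj_short_left {i j l : SignedIndex n} (hij : i.1 ≠ j.1) (hjl : j.1 ≠ l.1)
    (hil : i.1 ≠ l.1) {x y z : R} (hx : x ∈ η.peirce i j) (hy : y ∈ η.peirce j l)
    (hz : z ∈ η.peirce i l) (h : z = -(x * y)) :
    η.shortTransvection j l hjl y hy * η.shortTransvection i j hij x hx *
      (η.shortTransvection j l hjl y hy)⁻¹ =
      η.shortTransvection i l hil z hz * η.shortTransvection i j hij x hx := by
  subst h
  rw [← η.shortTransvection_inv i l hil _ (η.mul_mem_peirce hx hy), mul_inv_eq_iff_eq_mul, mul_assoc,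
    η.short_mul_short_comp hij hjl hil hx hy, inv_mul_cancel_left]

/-- Conjugation by the Weyl element `T_{ol}(a) T_{lo}(-b) T_{ol}(a)` replaces the index `l`
by `o`. -/
lemma weyl_conj_col {i o l : SignedIndex n} (hio : i.1 ≠ o.1) (hil : i.1 ≠ l.1) (hol : o.1 ≠ l.1)
    {a b x : R} (ha : a ∈ η.peirce o l) (hb : b ∈ η.peirce l o) (hba : b * a = η.e l)
    (hx : x ∈ η.peirce i l) :
    (η.shortTransvection o l hol a ha * η.shortTransvection l o hol.symm (-b)
      (η.neg_mem_peirce hb) * η.shortTransvection o l hol a ha) *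
      η.shortTransvection i l hil x hx * (η.shortTransvection o l hol a ha *
      η.shortTransvection l o hol.symm (-b) (η.neg_mem_peirce hb) *
      η.shortTransvection o l hol a ha)⁻¹ =
      η.shortTransvection i o hio (x * b) (η.mul_mem_peirce hx hb) := by
  have hxb := η.mul_mem_peirce hx hb
  set T := η.shortTransvection o l hol a ha
  set S := η.shortTransvection l o hol.symm (-b) (η.neg_mem_peirce hb)
  set X := η.shortTransvection i l hil x hx with hX
  set Y := η.shortTransvection i o hio (x * b) hxb
  have c1 : T * X * T⁻¹ = X := conj_eq_of_commute
    (η.commute_short_short hol hil ha hx (ne_of_fst hil.symm) (ne_of_fst hol) (ne_opp l)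
      (ne_of_fst (j := i.opp) hio.symm))
  have c2 : S * X * S⁻¹ = Y * X := η.short_conj_short_left hil hol.symm hio hx _ hxb (by simp)
  have c3 : T * Y * T⁻¹ = X⁻¹ * Y := by
    rw [hX, η.shortTransvection_inv i l hil x hx]
    exact η.short_conj_short_left hio hol hil hxb ha _ (by
      rw [mul_assoc, hba, η.mem_peirce_right hx])
  have c4 : Y * X = X * Y := η.commute_short_short hio hil hxb hx (ne_of_fst hio.symm)
    (ne_of_fst hil) (ne_of_fst (j := l.opp) hol) (ne_opp i)
  calc T * S * T * X * (T * S * T)⁻¹ = T * (S * (T * X * T⁻¹) * S⁻¹) * T⁻¹ := by group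
    _ = T * (Y * X) * T⁻¹ := by rw [c1, c2]
    _ = (T * Y * T⁻¹) * (T * X * T⁻¹) := by group
    _ = Y := by rw [c1, c3, mul_assoc, c4]; group

/-- The companion of `weyl_conj_col` for rows: the first conjugation by `T` creates `Y * X`,
conjugation by `S` cancels `X`, and the last `T` commutes with `Y`. -/
lemma weyl_conj_row {j o l : SignedIndex n} (hoj : o.1 ≠ j.1) (hlj : l.1 ≠ j.1) (hol : o.1 ≠ l.1)
    {a b x : R} (ha : a ∈ η.peirce o l) (hb : b ∈ η.peirce l o) (hba : b * a = η.e l)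
    (hx : x ∈ η.peirce l j) :
    (η.shortTransvection o l hol a ha * η.shortTransvection l o hol.symm (-b)
      (η.neg_mem_peirce hb) * η.shortTransvection o l hol a ha) *
      η.shortTransvection l j hlj x hx * (η.shortTransvection o l hol a ha *
      η.shortTransvection l o hol.symm (-b) (η.neg_mem_peirce hb) *
      η.shortTransvection o l hol a ha)⁻¹ =
      η.shortTransvection o j hoj (a * x) (η.mul_mem_peirce ha hx) := by
  have hax := η.mul_mem_peirce ha hx
  set T := η.shortTransvection o l hol a ha
  set S := η.shortTransvection l o hol.symm (-b) (η.neg_mem_peirce hb)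
  set X := η.shortTransvection l j hlj x hx with hX
  set Y := η.shortTransvection o j hoj (a * x) hax
  have c1 : T * X * T⁻¹ = Y * X := η.short_conj_short_right hol hlj hoj ha hx hax rfl
  have c2 : S * X * S⁻¹ = X := conj_eq_of_commute
    (η.commute_short_short hol.symm hlj _ hx (ne_of_fst hol) (ne_of_fst hlj)
      (ne_of_fst (j := j.opp) hoj) (ne_opp l))
  have c3 : S * Y * S⁻¹ = X⁻¹ * Y := by
    rw [hX, η.shortTransvection_inv l j hlj x hx]
    exact η.short_conj_short_right hol.symm hoj hlj _ hax _ (by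
      rw [neg_mul, ← mul_assoc, hba, η.mem_peirce_left hx])
  have c4 : Y * X = X * Y := η.commute_short_short hoj hlj hax hx (ne_of_fst hlj.symm)
    (ne_of_fst hoj) (ne_opp j) (ne_of_fst (j := l.opp) hol)
  have c5 : T * Y * T⁻¹ = Y := conj_eq_of_commute
    (η.commute_short_short hol hoj ha hax (ne_of_fst hol.symm) (ne_of_fst hoj)
      (ne_of_fst (j := j.opp) hlj) (ne_opp o))
  calc T * S * T * X * (T * S * T)⁻¹ = T * (S * (T * X * T⁻¹) * S⁻¹) * T⁻¹ := by group
    _ = T * ((S * Y * S⁻¹) * (S * X * S⁻¹)) * T⁻¹ := by rw [c1]; group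
    _ = T * Y * T⁻¹ := by rw [c2, c3, mul_assoc X⁻¹, c4]; group
    _ = Y := c5

end FreeHyperbolicFamily

/-! ### Linear elements fixing the last vector, and the absolute intersection property -/

namespace FreeHyperbolicFamily

open OddFormRing.Model SignedIndex
open OddUnitary (mat mat_mul β_mul mat_injective mat_one eq_one_of_mat mat_inv proj_mat β_inv)

variable {R Δ : Type*} [NonUnitalRing R] [StarRing R] [AddGroup Δ] [OddFormRing R Δ] {n : ℕ}
  (η : FreeHyperbolicFamily R Δ n)

/-- If the column `i` is trivial, unitarity forces the dual row `-i` to be trivial: multiply `star β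
* β + β + star β = 0` by `e_{-i}` on the left. -/
lemma e_mul_β_eq_zero {g : OddUnitary R Δ} {i : SignedIndex n} (h : g.β * η.e i = 0) :
    η.e i.opp * g.β = 0 := by
  have h1 := congrArg star h
  rw [star_mul, star_e, star_zero] at h1
  have h2 := congrArg (η.e i.opp * ·) g.star_mul
  simpa only [mul_add, ← mul_assoc, h1, zero_mul, zero_add, add_zero, mul_zero] using h2

lemma β_mul_e_eq_zero {g : OddUnitary R Δ} {i : SignedIndex n} (h : η.e i * g.β = 0) :
    g.β * η.e i.opp = 0 := by
  have h1 := congrArg star h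
  rw [star_mul, star_e, star_zero] at h1
  have h2 := congrArg (· * η.e i.opp) g.mul_star
  simpa only [add_mul, mul_assoc, h1, mul_zero, zero_mul, zero_add, add_zero] using h2

lemma mem_U_of_mem_levi {g : OddUnitary R Δ} (hg : g ∈ η.levi (flagWeight n)) {l : Fin n}
    (hl : l.val + 1 = n) (h1 : g.β * η.e (l, true) = 0) (h2 : η.e (l, true) * g.β = 0) :
    g ∈ η.U (n - 1) := by
  have h3 : η.e (l, false) * g.β = 0 := η.e_mul_β_eq_zero h1
  have h4 : g.β * η.e (l, false) = 0 := η.β_mul_e_eq_zero h2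
  rw [mem_U_iff]
  rintro ⟨i, s⟩ hi
  obtain rfl : i = l := Fin.ext (by
    have : ¬ i.val < n - 1 := hi
    have := i.isLt
    omega)
  rw [η.mat_of_mem_levi hg, mul_assoc, ← map_mul]
  cases s
  · exact ⟨h3, by rw [h4, map_zero, mul_zero]⟩
  · exact ⟨h2, by rw [h1, map_zero, mul_zero]⟩

lemma commute_short_of_mem_levi {g : OddUnitary R Δ} (hg : g ∈ η.levi (flagWeight n))
    {i j : SignedIndex n} (hij : i.1 ≠ j.1) {x : R} (hx : x ∈ η.peirce i j)
    (h1 : g.β * η.e i = 0) (h2 : η.e j * g.β = 0) :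
    Commute (η.shortTransvection i j hij x hx) g := by
  have h3 := η.e_mul_β_eq_zero h1
  have h4 := η.β_mul_e_eq_zero h2
  have hx' := η.star_mem_peirce hx
  have z1 : x * g.β = 0 := by rw [← η.mem_peirce_right hx, mul_assoc, h2, mul_zero]
  have z2 : star x * g.β = 0 := by rw [← η.mem_peirce_right hx', mul_assoc, h3, mul_zero]
  have z3 : g.β * x = 0 := by rw [← η.mem_peirce_left hx, ← mul_assoc, h1, zero_mul]
  have z4 : g.β * star x = 0 := by rw [← η.mem_peirce_left hx', ← mul_assoc, h4, zero_mul]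
  apply mat_injective
  rw [mat_mul, mat_mul, mat_short, β_short, sub_mul, emb_mul_emb_zero z1, emb_mul_emb_zero z2,
    η.mat_of_mem_levi hg, mul_assoc _ (emb Δ g.β) (emb Δ (x - star x)), ← map_mul, mul_sub, z3, z4]
  simp only [sub_zero, map_zero, mul_zero]
  abel

/-- The elements of the Levi subgroup of the flag that fix the last basis vector are elementary of
smaller rank. -/
lemma levi_inf_U_le (hn : 3 ≤ n) : η.levi (flagWeight n) ⊓ η.U (n - 1) ≤ η.E (n - 1) := by
  intro g hg
  obtain ⟨hgL, hgU⟩ := Subgroup.mem_inf.1 hg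
  obtain ⟨o, ho⟩ : ∃ o : Fin n, o.val = 0 := ⟨⟨0, by omega⟩, rfl⟩
  obtain ⟨l, hl⟩ : ∃ l : Fin n, l.val + 1 = n := ⟨⟨n - 1, by omega⟩, by dsimp only; omega⟩
  have hol : ((o, true) : SignedIndex n).1 ≠ ((l, true) : SignedIndex n).1 := fun h => by
    have : o.val = l.val := congrArg Fin.val h
    omega
  obtain ⟨b, hb, a, ha, hba⟩ := η.exists_matrix_units true l o
  have hgl := hgU (l, true) (by change ¬ l.val < n - 1; omega)
  -- A Weyl element for the indices `1` and `n`. Since `g` is trivial at both, it commutes with `g`,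
  -- and `g` may be replaced by its conjugate.
  have hw : Commute (η.shortTransvection (o, true) (l, true) hol a ha *
      η.shortTransvection (l, true) (o, true) hol.symm (-b) (η.neg_mem_peirce hb) *
      η.shortTransvection (o, true) (l, true) hol a ha) g := by
    have c1 := η.commute_short_of_mem_levi hgL hol ha
      (η.β_mul_e_of_mem_levi hgL ho) hgl.1
    have c2 := η.commute_short_of_mem_levi hgL hol.symm (η.neg_mem_peirce hb)
      hgl.2.1 (η.e_mul_β_of_mem_levi hgL ho)
    exact (c1.mul_left c2).mul_left c1
  rw [← conj_eq_of_commute hw]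
  set w := η.shortTransvection (o, true) (l, true) hol a ha *
      η.shortTransvection (l, true) (o, true) hol.symm (-b) (η.neg_mem_peirce hb) *
      η.shortTransvection (o, true) (l, true) hol a ha with hw_def
  have gen : ∀ {i j : SignedIndex n} (hij : i.1 ≠ j.1) {x : R} (hx : x ∈ η.peirce i j),
      i.1 ≠ l → j.1 ≠ l → η.shortTransvection i j hij x hx ∈ η.E (n - 1) := by
    intro i j hij x hx hi hj
    have key : ∀ k : Fin n, k ≠ l → k.val < n - 1 := fun k hk => by
      have := k.isLt
      have : k.val ≠ l.val := fun h => hk (Fin.ext h)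
      omega
    exact Subgroup.subset_closure (Or.inl ⟨i, j, hij, x, hx, key _ hi, key _ hj, rfl⟩)
  clear hw hgl hgU hg
  -- The conjugate of each generator of the Levi subgroup has `n` replaced by `1`, an index not
  -- occurring among `2, …, n`; so it lies in `E(n - 1)`.
  refine η.levi_flag_induction (p := fun g => w * g * w⁻¹ ∈ η.E (n - 1)) hgL ?_ ?_ ?_ ?_
  · intro i j hij x hx hi hj
    have hio : ∀ {i : SignedIndex n}, i ∈ flagSet n → i.1 ≠ o := fun hi h => by
      have := (mem_flagSet.1 hi).1
      rw [h] at this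
      omega
    have hF : ∀ {i : SignedIndex n}, i ∈ flagSet n → i.1 = l → i = (l, true) := fun hi h =>
      Prod.ext h (mem_flagSet.1 hi).2
    by_cases hil : i.1 = l
    · obtain rfl := hF hi hil
      rw [η.weyl_conj_row (o := (o, true)) (hio hj).symm hij hol ha hb hba hx]
      exact gen _ _ hol hij.symm
    · by_cases hjl : j.1 = l
      · obtain rfl := hF hj hjl
        rw [η.weyl_conj_col (o := (o, true)) (hio hi) hij hol ha hb hba hx]
        exact gen _ _ hil hol
      · have hc : Commute w (η.shortTransvection i j hij x hx) := by
          have c1 := η.commute_short_short hol hij ha hx (ne_of_fst (Ne.symm hil))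
            (ne_of_fst (hio hj).symm) (ne_of_fst (i := (l, true)) (j := j.opp) (Ne.symm hjl))
            (ne_of_fst (i := (o, true)) (j := i.opp) (hio hi).symm)
          have c2 := η.commute_short_short hol.symm hij (η.neg_mem_peirce hb) hx
            (ne_of_fst (hio hi).symm) (ne_of_fst (Ne.symm hjl))
            (ne_of_fst (i := (o, true)) (j := j.opp) (hio hj).symm)
            (ne_of_fst (i := (l, true)) (j := i.opp) (Ne.symm hil))
          exact (c1.mul_left c2).mul_left c1
        rw [conj_eq_of_commute hc]
        exact gen _ _ hil hjl
  · simp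
  · intro a b ha hb
    simpa [mul_assoc] using mul_mem ha hb
  · intro a ha
    simpa [mul_assoc] using inv_mem ha

/-- Reduction to a smaller rank in injective stability. -/
theorem U_inf_E_le {m : ℕ} (hm : 1 ≤ m) (η : FreeHyperbolicFamily R Δ (m + 2))
    (hsr : CornerStableRankLE (η.e (0, true)) m) : η.U (m + 1) ⊓ η.E (m + 2) ≤ η.E (m + 1) := by
  intro g hg
  obtain ⟨hgU, hgE⟩ := Subgroup.mem_inf.1 hg
  obtain ⟨q, hq, x, hx, p, hp, rfl⟩ := exists_decomposition hm η hsr hgE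
  obtain ⟨hx1, hx2⟩ := Subgroup.mem_inf.1 hx
  have hH : η.levi (lineWeight (m + 2)) = η.E (m + 1) := η.levi_lineWeight
  obtain ⟨u, hu, h, hh, rfl⟩ : ∃ u ∈ η.unipotent (lineWeight (m + 2)),
      ∃ h ∈ η.levi (lineWeight (m + 2)), p = u * h := by
    rw [Subgroup.sup_eq_closure] at hp
    exact exists_mul_of_le_normalizer (η.levi_le_normalizer _) (fun s hs => hs) hp
  obtain ⟨l, hl⟩ : ∃ l : Fin (m + 2), l.val + 1 = m + 2 := ⟨Fin.last (m + 1), rfl⟩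
  obtain ⟨hw1, hw2⟩ := of_lineWeight_lt hl
  have hlF : (l, true) ∈ flagSet (m + 2) := mem_flagSet.2 ⟨by dsimp only; omega, rfl⟩
  have hfl := η.es_mul_of_mem (η.e_idem _) hlF
  have hlf := η.mul_es_of_mem (η.e_idem _) hlF
  have hlU : ∀ {g : OddUnitary R Δ}, g ∈ η.U (m + 1) →
      η.e (l, true) * g.β = 0 ∧ g.mat * emb Δ (η.e (l, true)) = 0 := fun hg =>
    η.mem_U_iff.1 hg (l, true) (by change ¬ l.val < m + 1; omega)
  have hhE : h ∈ η.E (m + 1) := hH ▸ hh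
  have hg' : q * x * u ∈ η.U (m + 1) := by
    have := mul_mem hgU (inv_mem (η.E_le_U _ hhE))
    rwa [show q * x * (u * h) * h⁻¹ = q * x * u by group] at this
  have hue : u.mat * emb Δ (η.e (l, true)) = 0 :=
    mat_mul_e_opp_of_mem_unipotent_line (r := (l, false)) hw1 hw2 hu
  have β_of_mat : ∀ {g : OddUnitary R Δ}, g.mat * emb Δ (η.e (l, true)) = 0 →
      g.β * η.e (l, true) = 0 := fun h => by
    have := congrArg proj h
    rwa [map_mul, proj_mat, proj_emb, map_zero] at this
  -- Since `u` and `q x u` fix the last basis vector, `x` and `q⁻¹` have the same column `n`. For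
  -- `q⁻¹ - 1` that column lies in the span of `2, …, n`, while `x - 1` has zero rows there. So the
  -- column of `x - 1` vanishes, and it determines `x`.
  have hx0 : x = 1 := by
    refine eq_one_of_mem_unipotent_line (η := η) (w := -lineWeight (m + 2)) (r := (l, true)) ?_ ?_
      hx1 ?_
    · intro i j hij h
      rcases hw1 j i hij.symm (by simpa using h) with rfl | rfl
      · exact Or.inr rfl
      · exact Or.inl rfl
    · intro k hk
      rw [← opp_opp k, hw2 k.opp (by simpa using hk)]
      rfl
    · have e1 : (x * u).mat * emb Δ (η.e (l, true)) = x.mat * emb Δ (η.e (l, true)) := by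
        rw [mat_mul, add_mul, add_mul, mul_assoc, ← map_mul, β_of_mat hue, hue]
        simp
      have e2 : (x * u).mat * emb Δ (η.e (l, true)) = (q⁻¹).mat * emb Δ (η.e (l, true)) := by
        rw [show x * u = q⁻¹ * (q * x * u) by group, mat_mul, add_mul, add_mul, mul_assoc,
          ← map_mul, β_of_mat (hlU hg').2, (hlU hg').2]
        simp
      have e3 : (q⁻¹).mat * emb Δ (η.e (l, true)) =
          η.qs (flagSet (m + 2)) * emb Δ ((q⁻¹).β * η.e (l, true)) := by
        have := congrArg (· * emb Δ (η.e (l, true)))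
          (η.mat_mul_es_of_mem_flagParabolic (inv_mem hq))
        simpa only [mul_assoc, ← map_mul, hfl] using this
      have e4 : x.β * η.e (l, true) = η.es (flagSet (m + 2)) * ((q⁻¹).β * η.e (l, true)) := by
        have := congrArg proj (e1.symm.trans (e2.trans e3))
        rwa [map_mul, map_mul, proj_mat, proj_emb, proj_emb, proj_qs] at this
      have e5 : η.es (flagSet (m + 2)) * ((q⁻¹).β * η.e (l, true)) = 0 := by
        rw [← η.es_mul_es (subset_refl (flagSet (m + 2))), mul_assoc, ← e4, ← mul_assoc,
          η.es_mul_β_of_mem_unipotent_neg hx2, zero_mul]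
      rw [← e1, e2, e3, ← η.qs_mul_es (subset_refl (flagSet (m + 2))), mul_assoc, ← map_mul, e5,
        map_zero, mul_zero]
  subst hx0
  rw [mul_one] at hg' hgU ⊢
  have hquQ : q * u ∈ η.flagParabolic := mul_mem hq (η.unipotent_lineWeight_le (by omega) hu)
  rw [← mul_assoc]
  refine mul_mem ?_ hhE
  obtain ⟨v, hv, s, hs, e⟩ := η.mem_flagParabolic.1 hquQ
  rw [e] at hg' ⊢
  have hvf := η.mat_mul_es_of_mem_unipotent hv
  have hvf' : v.β * η.es (flagSet (m + 2)) = 0 := by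
    have := congrArg proj hvf
    rwa [map_mul, proj_mat, proj_emb, map_zero] at this
  -- The radical factor `v` acts trivially on the span of `2, …, n`, which `s` preserves; so the
  -- trivial column and row `n` of `v * s` are inherited by `s`.
  have hsU : s ∈ η.U (m + 1) := by
    refine η.mem_U_of_mem_levi hs hl ?_ ?_
    · have h1 := β_of_mat (hlU hg').2
      have h2 : v.β * s.β * η.e (l, true) = 0 := by
        rw [← hfl, mul_assoc, ← mul_assoc s.β, ← η.es_mul_β hs, ← mul_assoc, ← mul_assoc, hvf']
        simp
      have h3 : v.β * η.e (l, true) = 0 := by rw [← hfl, ← mul_assoc, hvf', zero_mul]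
      rw [β_mul, add_mul, add_mul, h2, h3, zero_add, zero_add] at h1
      exact h1
    · have h1 := congrArg (· * η.es (flagSet (m + 2))) (hlU hg').1
      have h2 : v.β * s.β * η.es (flagSet (m + 2)) = 0 := by
        rw [mul_assoc, ← η.es_mul_β hs, ← mul_assoc, hvf', zero_mul]
      simp only [β_mul, mul_assoc, add_mul, hvf', zero_mul] at h1
      rw [← mul_assoc v.β, h2, zero_add, zero_add, ← η.es_mul_β hs, ← mul_assoc, hlf] at h1
      exact h1
  refine mul_mem ?_ (η.levi_inf_U_le (by omega) (Subgroup.mem_inf.2 ⟨hs, hsU⟩))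
  have hvU : v ∈ η.U (m + 1) := by
    have := mul_mem hg' (inv_mem hsU)
    rwa [mul_inv_cancel_right] at this
  obtain ⟨u₂, hu₂, h₂, hh₂, rfl⟩ := η.unipotent_flag_eq_line (by omega) hv
  rw [hH] at hh₂
  have hu₂U : u₂ ∈ η.U (m + 1) := by
    have := mul_mem hvU (inv_mem (η.E_le_U _ hh₂))
    rwa [mul_inv_cancel_right] at this
  -- An element of the radical of the line is determined by its column `-n`, which is trivial in
  -- rank `n - 1`.
  have : u₂ = 1 := eq_one_of_mem_unipotent_line (r := (l, false)) hw1 hw2 hu₂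
    (η.mem_U_iff.1 hu₂U (l, false) (by change ¬ l.val < m + 1; omega)).2
  rw [this, one_mul]
  exact hh₂

end FreeHyperbolicFamily

/-! ### The case of rank two, and injectivity from intersections -/

namespace FreeHyperbolicFamily

open OddFormRing.Model SignedIndex
open OddUnitary (mat mat_mul β_mul mat_injective mat_one eq_one_of_mat mat_inv proj_mat β_inv)

variable {R Δ : Type*} [NonUnitalRing R] [StarRing R] [AddGroup Δ] [OddFormRing R Δ] {n : ℕ}
  (η : FreeHyperbolicFamily R Δ n)

lemma e_eq_zero {k : Fin n} (h : η.e (k, true) = 0) (i : SignedIndex n) : η.e i = 0 := by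
  have key : ∀ j, η.e (j, true) = 0 := fun j => by
    obtain ⟨a, ha, b, -, hab⟩ := η.exists_matrix_units true j k
    rw [← hab, ← η.mem_peirce_right ha, h]
    simp
  rcases i with ⟨j, _ | _⟩
  · have := congrArg star (key j)
    rwa [star_e, star_zero] at this
  · exact key j

lemma E_eq_bot (h : ∀ i, η.e i = 0) (m : ℕ) : η.E m = ⊥ := by
  rw [E, Subgroup.closure_eq_bot_iff]
  rintro _ (⟨i, j, hij, x, hx, -, -, rfl⟩ | ⟨k, u, hu, -, rfl⟩)
  · have : x = 0 := by rw [← η.mem_peirce_left hx, h, zero_mul]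
    subst this
    exact η.shortTransvection_zero i j hij
  · have : u = 0 := by rw [← hu.2, h, act_zero]
    subst this
    exact eq_one_of_mat (by simp [mat_ultrashort, ρ_zero, π_zero])

theorem U_inf_E_pred_le (hn : 2 ≤ n) {o : Fin n} (ho : o.val = 0)
    (hsr : CornerStableRankLE (η.e (o, true)) (n - 2)) :
    η.U (n - 1) ⊓ η.E n ≤ η.E (n - 1) := by
  obtain ⟨m, rfl⟩ : ∃ m, n = m + 2 := ⟨n - 2, by omega⟩
  obtain rfl : o = 0 := Fin.ext ho
  rcases Nat.eq_zero_or_pos m with rfl | hm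
  -- For `n = 2` the hypothesis reads `sr ≤ 0`: shortening a unimodular sequence of length one
  -- leaves the empty sum, so `e_1 = 0` and all transvections are trivial.
  · obtain ⟨a, z, -, -, h⟩ := hsr (fun _ => η.e _) (fun _ => η.e _) (fun _ => ⟨e_idem _ _, e_idem _ _⟩)
      (fun _ => ⟨e_idem _ _, e_idem _ _⟩) (by simp [e_idem])
    rw [η.E_eq_bot (η.e_eq_zero h.symm)]
    exact inf_le_right.trans bot_le
  · exact η.U_inf_E_le hm hsr

lemma KU_map_injective {m m' : ℕ} (hm : m ≤ m') (h : η.U m ⊓ η.E m' ≤ η.E m) :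
    Function.Injective (KU.map η hm) := by
  intro a b
  induction a using Quotient.inductionOn'
  induction b using Quotient.inductionOn'
  rename_i a b
  intro hab
  have h1 := QuotientGroup.leftRel_apply.1 (Quotient.exact' hab)
  refine Quotient.sound' (QuotientGroup.leftRel_apply.2 ?_)
  rw [Subgroup.mem_subgroupOf] at h1 ⊢
  exact h ⟨(a⁻¹ * b).2, h1⟩

lemma relKU_map_injective (J : OddFormIdeal R Δ) {m m' : ℕ} (hm : m ≤ m')
    (h : η.relU J m ⊓ η.relE J m' ≤ η.relE J m) : Function.Injective (relKU.map η J hm) := by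
  intro a b
  induction a using Quotient.inductionOn'
  induction b using Quotient.inductionOn'
  rename_i a b
  intro hab
  have h1 := QuotientGroup.leftRel_apply.1 (Quotient.exact' hab)
  refine Quotient.sound' (QuotientGroup.leftRel_apply.2 ?_)
  rw [Subgroup.mem_subgroupOf] at h1 ⊢
  exact h ⟨(a⁻¹ * b).2, h1⟩

end FreeHyperbolicFamily

/-! ### The fibre product odd form ring of an ideal -/

namespace OddFormIdeal

variable {R Δ : Type*} [NonUnitalRing R] [StarRing R] [AddGroup Δ] [OddFormRing R Δ]
  (J : OddFormIdeal R Δ)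

instance : J.Γ.Normal := J.normal

/-- The fibre product `R ×_{R / I} R`. -/
def fibreRing : NonUnitalSubring (R × R) where
  carrier := {x | x.1 - x.2 ∈ J.I}
  zero_mem' := by
    change (0 : R) - 0 ∈ J.I
    rw [sub_zero]
    exact J.I.zero_mem
  add_mem' := by
    intro x y hx hy
    change x.1 + y.1 - (x.2 + y.2) ∈ J.I
    rw [add_sub_add_comm]
    exact J.I.add_mem hx hy
  neg_mem' := by
    intro x hx
    change -x.1 - -x.2 ∈ J.I
    rw [neg_sub_neg, ← neg_sub]
    exact J.I.neg_mem hx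
  mul_mem' := by
    intro x y hx hy
    change x.1 * y.1 - x.2 * y.2 ∈ J.I
    have : x.1 * y.1 - x.2 * y.2 = (x.1 - x.2) * y.1 + x.2 * (y.1 - y.2) := by noncomm_ring
    rw [this]
    exact J.I.add_mem (J.I.mul_mem_right _ _ hx) (J.I.mul_mem_left _ _ hy)

lemma add_neg_mem_iff {u v : Δ} : u - v ∈ J.Γ ↔ (u : Δ ⧸ J.Γ) = v :=
  QuotientAddGroup.eq_iff_sub_mem.symm

/-- The fibre product `Δ ×_{Δ / Γ} Δ`. -/
def fibreForm : AddSubgroup (Δ × Δ) where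
  carrier := {u | u.1 - u.2 ∈ J.Γ}
  zero_mem' := by
    change (0 : Δ) - 0 ∈ J.Γ
    simp
  add_mem' := by
    intro u v hu hv
    have hu' := J.add_neg_mem_iff.1 hu
    have hv' := J.add_neg_mem_iff.1 hv
    refine J.add_neg_mem_iff.2 ?_
    change ((u.1 + v.1 : Δ) : Δ ⧸ J.Γ) = ((u.2 + v.2 : Δ) : Δ ⧸ J.Γ)
    rw [QuotientAddGroup.mk_add, QuotientAddGroup.mk_add, hu', hv']
  neg_mem' := by
    intro u hu
    have hu' := J.add_neg_mem_iff.1 hu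
    refine J.add_neg_mem_iff.2 ?_
    change ((-u.1 : Δ) : Δ ⧸ J.Γ) = ((-u.2 : Δ) : Δ ⧸ J.Γ)
    rw [QuotientAddGroup.mk_neg, QuotientAddGroup.mk_neg, hu']

lemma star_sub_mem {x y : R} (h : x - y ∈ J.I) : star x - star y ∈ J.I := by
  rw [← star_sub]
  exact J.star_mem _ h

/-- Expand `act u x` along `x = y + (x - y)`: the last two terms lie in `Γ` since `x - y` lies in
`I`, and the first depends on `u` only modulo `Γ`. -/
lemma act_sub_mem {u v : Δ} {x y : R} (hu : u - v ∈ J.Γ) (hx : x - y ∈ J.I) :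
    act u x - act v y ∈ J.Γ := by
  have h1 : act u x = act u y + φ (star (x - y) * ρ u * y) + act u (x - y) := by
    rw [← act_add, add_sub_cancel]
  have h2 : act u y = act (u - v) y + act v y := by rw [← add_act, sub_add_cancel]
  rw [add_neg_mem_iff, h1, h2]
  have h3 : ((act (u - v) y : Δ) : Δ ⧸ J.Γ) = 0 :=
    (QuotientAddGroup.eq_zero_iff _).2 (J.act_mem _ hu _)
  have h4 : ((act u (x - y) : Δ) : Δ ⧸ J.Γ) = 0 :=
    (QuotientAddGroup.eq_zero_iff _).2 (J.act_mem_of_mem _ _ hx)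
  have h5 : ((φ (star (x - y) * ρ u * y) : Δ) : Δ ⧸ J.Γ) = 0 :=
    (QuotientAddGroup.eq_zero_iff _).2 (J.φ_mem _ (J.I.mul_mem_right _ _
      (J.I.mul_mem_right _ _ (J.star_mem _ hx))))
  rw [QuotientAddGroup.mk_add, QuotientAddGroup.mk_add, QuotientAddGroup.mk_add, h3, h4, h5]
  simp

lemma φ_sub_mem {x y : R} (h : x - y ∈ J.I) : (φ x : Δ) - φ y ∈ J.Γ := by
  rw [sub_eq_add_neg, ← φ_neg, ← φ_add, ← sub_eq_add_neg]
  exact J.φ_mem _ h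

lemma π_sub_mem {u v : Δ} (h : u - v ∈ J.Γ) : (π u : R) - π v ∈ J.I := by
  rw [sub_eq_add_neg, ← π_neg, ← π_add, ← sub_eq_add_neg]
  exact J.π_mem _ h

lemma ρ_sub_mem {u v : Δ} (h : u - v ∈ J.Γ) : (ρ u : R) - ρ v ∈ J.I := by
  have h1 : (ρ u : R) = ρ (u - v) - star (π (u - v)) * π v + ρ v := by
    rw [← ρ_add, sub_add_cancel]
  rw [h1, add_sub_cancel_right]
  exact J.I.sub_mem (J.ρ_mem _ h) (J.I.mul_mem_right _ _ (J.star_mem _ (J.π_mem _ h)))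

instance : StarRing J.fibreRing where
  star x := ⟨star x.1, J.star_sub_mem x.2⟩
  star_involutive x := Subtype.ext (star_star x.1)
  star_mul x y := Subtype.ext (star_mul x.1 y.1)
  star_add x y := Subtype.ext (star_add x.1 y.1)

instance : OddFormRing J.fibreRing J.fibreForm where
  act u x := ⟨(act u.1.1 x.1.1, act u.1.2 x.1.2), J.act_sub_mem u.2 x.2⟩
  φ x := ⟨(φ x.1.1, φ x.1.2), J.φ_sub_mem x.2⟩
  π u := ⟨(π u.1.1, π u.1.2), J.π_sub_mem u.2⟩
  ρ u := ⟨(ρ u.1.1, ρ u.1.2), J.ρ_sub_mem u.2⟩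
  act_mul _ _ _ := Subtype.ext (Prod.ext (act_mul _ _ _) (act_mul _ _ _))
  add_act _ _ _ := Subtype.ext (Prod.ext (add_act _ _ _) (add_act _ _ _))
  π_add _ _ := Subtype.ext (Prod.ext (π_add _ _) (π_add _ _))
  π_act _ _ := Subtype.ext (Prod.ext (π_act _ _) (π_act _ _))
  φ_add _ _ := Subtype.ext (Prod.ext (φ_add _ _) (φ_add _ _))
  φ_conj _ _ := Subtype.ext (Prod.ext (φ_conj _ _) (φ_conj _ _))
  φ_hermitian _ h := Subtype.ext (Prod.ext
    (φ_hermitian _ (congrArg (fun x => x.1.1) h)) (φ_hermitian _ (congrArg (fun x => x.1.2) h)))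
  add_φ _ _ := Subtype.ext (Prod.ext (add_φ _ _) (add_φ _ _))
  add_swap _ _ := Subtype.ext (Prod.ext (add_swap _ _) (add_swap _ _))
  ρ_add _ _ := Subtype.ext (Prod.ext (ρ_add _ _) (ρ_add _ _))
  star_ρ _ := Subtype.ext (Prod.ext (star_ρ _) (star_ρ _))
  ρ_act _ _ := Subtype.ext (Prod.ext (ρ_act _ _) (ρ_act _ _))
  π_φ _ := Subtype.ext (Prod.ext (π_φ _) (π_φ _))
  ρ_φ _ := Subtype.ext (Prod.ext (ρ_φ _) (ρ_φ _))
  act_add _ _ _ := Subtype.ext (Prod.ext (act_add _ _ _) (act_add _ _ _))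

/-- The diagonal of the fibre product of rings. -/
def diagRing (x : R) : J.fibreRing := ⟨(x, x), by
  change x - x ∈ J.I
  rw [sub_self]
  exact J.I.zero_mem⟩

/-- The diagonal of the fibre product of form parameters. -/
def diagForm (u : Δ) : J.fibreForm := ⟨(u, u), by
  change u - u ∈ J.Γ
  rw [sub_self]
  exact J.Γ.zero_mem⟩

/-- The diagonal of a hyperbolic pair in the fibre product. -/
def diagPair (p : HyperbolicPair R Δ) : HyperbolicPair J.fibreRing J.fibreForm where
  eNeg := J.diagRing p.eNeg
  ePos := J.diagRing p.ePos
  qNeg := J.diagForm p.qNeg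
  qPos := J.diagForm p.qPos
  eNeg_idem := congrArg J.diagRing p.eNeg_idem
  ePos_idem := congrArg J.diagRing p.ePos_idem
  eNeg_mul_ePos := congrArg J.diagRing p.eNeg_mul_ePos
  ePos_mul_eNeg := congrArg J.diagRing p.ePos_mul_eNeg
  star_ePos := congrArg J.diagRing p.star_ePos
  π_qNeg := congrArg J.diagRing p.π_qNeg
  ρ_qNeg := congrArg J.diagRing p.ρ_qNeg
  act_qNeg := congrArg J.diagForm p.act_qNeg
  π_qPos := congrArg J.diagRing p.π_qPos
  ρ_qPos := congrArg J.diagRing p.ρ_qPos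
  act_qPos := congrArg J.diagForm p.act_qPos

/-- The diagonal of a free orthogonal hyperbolic family in the fibre product. -/
def diagFamily {n : ℕ} (η : FreeHyperbolicFamily R Δ n) :
    FreeHyperbolicFamily J.fibreRing J.fibreForm n where
  pair i := J.diagPair (η.pair i)
  orthogonal i j h := congrArg J.diagRing (η.orthogonal i j h)
  free := by
    obtain ⟨E, h1, h2⟩ := η.free
    exact ⟨fun i j => J.diagRing (E i j), fun i => congrArg J.diagRing (h1 i),
      fun i j k => congrArg J.diagRing (h2 i j k)⟩

variable {J}

/-- The first projection of the unitary group of the fibre product. -/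
def fstUnitary : OddUnitary J.fibreRing J.fibreForm →* OddUnitary R Δ where
  toFun g :=
    { β := g.β.1.1
      γ := g.γ.1.1
      mul_star := congrArg (fun x : J.fibreRing => x.1.1) g.mul_star
      star_mul := congrArg (fun x : J.fibreRing => x.1.1) g.star_mul
      π_γ := congrArg (fun x : J.fibreRing => x.1.1) g.π_γ
      ρ_γ := congrArg (fun x : J.fibreRing => x.1.1) g.ρ_γ }
  map_one' := rfl
  map_mul' _ _ := rfl

/-- The second projection of the unitary group of the fibre product. -/
def sndUnitary : OddUnitary J.fibreRing J.fibreForm →* OddUnitary R Δ where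
  toFun g :=
    { β := g.β.1.2
      γ := g.γ.1.2
      mul_star := congrArg (fun x : J.fibreRing => x.1.2) g.mul_star
      star_mul := congrArg (fun x : J.fibreRing => x.1.2) g.star_mul
      π_γ := congrArg (fun x : J.fibreRing => x.1.2) g.π_γ
      ρ_γ := congrArg (fun x : J.fibreRing => x.1.2) g.ρ_γ }
  map_one' := rfl
  map_mul' _ _ := rfl

section Family

variable {n : ℕ} {η : FreeHyperbolicFamily R Δ n}

lemma e_diagFamily (i : SignedIndex n) : (J.diagFamily η).e i = J.diagRing (η.e i) := by
  rcases i with ⟨i, _ | _⟩ <;> rfl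

lemma q_diagFamily (i : SignedIndex n) : (J.diagFamily η).q i = J.diagForm (η.q i) := by
  rcases i with ⟨i, _ | _⟩ <;> rfl

lemma mem_peirce_diagFamily {i j : SignedIndex n} {x : J.fibreRing} :
    x ∈ (J.diagFamily η).peirce i j ↔ x.1.1 ∈ η.peirce i j ∧ x.1.2 ∈ η.peirce i j := by
  change _ * _ * _ = _ ↔ _ * _ * _ = _ ∧ _ * _ * _ = _
  rw [e_diagFamily, e_diagFamily, Subtype.ext_iff, Prod.ext_iff]
  rfl

lemma mem_delta0At_diagFamily {k : SignedIndex n} {u : J.fibreForm} :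
    u ∈ (J.diagFamily η).delta0At k ↔ u.1.1 ∈ η.delta0At k ∧ u.1.2 ∈ η.delta0At k := by
  have h1 : ∀ i, (J.diagFamily η).e i * π u = 0 ↔
      η.e i * π u.1.1 = 0 ∧ η.e i * π u.1.2 = 0 := fun i => by
    rw [e_diagFamily, Subtype.ext_iff, Prod.ext_iff]
    rfl
  have h2 : act u ((J.diagFamily η).e k) = u ↔
      act u.1.1 (η.e k) = u.1.1 ∧ act u.1.2 (η.e k) = u.1.2 := by
    rw [e_diagFamily, Subtype.ext_iff, Prod.ext_iff]
    rfl
  change (∀ i, _) ∧ _ ↔ ((∀ i, _) ∧ _) ∧ (∀ i, _) ∧ _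
  rw [forall_congr' h1, h2, forall_and]
  tauto

lemma mem_U_diagFamily {m : ℕ} {g : OddUnitary J.fibreRing J.fibreForm} :
    g ∈ (J.diagFamily η).U m ↔ fstUnitary g ∈ η.U m ∧ sndUnitary g ∈ η.U m := by
  have h1 : ∀ i, ((J.diagFamily η).e i * g.β = 0 ∧ g.β * (J.diagFamily η).e i = 0 ∧
      act g.γ ((J.diagFamily η).e i) = 0) ↔
      (η.e i * (fstUnitary g).β = 0 ∧ (fstUnitary g).β * η.e i = 0 ∧
        act (fstUnitary g).γ (η.e i) = 0) ∧
      (η.e i * (sndUnitary g).β = 0 ∧ (sndUnitary g).β * η.e i = 0 ∧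
        act (sndUnitary g).γ (η.e i) = 0) := fun i => by
    rw [e_diagFamily, Subtype.ext_iff, Subtype.ext_iff, Subtype.ext_iff, Prod.ext_iff,
      Prod.ext_iff, Prod.ext_iff]
    constructor
    · rintro ⟨⟨a1, a2⟩, ⟨b1, b2⟩, c1, c2⟩
      exact ⟨⟨a1, b1, c1⟩, a2, b2, c2⟩
    · rintro ⟨⟨a1, b1, c1⟩, a2, b2, c2⟩
      exact ⟨⟨a1, a2⟩, ⟨b1, b2⟩, c1, c2⟩
  change (∀ i, _ → _) ↔ (∀ i, _ → _) ∧ ∀ i, _ → _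
  rw [← forall_and]
  refine forall_congr' fun i => ?_
  rw [← imp_and, h1]

lemma fst_short {i j : SignedIndex n} (hij : i.1 ≠ j.1) {x : J.fibreRing}
    (hx : x ∈ (J.diagFamily η).peirce i j) :
    fstUnitary ((J.diagFamily η).shortTransvection i j hij x hx) =
      η.shortTransvection i j hij x.1.1 (mem_peirce_diagFamily.1 hx).1 := by
  refine OddUnitary.ext rfl ?_
  change (act ((J.diagFamily η).q i) x + act ((J.diagFamily η).q j.opp) (-star x) - φ x).1.1 = _
  rw [q_diagFamily, q_diagFamily]
  rfl

lemma snd_short {i j : SignedIndex n} (hij : i.1 ≠ j.1) {x : J.fibreRing}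
    (hx : x ∈ (J.diagFamily η).peirce i j) :
    sndUnitary ((J.diagFamily η).shortTransvection i j hij x hx) =
      η.shortTransvection i j hij x.1.2 (mem_peirce_diagFamily.1 hx).2 := by
  refine OddUnitary.ext rfl ?_
  change (act ((J.diagFamily η).q i) x + act ((J.diagFamily η).q j.opp) (-star x) - φ x).1.2 = _
  rw [q_diagFamily, q_diagFamily]
  rfl

lemma fst_ultrashort {k : SignedIndex n} {u : J.fibreForm}
    (hu : u ∈ (J.diagFamily η).delta0At k) :
    fstUnitary ((J.diagFamily η).ultrashortTransvection k u hu) =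
      η.ultrashortTransvection k u.1.1 (mem_delta0At_diagFamily.1 hu).1 := by
  refine OddUnitary.ext rfl ?_
  change (act ((J.diagFamily η).q k.opp) (ρ u - star (π u)) + u -
    φ (ρ u + π u : J.fibreRing)).1.1 = _
  rw [q_diagFamily]
  rfl

lemma snd_ultrashort {k : SignedIndex n} {u : J.fibreForm}
    (hu : u ∈ (J.diagFamily η).delta0At k) :
    sndUnitary ((J.diagFamily η).ultrashortTransvection k u hu) =
      η.ultrashortTransvection k u.1.2 (mem_delta0At_diagFamily.1 hu).2 := by
  refine OddUnitary.ext rfl ?_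
  change (act ((J.diagFamily η).q k.opp) (ρ u - star (π u)) + u -
    φ (ρ u + π u : J.fibreRing)).1.2 = _
  rw [q_diagFamily]
  rfl

end Family

end OddFormIdeal

/-! ### Relative elementary groups through the fibre product -/

namespace OddFormIdeal

open OddUnitary (mat_injective)
open FreeHyperbolicFamily

variable {R Δ : Type*} [NonUnitalRing R] [StarRing R] [AddGroup Δ] [OddFormRing R Δ]
  {J : OddFormIdeal R Δ} {n : ℕ} {η : FreeHyperbolicFamily R Δ n}

lemma relE_conj_mem {m : ℕ} {a g : OddUnitary R Δ} (ha : a ∈ η.E m) (hg : g ∈ η.relE J m) :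
    a * g * a⁻¹ ∈ η.relE J m := by
  induction hg using Subgroup.closure_induction with
  | mem g hg =>
    obtain ⟨b, hb, t, ht, rfl⟩ := hg
    exact Subgroup.subset_closure ⟨a * b, mul_mem ha hb, t, ht, by group⟩
  | one => simp
  | mul x y _ _ hx hy => simpa [mul_assoc] using mul_mem hx hy
  | inv x _ hx => simpa [mul_assoc] using inv_mem hx

lemma relGenerators_subset_relE (m : ℕ) : η.relGenerators J m ⊆ η.relE J m :=
  fun t ht => Subgroup.subset_closure ⟨1, one_mem _, t, ht, by simp⟩

/-- The elements of the elementary group of the fibre product have components that are congruent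
modulo the relative elementary group. -/
lemma of_mem_E_diagFamily {m : ℕ} {g : OddUnitary J.fibreRing J.fibreForm}
    (hg : g ∈ (J.diagFamily η).E m) :
    sndUnitary g ∈ η.E m ∧ fstUnitary g * (sndUnitary g)⁻¹ ∈ η.relE J m := by
  induction hg using Subgroup.closure_induction with
  | mem g hg =>
    rcases hg with ⟨i, j, hij, x, hx, h1, h2, rfl⟩ | ⟨k, u, hu, h1, rfl⟩
    · obtain ⟨hx1, hx2⟩ := mem_peirce_diagFamily.1 hx
      have hd := η.add_mem_peirce hx1 (η.neg_mem_peirce hx2)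
      rw [fst_short, snd_short, η.shortTransvection_inv, ← η.shortTransvection_add]
      refine ⟨Subgroup.subset_closure (Or.inl ⟨i, j, hij, _, hx2, h1, h2, rfl⟩),
        relGenerators_subset_relE m (Or.inl ⟨i, j, hij, _, hd, h1, h2, ?_, rfl⟩)⟩
      rw [← sub_eq_add_neg]
      exact x.2
    · obtain ⟨hu1, hu2⟩ := mem_delta0At_diagFamily.1 hu
      have hd := η.add_mem_delta0At hu1 (η.neg_mem_delta0At hu2)
      rw [fst_ultrashort, snd_ultrashort, η.ultrashortTransvection_inv,
        ← η.ultrashortTransvection_add]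
      refine ⟨Subgroup.subset_closure (Or.inr ⟨k, _, hu2, h1, rfl⟩),
        relGenerators_subset_relE m (Or.inr ⟨k, _, hd, h1, ?_, rfl⟩)⟩
      rw [← sub_eq_add_neg]
      exact u.2
  | one => simp [one_mem]
  | mul a b _ _ ha hb =>
    refine ⟨by rw [map_mul]; exact mul_mem ha.1 hb.1, ?_⟩
    -- The quotient of components is a crossed homomorphism; the twist by the elementary second
    -- component is harmless because the relative group is normalized by it.
    have e : fstUnitary (a * b) * (sndUnitary (a * b))⁻¹ =
        fstUnitary a * (sndUnitary a)⁻¹ *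
          (sndUnitary a * (fstUnitary b * (sndUnitary b)⁻¹) * (sndUnitary a)⁻¹) := by
      rw [map_mul, map_mul]
      group
    rw [e]
    exact mul_mem ha.2 (relE_conj_mem ha.1 hb.2)
  | inv a _ ha =>
    refine ⟨by rw [map_inv]; exact inv_mem ha.1, ?_⟩
    have e : fstUnitary a⁻¹ * (sndUnitary a⁻¹)⁻¹ =
        (sndUnitary a)⁻¹ * (fstUnitary a * (sndUnitary a)⁻¹)⁻¹ * (sndUnitary a)⁻¹⁻¹ := by
      rw [map_inv, map_inv]
      group
    rw [e]
    exact relE_conj_mem (inv_mem ha.1) (inv_mem ha.2)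

lemma exists_diag_of_mem_E {m : ℕ} {g : OddUnitary R Δ} (hg : g ∈ η.E m) :
    ∃ d ∈ (J.diagFamily η).E m, fstUnitary d = g ∧ sndUnitary d = g := by
  induction hg using Subgroup.closure_induction with
  | mem g hg =>
    rcases hg with ⟨i, j, hij, x, hx, h1, h2, rfl⟩ | ⟨k, u, hu, h1, rfl⟩
    · have hx' : J.diagRing x ∈ (J.diagFamily η).peirce i j := mem_peirce_diagFamily.2 ⟨hx, hx⟩
      exact ⟨_, Subgroup.subset_closure (Or.inl ⟨i, j, hij, _, hx', h1, h2, rfl⟩),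
        fst_short _ _, snd_short _ _⟩
    · have hu' : J.diagForm u ∈ (J.diagFamily η).delta0At k :=
        mem_delta0At_diagFamily.2 ⟨hu, hu⟩
      exact ⟨_, Subgroup.subset_closure (Or.inr ⟨k, _, hu', h1, rfl⟩),
        fst_ultrashort _, snd_ultrashort _⟩
  | one => exact ⟨1, one_mem _, map_one _, map_one _⟩
  | mul a b _ _ ha hb =>
    obtain ⟨c, hc, c1, c2⟩ := ha
    obtain ⟨d, hd, d1, d2⟩ := hb
    exact ⟨c * d, mul_mem hc hd, by rw [map_mul, c1, d1], by rw [map_mul, c2, d2]⟩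
  | inv a _ ha =>
    obtain ⟨c, hc, c1, c2⟩ := ha
    exact ⟨c⁻¹, inv_mem hc, by rw [map_inv, c1], by rw [map_inv, c2]⟩

/-- A relative generator `t` lifts to the pair `(t, 1)`, and conjugation by an elementary `a` lifts
to conjugation by the diagonal pair `(a, a)`. -/
lemma exists_of_mem_relE {m : ℕ} {g : OddUnitary R Δ} (hg : g ∈ η.relE J m) :
    ∃ d ∈ (J.diagFamily η).E m, fstUnitary d = g ∧ sndUnitary d = 1 := by
  induction hg using Subgroup.closure_induction with
  | mem g hg =>
    obtain ⟨a, ha, t, ht, rfl⟩ := hg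
    obtain ⟨c, hc, c1, c2⟩ := exists_diag_of_mem_E (J := J) ha
    have key : ∃ d ∈ (J.diagFamily η).E m, fstUnitary d = t ∧ sndUnitary d = 1 := by
      rcases ht with ⟨i, j, hij, x, hx, h1, h2, h3, rfl⟩ | ⟨k, u, hu, h1, h2, rfl⟩
      · have hx0 : x - 0 ∈ J.I := by rwa [sub_zero]
        have hx' : (⟨(x, 0), hx0⟩ : J.fibreRing) ∈ (J.diagFamily η).peirce i j :=
          mem_peirce_diagFamily.2 ⟨hx, η.zero_mem_peirce i j⟩
        exact ⟨_, Subgroup.subset_closure (Or.inl ⟨i, j, hij, _, hx', h1, h2, rfl⟩),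
          fst_short _ _, (snd_short _ _).trans (η.shortTransvection_zero i j hij)⟩
      · have hu0 : u - 0 ∈ J.Γ := by rwa [sub_zero]
        have h0 : (0 : Δ) ∈ η.delta0At k := by
          have := η.add_mem_delta0At hu (η.neg_mem_delta0At hu)
          rwa [add_neg_cancel] at this
        have hu' : (⟨(u, 0), hu0⟩ : J.fibreForm) ∈ (J.diagFamily η).delta0At k :=
          mem_delta0At_diagFamily.2 ⟨hu, h0⟩
        refine ⟨_, Subgroup.subset_closure (Or.inr ⟨k, _, hu', h1, rfl⟩), fst_ultrashort _, ?_⟩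
        rw [snd_ultrashort]
        exact OddUnitary.eq_one_of_mat (by simp [mat_ultrashort, ρ_zero, π_zero])
    obtain ⟨d, hd, d1, d2⟩ := key
    exact ⟨c * d * c⁻¹, mul_mem (mul_mem hc hd) (inv_mem hc),
      by rw [map_mul, map_mul, map_inv, c1, d1], by rw [map_mul, map_mul, map_inv, c2, d2]; simp⟩
  | one => exact ⟨1, one_mem _, map_one _, map_one _⟩
  | mul a b _ _ ha hb =>
    obtain ⟨c, hc, c1, c2⟩ := ha
    obtain ⟨d, hd, d1, d2⟩ := hb
    exact ⟨c * d, mul_mem hc hd, by rw [map_mul, c1, d1], by rw [map_mul, c2, d2, one_mul]⟩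
  | inv a _ ha =>
    obtain ⟨c, hc, c1, c2⟩ := ha
    exact ⟨c⁻¹, inv_mem hc, by rw [map_inv, c1], by rw [map_inv, c2, inv_one]⟩

variable (J) in
/-- The homomorphism from `I ⋊ R` to the fibre product. -/
def toFibre : IdealSemidirect J.I →ₙ+* J.fibreRing where
  toFun x := ⟨(x.1.1 + x.2, x.2), by
    change x.1.1 + x.2 - x.2 ∈ J.I
    rw [add_sub_cancel_right]
    exact x.1.2⟩
  map_zero' := Subtype.ext (Prod.ext (add_zero _) rfl)
  map_add' x y := Subtype.ext (Prod.ext (add_add_add_comm _ _ _ _) rfl)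
  map_mul' x y := by
    refine Subtype.ext (Prod.ext ?_ rfl)
    change x.1.1 * y.1.1 + x.1.1 * y.2 + x.2 * y.1.1 + x.2 * y.2 =
      (x.1.1 + x.2) * (y.1.1 + y.2)
    noncomm_ring

variable (J) in
/-- The homomorphism from the fibre product to `I ⋊ R`. -/
def ofFibre : J.fibreRing →ₙ+* IdealSemidirect J.I where
  toFun x := (⟨x.1.1 - x.1.2, x.2⟩, x.1.2)
  map_zero' := IdealSemidirect.ext' J.I (sub_zero _) rfl
  map_add' x y := IdealSemidirect.ext' J.I (add_sub_add_comm _ _ _ _) rfl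
  map_mul' x y := by
    refine IdealSemidirect.ext' J.I ?_ rfl
    change x.1.1 * y.1.1 - x.1.2 * y.1.2 = (x.1.1 - x.1.2) * (y.1.1 - y.1.2) +
      (x.1.1 - x.1.2) * y.1.2 + x.1.2 * (y.1.1 - y.1.2)
    noncomm_ring

theorem relU_inf_relE_pred_le (hn : 2 ≤ n) {o : Fin n} (ho : o.val = 0)
    (hsr : CornerStableRankLE (IdealSemidirect.diag J.I (η.e (o, true))) (n - 2)) :
    η.relU J (n - 1) ⊓ η.relE J n ≤ η.relE J (n - 1) := by
  intro g hg
  obtain ⟨hgU, hgE⟩ := Subgroup.mem_inf.1 hg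
  obtain ⟨d, hd, d1, d2⟩ := exists_of_mem_relE hgE
  have e1 : J.toFibre (IdealSemidirect.diag J.I (η.e (o, true))) =
      (J.diagFamily η).e (o, true) := by
    rw [e_diagFamily]
    exact Subtype.ext (Prod.ext (zero_add _) rfl)
  -- The isomorphism sends `(x, y)` to `(x + y, y)`, so stable rank passes from `I ⋊ R` to the fibre
  -- product without any condition on `R` itself.
  have hsr' := hsr.map J.toFibre J.ofFibre
    (fun x => Subtype.ext (Prod.ext (sub_add_cancel _ _) rfl))
    (IdealSemidirect.ext' J.I (add_sub_cancel_right _ _) rfl)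
  rw [e1] at hsr'
  have hdU : d ∈ (J.diagFamily η).U (n - 1) :=
    mem_U_diagFamily.2 ⟨d1 ▸ (Subgroup.mem_inf.1 hgU).1, d2 ▸ one_mem _⟩
  -- The lift `d` has components `g` and `1`; once it is elementary of rank `n - 1`, its quotient of
  -- components is `g` itself.
  have := (of_mem_E_diagFamily ((J.diagFamily η).U_inf_E_pred_le hn ho hsr' ⟨hdU, hd⟩)).2
  rwa [d1, d2, inv_one, mul_one] at this

end OddFormIdeal

theorem mainTheorem2 {R Δ : Type*} [NonUnitalRing R] [StarRing R] [AddGroup Δ]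
    [OddFormRing R Δ] (n : ℕ) (hn : 2 ≤ n) (η : FreeHyperbolicFamily R Δ n) :
    (StableRankLE (η.cornerRing ⟨0, by omega⟩) (n - 2) →
      Function.Injective (FreeHyperbolicFamily.KU.map η (Nat.sub_le n 1))) ∧
    ∀ J : OddFormIdeal R Δ,
      StableRankLE (η.relCornerRing J ⟨0, by omega⟩) (n - 2) →
        Function.Injective (FreeHyperbolicFamily.relKU.map η J (Nat.sub_le n 1)) :=
  ⟨fun h => η.KU_map_injective _ (η.U_inf_E_pred_le hn rfl (h.corner _)),
    fun J h => η.relKU_map_injective J _ (OddFormIdeal.relU_inf_relE_pred_le hn rfl (h.corner _))⟩
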